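/- Let $M>0$ and let $Q,a,m,e\in\mathbb R$. Put $\Delta(r)=r^2-2Mr+a^2+Q^2$, assume that $\Delta$ has a real zero (extreme or non-extreme Kerr–Newman case), let $r_+$ be its largest zero, and let $x$ be a function of $r\in(r_+,\infty)$ with $$\frac{dx}{dr}=\frac{r^2+a^2}{\Delta(r)} .$$ Then $x$ maps $(r_+,\infty)$ bijectively onto $\mathbb R$; write $r=r(x)$ for the inverse. Consider the Dirac equation $(\widehat{\mathfrak R}+\widehat{\mathfrak A})\widehat\Psi=0$ for $\widehat\Psi(r,\theta,\phi,t)\in\mathbb C^4$, $r>r_+$, $0<\theta<\pi$, $\phi,t\in\mathbb R$, where $$\widehat{\mathfrak R}=\begin{pmatrix} imr&0&\sqrt\Delta\,\mathcal D_+&0\\0&-imr&0&\sqrt\Delta\,\mathcal D_-\\ \sqrt\Delta\,\mathcal D_-&0&-imr&0\\0&\sqrt\Delta\,\mathcal D_+&0&imr\end{pmatrix},\qquad \widehat{\mathfrak A}=\begin{pmatrix}-am\cos\theta&0&0&\mathcal L_+\\0&am\cos\theta&-\mathcal L_-&0\\0&\mathcal L_+&-am\cos\theta&0\\-\mathcal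 L_-&0&0&am\cos\theta\end{pmatrix},$$ $$\mathcal D_\pm=\partial_r\pm\tfrac{i}{\Delta}\bigl[(r^2+a^2)\,i\partial_t+a\,i\partial_\phi+eQr\bigr],\qquad \mathcal L_\pm=\partial_\theta+\tfrac{\cot\theta}{2}\mp\bigl[a\sin\theta\, i\partial_t+\tfrac1{\sin\theta}\,i\partial_\phi\bigr].$$ With the Pauli matrices $\sigma_1,\sigma_2,\sigma_3$ and with $r=r(x)$, $\Delta=\Delta(r(x))$ put $$\mathcal S=I+\frac{a\sqrt\Delta\sin\theta}{r^2+a^2}\begin{pmatrix}\sigma_2&\\&-\sigma_2\end{pmatrix},\qquad \mathfrak H=\begin{pmatrix}\mathfrak h_1&\\&-\mathfrak h_1\end{pmatrix}+\mathfrak H_2,$$ $$\mathfrak h_1=-\sigma_3\,i\partial_x-\frac{\sqrt\Delta}{r^2+a^2}\Bigl(\sigma_1\,i\partial_\theta+\sigma_2\frac1{\sin\theta}\,i\partial_\phi\Bigr),$$ $$\mathfrak H_2=-\frac{1}{r^2+a^2}\bigl(a\,i\partial_\phi+eQr\bigr)-\frac{mr\sqrt\Delta}{r^2+a^2}\begin{pmatrix}&I_2\\I_2&\end{pmatrix}+\frac{am\sqrt\Delta\cos\theta}{r^2+a^2}\begin{pmatrix}&iI_2\\-iI_2&\end{pmatrix}.$$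 (1) Let $\Psi(x,\theta,\phi,t)=(\sin\theta)^{1/2}\,\widehat\Psi(r(x),\theta,\phi,t)$. For every $k\in\{1,2,\dots,\infty\}$, $\widehat\Psi$ is a $C^k$ solution of the Dirac equation on $r>r_+$, $0<\theta<\pi$ if and only if $\Psi$ is a $C^k$ solution of $i\partial_t\Psi=\mathcal S^{-1}\mathfrak H\Psi$ on $x\in\mathbb R$, $0<\theta<\pi$; and $\widehat\Psi$ satisfies the boundary condition $\widehat\Psi(r,\theta,\phi+2\pi,t)=-\widehat\Psi(r,\theta,\phi,t)$ if and only if $\Psi$ satisfies $\Psi(x,\theta,\phi+2\pi,t)=-\Psi(x,\theta,\phi,t)$. (2) Let $\Omega_3=\mathbb R\times(0,\pi)\times[0,2\pi)$ and let $C_0^\infty(\Omega_3)^4$ be the space of smooth $\mathbb C^4$-valued functions of $(x,\theta,\phi)\in\mathbb R\times(0,\pi)\times\mathbb R$ with $\Psi(x,\theta,\phi+2\pi)=-\Psi(x,\theta,\phi)$ that vanish for $(x,\theta)$ outside a compact subset of $\mathbb R\times(0,\pi)$. The operator $H_0\Psi=\mathfrak H\Psi$ with domain $C_0^\infty(\Omega_3)^4$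 is essentially selfadjoint in $L^2(\Omega_3)^4$. (3) The operator $\mathcal S^{-1}H_0$ with domain $C_0^\infty(\Omega_3)^4$ is essentially selfadjoint in the Hilbert space $L^2_{\mathcal S}(\Omega_3)^4$, that is, $L^2(\Omega_3)^4$ with the scalar product $$(\Psi,\Phi)_{\mathcal S}=\int_{\mathbb R}\int_0^\pi\int_0^{2\pi}\langle\Psi,\mathcal S\Phi\rangle_{\mathbb C^4}\,d\phi\,d\theta\,dx .$$ -/

import Mathlib

open MeasureTheory Set
open scoped Matrix ContDiff

noncomputable section

/-! ## Essential selfadjointness, minimal operators -/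

/-- A (possibly unbounded) operator in a complex Hilbert space is essentially selfadjoint if it is
densely defined and symmetric and its closure is selfadjoint. -/
def IsEssentiallySelfAdjoint {E : Type*} [NormedAddCommGroup E] [InnerProductSpace ℂ E]
    [CompleteSpace E] (T : E →ₗ.[ℂ] E) : Prop :=
  Dense (T.domain : Set E) ∧ T.IsFormalAdjoint T ∧ T.IsClosable ∧ IsSelfAdjoint T.closure

/-- If `ι : V → E` embeds a space of test functions into `E`, this is the operator in `E` with
domain `ι V` which sends `ι Ψ` to `T Ψ`. -/
def operatorOnTestFunctions {V E : Type*} [AddCommGroup V] [Module ℂ V] [AddCommGroup E]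
    [Module ℂ E] (ι T : V →ₗ[ℂ] E) (hι : Function.Injective ι) : E →ₗ.[ℂ] E where
  domain := LinearMap.range ι
  toFun := T ∘ₗ (LinearEquiv.ofInjective ι hι).symm.toLinearMap

theorem operatorOnTestFunctions_apply {V E : Type*} [AddCommGroup V] [Module ℂ V]
    [AddCommGroup E] [Module ℂ E] (ι T : V →ₗ[ℂ] E) (hι : Function.Injective ι) (v : V) :
    operatorOnTestFunctions ι T hι ⟨ι v, LinearMap.mem_range_self ι v⟩ = T v := by
  have : (LinearEquiv.ofInjective ι hι).symm ⟨ι v, LinearMap.mem_range_self ι v⟩ = v := by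
    rw [LinearEquiv.symm_apply_eq]; rfl
  exact congrArg T this

namespace KerrNewman

/-! ## The exterior region and the tortoise coordinate -/

/-- The function `Δ`. -/
def Delta (M Q a r : ℝ) : ℝ := r ^ 2 - 2 * M * r + a ^ 2 + Q ^ 2

/-- The data of the exterior of a (non-extreme or extreme) Kerr-Newman black hole of mass `M`,
charge `Q` and angular momentum parameter `a`: the function `Δ` has a real zero, `rPlus` is its
largest zero, and `x` is a radial coordinate on `(rPlus, ∞)` with `dx/dr = (r² + a²) / Δ(r)`
(such an `x` is unique up to an additive constant). -/
structure Exterior where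
  M : ℝ
  Q : ℝ
  a : ℝ
  rPlus : ℝ
  x : ℝ → ℝ
  M_pos : 0 < M
  rPlus_isGreatest : IsGreatest {r : ℝ | Delta M Q a r = 0} rPlus
  x_hasDerivAt : ∀ s : ℝ, rPlus < s → HasDerivAt x ((s ^ 2 + a ^ 2) / Delta M Q a s) s

namespace Exterior

variable (K : Exterior)

/-- The function `Δ` of the given black hole. -/
def Δ (r : ℝ) : ℝ := Delta K.M K.Q K.a r

/-- The inverse `x ↦ r(x)` of the tortoise coordinate, a function from `ℝ` to `(rPlus, ∞)`. -/
def r : ℝ → ℝ := Function.invFunOn K.x (Ioi K.rPlus)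

theorem M_le_rPlus : K.M ≤ K.rPlus := by
  have h := K.rPlus_isGreatest
  have h1 : Delta K.M K.Q K.a K.rPlus = 0 := h.1
  have h2 : 2 * K.M - K.rPlus ≤ K.rPlus := h.2 (by
    simp only [mem_ofPred_eq, Delta] at h1 ⊢; linarith)
  linarith

theorem rPlus_pos : 0 < K.rPlus := K.M_pos.trans_le K.M_le_rPlus

theorem Δ_eq (s : ℝ) : K.Δ s = (s - K.rPlus) * (s - (2 * K.M - K.rPlus)) := by
  have h1 : Delta K.M K.Q K.a K.rPlus = 0 := K.rPlus_isGreatest.1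
  simp only [Δ, Delta] at h1 ⊢
  linarith

theorem rMinus_nonneg : 0 ≤ 2 * K.M - K.rPlus := by
  have h1 : Delta K.M K.Q K.a K.rPlus = 0 := K.rPlus_isGreatest.1
  have h0 := K.rPlus_pos
  simp only [Delta] at h1
  by_contra! h
  nlinarith [sq_nonneg K.a, sq_nonneg K.Q, mul_pos h0 (neg_pos.2 h)]

theorem Δ_pos {s : ℝ} (hs : K.rPlus < s) : 0 < K.Δ s := by
  rw [K.Δ_eq]
  have := K.M_le_rPlus
  exact mul_pos (by linarith) (by linarith)

theorem Δ_le_sq {s : ℝ} (hs : K.rPlus < s) : K.Δ s ≤ s ^ 2 := by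
  rw [K.Δ_eq]
  have h0 := K.rPlus_pos
  have h1 := K.rMinus_nonneg
  have h2 := K.M_le_rPlus
  have h3 : s - (2 * K.M - K.rPlus) ≤ s := by linarith
  have h4 : s - K.rPlus ≤ s := by linarith
  rw [sq]
  exact mul_le_mul h4 h3 (by linarith) (by linarith)

theorem sq_add_sq_pos {s : ℝ} (hs : K.rPlus < s) : 0 < s ^ 2 + K.a ^ 2 := by
  have := K.rPlus_pos.trans hs
  positivity

theorem x_continuousOn : ContinuousOn K.x (Ioi K.rPlus) := fun s hs =>
  (K.x_hasDerivAt s hs).continuousAt.continuousWithinAt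

theorem x_strictMonoOn : StrictMonoOn K.x (Ioi K.rPlus) := by
  refine strictMonoOn_of_deriv_pos (convex_Ioi _) K.x_continuousOn fun s hs => ?_
  rw [interior_Ioi] at hs
  rw [(K.x_hasDerivAt s hs).deriv]
  exact div_pos (K.sq_add_sq_pos hs) (K.Δ_pos hs)

theorem x_sub_monotoneOn : MonotoneOn (fun s => K.x s - s) (Ioi K.rPlus) := by
  have hd : ∀ s, K.rPlus < s →
      HasDerivAt (fun s => K.x s - s) ((s ^ 2 + K.a ^ 2) / K.Δ s - 1) s :=
    fun s hs => (K.x_hasDerivAt s hs).sub (hasDerivAt_id s)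
  refine monotoneOn_of_deriv_nonneg (convex_Ioi _)
    (fun s hs => (hd s hs).continuousAt.continuousWithinAt) ?_ ?_
  · rw [interior_Ioi]
    exact fun s hs => (hd s hs).differentiableAt.differentiableWithinAt
  · rw [interior_Ioi]
    intro s hs
    rw [(hd s hs).deriv, sub_nonneg, le_div_iff₀ (K.Δ_pos hs)]
    nlinarith [K.Δ_le_sq hs, sq_nonneg K.a]

theorem x_sub_log_monotoneOn :
    MonotoneOn (fun s => K.x s - K.rPlus * Real.log (s - K.rPlus)) (Ioi K.rPlus) := by
  have hd : ∀ s, K.rPlus < s →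
      HasDerivAt (fun s => K.x s - K.rPlus * Real.log (s - K.rPlus))
        ((s ^ 2 + K.a ^ 2) / K.Δ s - K.rPlus * (1 / (s - K.rPlus))) s := fun s hs =>
    (K.x_hasDerivAt s hs).sub
      ((((hasDerivAt_id s).sub_const K.rPlus).log (sub_pos.2 hs).ne').const_mul K.rPlus)
  refine monotoneOn_of_deriv_nonneg (convex_Ioi _)
    (fun s hs => (hd s hs).continuousAt.continuousWithinAt) ?_ ?_
  · rw [interior_Ioi]
    exact fun s hs => (hd s hs).differentiableAt.differentiableWithinAt
  · rw [interior_Ioi]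
    intro s hs
    have hs' : 0 < s - K.rPlus := sub_pos.2 hs
    have h0 := K.rPlus_pos
    have h1 := K.rMinus_nonneg
    have h2 : K.rPlus < s := hs
    rw [(hd s hs).deriv, sub_nonneg, mul_one_div, div_le_div_iff₀ hs' (K.Δ_pos hs), K.Δ_eq]
    have h3 : K.rPlus * (s - (2 * K.M - K.rPlus)) ≤ s ^ 2 + K.a ^ 2 := by
      nlinarith [sq_nonneg K.a, mul_nonneg h0.le h1]
    nlinarith [mul_le_mul_of_nonneg_left h3 hs'.le]

/-- The tortoise coordinate maps `(rPlus, ∞)` bijectively onto `ℝ`. -/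
theorem x_bijOn : BijOn K.x (Ioi K.rPlus) univ := by
  refine ⟨mapsTo_univ _ _, K.x_strictMonoOn.injOn, ?_⟩
  have hs0 : K.rPlus < K.rPlus + 1 := by linarith
  have htop : Filter.Tendsto K.x Filter.atTop Filter.atTop := by
    refine Filter.tendsto_atTop_mono' _ ?_
      (Filter.tendsto_atTop_add_const_left _ (K.x (K.rPlus + 1) - (K.rPlus + 1)) Filter.tendsto_id)
    filter_upwards [Filter.eventually_ge_atTop (K.rPlus + 1)] with s hs
    have := K.x_sub_monotoneOn hs0 (show s ∈ Ioi K.rPlus from hs0.trans_le hs) hs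
    simp only [id] at this ⊢
    linarith
  have hbot : Filter.Tendsto K.x (nhdsWithin K.rPlus (Ioi K.rPlus)) Filter.atBot := by
    have h1 : Filter.Tendsto (fun s => s - K.rPlus) (nhdsWithin K.rPlus (Ioi K.rPlus))
        (nhdsWithin 0 (Ioi 0)) := by
      refine tendsto_nhdsWithin_iff.2 ⟨?_, ?_⟩
      · have : Filter.Tendsto (fun s => s - K.rPlus) (nhds K.rPlus) (nhds (K.rPlus - K.rPlus)) :=
          (continuous_id.sub continuous_const).tendsto _
        rw [sub_self] at this
        exact this.mono_left nhdsWithin_le_nhds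
      · filter_upwards [self_mem_nhdsWithin] with s hs using sub_pos.2 (mem_Ioi.1 hs)
    have h2 := (Real.tendsto_log_nhdsGT_zero.comp h1).const_mul_atBot K.rPlus_pos
    refine Filter.tendsto_atBot_mono' _ ?_ (Filter.tendsto_atBot_add_const_left _
      (K.x (K.rPlus + 1) - K.rPlus * Real.log ((K.rPlus + 1) - K.rPlus)) h2)
    filter_upwards [Ioc_mem_nhdsGT hs0] with s hs
    have := K.x_sub_log_monotoneOn (show s ∈ Ioi K.rPlus from hs.1) hs0 hs.2
    simp only [Function.comp] at this ⊢
    linarith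
  exact isPreconnected_Ioi.intermediate_value_Iii
    (Filter.le_principal_iff.2 self_mem_nhdsWithin)
    (Filter.le_principal_iff.2 (Filter.Ioi_mem_atTop _)) K.x_continuousOn hbot htop

theorem rPlus_lt_r (y : ℝ) : K.rPlus < K.r y := K.x_bijOn.surjOn.mapsTo_invFunOn (mem_univ y)

theorem x_r (y : ℝ) : K.x (K.r y) = y := K.x_bijOn.surjOn.rightInvOn_invFunOn (mem_univ y)

theorem r_x {s : ℝ} (hs : K.rPlus < s) : K.r (K.x s) = s :=
  K.x_bijOn.injOn (K.rPlus_lt_r _) hs (K.x_r _)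

theorem r_continuous : Continuous K.r := by
  let f : ℝ → Ioi K.rPlus := fun y => ⟨K.r y, K.rPlus_lt_r y⟩
  have hmono : Monotone f := fun y z hyz => by
    refine (K.x_strictMonoOn.le_iff_le (K.rPlus_lt_r y) (K.rPlus_lt_r z)).1 ?_
    rwa [K.x_r, K.x_r]
  have hsurj : Function.Surjective f := fun s => ⟨K.x s, Subtype.ext (K.r_x s.2)⟩
  exact continuous_subtype_val.comp (hmono.continuous_of_surjective hsurj)

end Exterior

/-! ## Matrices -/

/-- Values of wave functions: `ℂ⁴` with its Euclidean norm. -/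
abbrev Spinor : Type := EuclideanSpace ℂ (Fin 4)

/-- The first Pauli matrix. -/
def σ₁ : Matrix (Fin 2) (Fin 2) ℂ := !![0, 1; 1, 0]

/-- The second Pauli matrix. -/
def σ₂ : Matrix (Fin 2) (Fin 2) ℂ := !![0, -Complex.I; Complex.I, 0]

/-- The third Pauli matrix. -/
def σ₃ : Matrix (Fin 2) (Fin 2) ℂ := !![1, 0; 0, -1]

/-- The `4 × 4` matrix with the given `2 × 2` blocks. -/
def block (A B C D : Matrix (Fin 2) (Fin 2) ℂ) : Matrix (Fin 4) (Fin 4) ℂ :=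
  (Matrix.fromBlocks A B C D).submatrix (finSumFinEquiv (m := 2) (n := 2)).symm
    (finSumFinEquiv (m := 2) (n := 2)).symm

/-- The product of a `4 × 4` matrix and a vector of `ℂ⁴`. -/
def act (A : Matrix (Fin 4) (Fin 4) ℂ) : Spinor →L[ℂ] Spinor :=
  Matrix.toEuclideanCLM (n := Fin 4) (𝕜 := ℂ) A

/-! ## The Dirac equation -/

/-- A scalar function of `(r, θ, φ, t)`, or of `(x, θ, φ, t)`. -/
abbrev ScalarField : Type := ℝ × ℝ × ℝ × ℝ → ℂ

/-- `(r, θ, φ, t)` is in the exterior region if `r > rPlus` and `0 < θ < π`; the angle `φ` runs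
through `ℝ`. -/
def Exterior.region (K : Exterior) : Set (ℝ × ℝ × ℝ × ℝ) := Ioi K.rPlus ×ˢ Ioo 0 Real.pi ×ˢ univ

/-- The region `x ∈ ℝ`, `0 < θ < π` in the coordinates `(x, θ, φ, t)`. -/
def tortoiseRegion : Set (ℝ × ℝ × ℝ × ℝ) := univ ×ˢ Ioo 0 Real.pi ×ˢ univ

/-- The boundary condition `Ψ(·, θ, φ + 2π, t) = -Ψ(·, θ, φ, t)` at the points of `U`. -/
def IsAntiperiodicOn (Ψ : ℝ × ℝ × ℝ × ℝ → Spinor) (U : Set (ℝ × ℝ × ℝ × ℝ)) : Prop :=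
  ∀ y θ φ t : ℝ, (y, θ, φ, t) ∈ U → Ψ (y, θ, φ + 2 * Real.pi, t) = -Ψ (y, θ, φ, t)

namespace Exterior

variable (K : Exterior)

/-- The operator `∂_r + s (i/Δ) [(r² + a²) i ∂_t + a i ∂_φ + e Q r]` with a sign `s = ±1`. -/
def radialD (e s : ℝ) (f : ScalarField) : ScalarField := fun (r, θ, φ, t) =>
  deriv (fun r' => f (r', θ, φ, t)) r
    + s * (Complex.I / K.Δ r) *
      ((r ^ 2 + K.a ^ 2) * (Complex.I * deriv (fun t' => f (r, θ, φ, t')) t)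
        + K.a * (Complex.I * deriv (fun φ' => f (r, θ, φ', t)) φ)
        + e * K.Q * r * f (r, θ, φ, t))

/-- The operator `∂_θ + cot θ / 2 - s [a sin θ i ∂_t + (1 / sin θ) i ∂_φ]` with a sign
`s = ±1`. -/
def angularL (s : ℝ) (f : ScalarField) : ScalarField := fun (r, θ, φ, t) =>
  deriv (fun θ' => f (r, θ', φ, t)) θ + Real.cot θ / 2 * f (r, θ, φ, t)
    - s * (K.a * Real.sin θ * (Complex.I * deriv (fun t' => f (r, θ, φ, t')) t)
        + 1 / Real.sin θ * (Complex.I * deriv (fun φ' => f (r, θ, φ', t)) φ))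

/-- The radial part of the Dirac operator, applied to a wave function. -/
def radialPart (m e : ℝ) (Ψ : ℝ × ℝ × ℝ × ℝ → Spinor) (p : ℝ × ℝ × ℝ × ℝ) : Fin 4 → ℂ :=
  let imr : ℂ := Complex.I * m * p.1
  let δ : ℂ := Real.sqrt (K.Δ p.1)
  ![imr * Ψ p 0 + δ * K.radialD e 1 (fun q => Ψ q 2) p,
    -imr * Ψ p 1 + δ * K.radialD e (-1) (fun q => Ψ q 3) p,
    δ * K.radialD e (-1) (fun q => Ψ q 0) p - imr * Ψ p 2,
    δ * K.radialD e 1 (fun q => Ψ q 1) p + imr * Ψ p 3]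

/-- The angular part of the Dirac operator, applied to a wave function. -/
def angularPart (m : ℝ) (Ψ : ℝ × ℝ × ℝ × ℝ → Spinor) (p : ℝ × ℝ × ℝ × ℝ) : Fin 4 → ℂ :=
  let D : ℂ := K.a * m * Real.cos p.2.1
  ![-D * Ψ p 0 + K.angularL 1 (fun q => Ψ q 3) p,
    D * Ψ p 1 - K.angularL (-1) (fun q => Ψ q 2) p,
    K.angularL 1 (fun q => Ψ q 1) p - D * Ψ p 2,
    -K.angularL (-1) (fun q => Ψ q 0) p + D * Ψ p 3]

/-- `Ψ` is a classical solution, of class `C^k` in the exterior region, of the Dirac equation in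
the Kerr-Newman metric. -/
def IsDiracSolution (m e : ℝ) (k : ℕ∞) (Ψ : ℝ × ℝ × ℝ × ℝ → Spinor) : Prop :=
  ContDiffOn ℝ k Ψ K.region ∧ ∀ p ∈ K.region, K.radialPart m e Ψ p + K.angularPart m Ψ p = 0

/-! ## The Cauchy problem in the coordinates `(x, θ, φ)` -/

/-- The rescaled wave function `(sin θ)^{1/2} Ψ(r(x), θ, φ, t)`. -/
def rescale (Ψ : ℝ × ℝ × ℝ × ℝ → Spinor) : ℝ × ℝ × ℝ × ℝ → Spinor := fun (x, θ, φ, t) =>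
  (Real.sqrt (Real.sin θ) : ℂ) • Ψ (K.r x, θ, φ, t)

/-- The function `√Δ / (r² + a²)` of `x`. -/
def w (x : ℝ) : ℝ := Real.sqrt (K.Δ (K.r x)) / (K.r x ^ 2 + K.a ^ 2)

/-- The matrix `S(x, θ) = I + a √Δ sin θ / (r² + a²) diag(σ₂, -σ₂)`. -/
def S (p : ℝ × ℝ × ℝ) : Matrix (Fin 4) (Fin 4) ℂ :=
  1 + ((K.a * K.w p.1 * Real.sin p.2.1 : ℝ) : ℂ) • block σ₂ 0 0 (-σ₂)

end Exterior

/-- `∂Ψ/∂x`. -/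
def dx (Ψ : ℝ × ℝ × ℝ → Spinor) (p : ℝ × ℝ × ℝ) : Spinor :=
  deriv (fun x => Ψ (x, p.2.1, p.2.2)) p.1

/-- `∂Ψ/∂θ`. -/
def dθ (Ψ : ℝ × ℝ × ℝ → Spinor) (p : ℝ × ℝ × ℝ) : Spinor :=
  deriv (fun θ => Ψ (p.1, θ, p.2.2)) p.2.1

/-- `∂Ψ/∂φ`. -/
def dφ (Ψ : ℝ × ℝ × ℝ → Spinor) (p : ℝ × ℝ × ℝ) : Spinor :=
  deriv (fun φ => Ψ (p.1, p.2.1, φ)) p.2.2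

namespace Exterior

variable (K : Exterior)

/-- The differential expression `diag(h₁, -h₁)` with
`h₁ = -σ₃ i ∂_x - √Δ / (r² + a²) (σ₁ i ∂_θ + σ₂ (1 / sin θ) i ∂_φ)`. -/
def h₁ (Ψ : ℝ × ℝ × ℝ → Spinor) (p : ℝ × ℝ × ℝ) : Spinor :=
  -(act (block σ₃ 0 0 (-σ₃)) (Complex.I • dx Ψ p))
    - (K.w p.1 : ℂ) • (act (block σ₁ 0 0 (-σ₁)) (Complex.I • dθ Ψ p)
        + ((1 / Real.sin p.2.1 : ℝ) : ℂ) • act (block σ₂ 0 0 (-σ₂)) (Complex.I • dφ Ψ p))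

/-- The differential expression
`-(r² + a²)⁻¹ (a i ∂_φ + e Q r) - m r √Δ / (r² + a²) (0, I; I, 0)
  + a m √Δ cos θ / (r² + a²) (0, i I; -i I, 0)`. -/
def h₂ (m e : ℝ) (Ψ : ℝ × ℝ × ℝ → Spinor) (p : ℝ × ℝ × ℝ) : Spinor :=
  -(((1 / (K.r p.1 ^ 2 + K.a ^ 2) : ℝ) : ℂ) •
      ((K.a : ℂ) • Complex.I • dφ Ψ p + ((e * K.Q * K.r p.1 : ℝ) : ℂ) • Ψ p))
    - ((m * K.r p.1 * K.w p.1 : ℝ) : ℂ) • act (block 0 1 1 0) (Ψ p)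
    + ((K.a * m * K.w p.1 * Real.cos p.2.1 : ℝ) : ℂ) •
      act (block 0 (Complex.I • 1) (-Complex.I • 1) 0) (Ψ p)

/-- The formal Dirac operator. -/
def h (m e : ℝ) (Ψ : ℝ × ℝ × ℝ → Spinor) (p : ℝ × ℝ × ℝ) : Spinor :=
  K.h₁ Ψ p + K.h₂ m e Ψ p

/-- `Ψ` is a classical solution, of class `C^k` for `x ∈ ℝ` and `0 < θ < π`, of
`i ∂_t Ψ = S⁻¹ h Ψ`. -/
def IsCauchySolution (m e : ℝ) (k : ℕ∞) (Ψ : ℝ × ℝ × ℝ × ℝ → Spinor) : Prop :=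
  ContDiffOn ℝ k Ψ tortoiseRegion ∧
    ∀ x θ φ t : ℝ, θ ∈ Ioo 0 Real.pi →
      Complex.I • deriv (fun t' => Ψ (x, θ, φ, t')) t
        = act (K.S (x, θ, φ))⁻¹ (K.h m e (fun q => Ψ (q.1, q.2.1, q.2.2, t)) (x, θ, φ))

end Exterior

/-! ## Test functions and the Hilbert space `L²(Ω₃)⁴` -/

/-- `Ω₃ = ℝ × (0, π) × [0, 2π)`. -/
def Ω₃ : Set (ℝ × ℝ × ℝ) := univ ×ˢ Ioo 0 Real.pi ×ˢ Ico 0 (2 * Real.pi)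

/-- The space `C₀^∞(Ω₃)⁴`. Functions of the angle `φ` are subject to the boundary condition
`Ψ(x, θ, φ + 2π) = -Ψ(x, θ, φ)` (half-integer angular momentum), and supports are compact
in `(x, θ) ∈ ℝ × (0, π)`. The functions are extended by this condition to all `φ ∈ ℝ`, and by `0`
to all `θ ∈ ℝ`. -/
def testFunctions : Submodule ℂ (ℝ × ℝ × ℝ → Spinor) where
  carrier := {Ψ | ContDiff ℝ ∞ Ψ ∧ (∀ x θ φ, Ψ (x, θ, φ + 2 * Real.pi) = -Ψ (x, θ, φ)) ∧
    ∃ C : Set (ℝ × ℝ), IsCompact C ∧ C ⊆ univ ×ˢ Ioo 0 Real.pi ∧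
      ∀ x θ φ, (x, θ) ∉ C → Ψ (x, θ, φ) = 0}
  zero_mem' := ⟨contDiff_const, by simp, ∅, isCompact_empty, empty_subset _, by simp⟩
  add_mem' := by
    rintro Ψ Φ ⟨h1, h2, C, hC, hCs, h3⟩ ⟨k1, k2, D, hD, hDs, k3⟩
    refine ⟨h1.add k1, fun x θ φ => ?_, C ∪ D, hC.union hD, union_subset hCs hDs,
      fun x θ φ hx => ?_⟩
    · simp only [Pi.add_apply, h2, k2, neg_add]
    · simp only [mem_union, not_or] at hx
      simp [h3 x θ φ hx.1, k3 x θ φ hx.2]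
  smul_mem' := by
    rintro c Ψ ⟨h1, h2, C, hC, hCs, h3⟩
    refine ⟨h1.const_smul c, fun x θ φ => ?_, C, hC, hCs, fun x θ φ hx => ?_⟩
    · simp only [Pi.smul_apply, h2, smul_neg]
    · simp [h3 x θ φ hx]

/-- An element of `C₀^∞(Ω₃)⁴`. -/
abbrev TestFunction : Type := testFunctions

theorem measurableSet_Ω₃ : MeasurableSet Ω₃ :=
  MeasurableSet.univ.prod (measurableSet_Ioo.prod measurableSet_Ico)

/-- The Hilbert space `L²(Ω₃)⁴`, realised as `L²(Ω₃; ℂ⁴)`. -/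
abbrev L2 : Type := Lp Spinor 2 (volume.restrict Ω₃)

/-- Functions which are continuous for `0 < θ < π` and supported in a compact set of `(x, θ)`. -/
theorem memLp_of_support {F : ℝ × ℝ × ℝ → Spinor}
    (hF : ContinuousOn F (univ ×ˢ Ioo 0 Real.pi ×ˢ univ))
    {C : Set (ℝ × ℝ)} (hC : IsCompact C) (hCs : C ⊆ univ ×ˢ Ioo 0 Real.pi)
    (h0 : ∀ x θ φ, (x, θ) ∉ C → F (x, θ, φ) = 0) : MemLp F 2 (volume.restrict Ω₃) := by
  let L : Set (ℝ × ℝ × ℝ) :=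
    (fun q : (ℝ × ℝ) × ℝ => (q.1.1, q.1.2, q.2)) '' (C ×ˢ Icc 0 (2 * Real.pi))
  have hL : IsCompact L := (hC.prod isCompact_Icc).image (by fun_prop)
  have hLU : L ⊆ univ ×ˢ Ioo 0 Real.pi ×ˢ univ := by
    rintro _ ⟨⟨⟨x, θ⟩, φ⟩, ⟨hq, -⟩, rfl⟩
    exact ⟨trivial, (hCs hq).2, trivial⟩
  have hFL : ContinuousOn F L := hF.mono hLU
  have : IsFiniteMeasure (volume.restrict L) := ⟨by
    rw [Measure.restrict_apply_univ]; exact hL.measure_lt_top⟩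
  obtain ⟨B, hB⟩ := hL.exists_bound_of_continuousOn hFL
  have h1 : MemLp F 2 (volume.restrict L) :=
    MemLp.of_bound (hFL.aestronglyMeasurable hL.measurableSet) B
      ((ae_restrict_iff' hL.measurableSet).2 (Filter.Eventually.of_forall hB))
  have h2 : MemLp (L.indicator F) 2 (volume.restrict Ω₃) :=
    ((memLp_indicator_iff_restrict hL.measurableSet).2 h1).restrict Ω₃
  refine h2.ae_eq ((ae_restrict_iff' measurableSet_Ω₃).2 (Filter.Eventually.of_forall ?_))
  rintro ⟨x, θ, φ⟩ ⟨-, -, hφ⟩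
  by_cases hx : (x, θ) ∈ C
  · exact indicator_of_mem (show (x, θ, φ) ∈ L from
      ⟨((x, θ), φ), ⟨hx, Ico_subset_Icc_self hφ⟩, rfl⟩) F
  · rw [h0 x θ φ hx]
    exact indicator_apply_eq_zero.2 fun _ => h0 x θ φ hx

namespace TestFunction

variable (Ψ : TestFunction)

theorem contDiff : ContDiff ℝ ∞ (Ψ : ℝ × ℝ × ℝ → Spinor) := Ψ.2.1

theorem differentiable : Differentiable ℝ (Ψ : ℝ × ℝ × ℝ → Spinor) :=
  Ψ.contDiff.differentiable (by simp)

theorem hasDerivAt_dx (p : ℝ × ℝ × ℝ) :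
    HasDerivAt (fun x => (Ψ : ℝ × ℝ × ℝ → Spinor) (x, p.2.1, p.2.2))
      (fderiv ℝ (Ψ : ℝ × ℝ × ℝ → Spinor) p (1, 0, 0)) p.1 :=
  (Ψ.differentiable p).hasFDerivAt.comp_hasDerivAt p.1
    ((hasDerivAt_id p.1).prodMk ((hasDerivAt_const _ _).prodMk (hasDerivAt_const _ _)))

theorem hasDerivAt_dθ (p : ℝ × ℝ × ℝ) :
    HasDerivAt (fun θ => (Ψ : ℝ × ℝ × ℝ → Spinor) (p.1, θ, p.2.2))
      (fderiv ℝ (Ψ : ℝ × ℝ × ℝ → Spinor) p (0, 1, 0)) p.2.1 :=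
  (Ψ.differentiable p).hasFDerivAt.comp_hasDerivAt p.2.1
    ((hasDerivAt_const _ _).prodMk ((hasDerivAt_id p.2.1).prodMk (hasDerivAt_const _ _)))

theorem hasDerivAt_dφ (p : ℝ × ℝ × ℝ) :
    HasDerivAt (fun φ => (Ψ : ℝ × ℝ × ℝ → Spinor) (p.1, p.2.1, φ))
      (fderiv ℝ (Ψ : ℝ × ℝ × ℝ → Spinor) p (0, 0, 1)) p.2.2 :=
  (Ψ.differentiable p).hasFDerivAt.comp_hasDerivAt p.2.2
    ((hasDerivAt_const _ _).prodMk ((hasDerivAt_const _ _).prodMk (hasDerivAt_id p.2.2)))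

theorem dx_eq : dx Ψ = fun p => fderiv ℝ (Ψ : ℝ × ℝ × ℝ → Spinor) p (1, 0, 0) :=
  funext fun p => (Ψ.hasDerivAt_dx p).deriv

theorem dθ_eq : dθ Ψ = fun p => fderiv ℝ (Ψ : ℝ × ℝ × ℝ → Spinor) p (0, 1, 0) :=
  funext fun p => (Ψ.hasDerivAt_dθ p).deriv

theorem dφ_eq : dφ Ψ = fun p => fderiv ℝ (Ψ : ℝ × ℝ × ℝ → Spinor) p (0, 0, 1) :=
  funext fun p => (Ψ.hasDerivAt_dφ p).deriv

theorem continuous_fderiv_apply (v : ℝ × ℝ × ℝ) :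
    Continuous fun p => fderiv ℝ (Ψ : ℝ × ℝ × ℝ → Spinor) p v :=
  (Ψ.contDiff.continuous_fderiv (by simp)).clm_apply continuous_const

/-- A test function and its derivatives vanish outside a compact set of `(x, θ)`. -/
theorem exists_support : ∃ C : Set (ℝ × ℝ), IsCompact C ∧ C ⊆ univ ×ˢ Ioo 0 Real.pi ∧
    ∀ x θ φ, (x, θ) ∉ C → (Ψ : ℝ × ℝ × ℝ → Spinor) (x, θ, φ) = 0 ∧
      fderiv ℝ (Ψ : ℝ × ℝ × ℝ → Spinor) (x, θ, φ) = 0 := by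
  obtain ⟨-, -, C, hC, hCs, h0⟩ := Ψ.2
  refine ⟨C, hC, hCs, fun x θ φ hx => ⟨h0 x θ φ hx, ?_⟩⟩
  have hev : (Ψ : ℝ × ℝ × ℝ → Spinor) =ᶠ[nhds (x, θ, φ)] fun _ => 0 := by
    have hopen : IsOpen ((fun q : ℝ × ℝ × ℝ => (q.1, q.2.1)) ⁻¹' Cᶜ) :=
      hC.isClosed.isOpen_compl.preimage (by fun_prop)
    filter_upwards [hopen.mem_nhds (show (x, θ, φ) ∈ _ from hx)] with q hq
    exact h0 q.1 q.2.1 q.2.2 hq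
  rw [hev.fderiv_eq, fderiv_fun_const]
  rfl

theorem memLp : MemLp (Ψ : ℝ × ℝ × ℝ → Spinor) 2 (volume.restrict Ω₃) := by
  obtain ⟨C, hC, hCs, h0⟩ := Ψ.exists_support
  exact memLp_of_support Ψ.contDiff.continuous.continuousOn hC hCs
    fun x θ φ hx => (h0 x θ φ hx).1

/-- The inclusion of `C₀^∞(Ω₃)⁴` into `L²(Ω₃)⁴`. -/
def toL2 : TestFunction →ₗ[ℂ] L2 where
  toFun Ψ := Ψ.memLp.toLp _
  map_add' Ψ Φ := MemLp.toLp_add Ψ.memLp Φ.memLp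
  map_smul' c Ψ := MemLp.toLp_const_smul c Ψ.memLp

theorem toL2_injective : Function.Injective toL2 := by
  rw [← LinearMap.ker_eq_bot, LinearMap.ker_eq_bot']
  intro Ψ hΨ
  have hae : (Ψ : ℝ × ℝ × ℝ → Spinor) =ᵐ[volume.restrict Ω₃] 0 :=
    (MemLp.coeFn_toLp Ψ.memLp).symm.trans
      ((congrArg (fun f : L2 => (f : ℝ × ℝ × ℝ → Spinor)) hΨ).eventuallyEq.trans
        (Lp.coeFn_zero _ _ _))
  let U : Set (ℝ × ℝ × ℝ) := univ ×ˢ Ioo 0 Real.pi ×ˢ Ioo 0 (2 * Real.pi)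
  have hU : IsOpen U := isOpen_univ.prod (isOpen_Ioo.prod isOpen_Ioo)
  have hUΩ : U ⊆ Ω₃ := prod_mono_right (prod_mono_right Ioo_subset_Ico_self)
  have hcont := Ψ.contDiff.continuous
  have hUeq : EqOn (Ψ : ℝ × ℝ × ℝ → Spinor) 0 U :=
    Measure.eqOn_open_of_ae_eq (ae_mono (Measure.restrict_mono_set volume hUΩ) hae) hU
      hcont.continuousOn continuousOn_const
  have hIco : ∀ x θ, θ ∈ Ioo 0 Real.pi → ∀ φ ∈ Icc 0 (2 * Real.pi),
      (Ψ : ℝ × ℝ × ℝ → Spinor) (x, θ, φ) = 0 := by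
    intro x θ hθ φ hφ
    have hcl : closure (Ioo 0 (2 * Real.pi)) = Icc 0 (2 * Real.pi) :=
      closure_Ioo (by positivity)
    have : EqOn (fun φ => (Ψ : ℝ × ℝ × ℝ → Spinor) (x, θ, φ)) (fun _ => 0)
        (closure (Ioo 0 (2 * Real.pi))) :=
      EqOn.closure (fun φ hφ => hUeq (show (x, θ, φ) ∈ U from ⟨trivial, hθ, hφ⟩))
        (by fun_prop) continuous_const
    exact this (by rw [hcl]; exact hφ)
  obtain ⟨-, hanti, C, -, hCs, h0⟩ := Ψ.2
  refine Subtype.ext (funext fun ⟨x, θ, φ⟩ => ?_)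
  by_cases hx : (x, θ) ∈ C
  · have hθ : θ ∈ Ioo 0 Real.pi := (hCs hx).2
    have hper : Function.Periodic (fun φ => ‖(Ψ : ℝ × ℝ × ℝ → Spinor) (x, θ, φ)‖)
        (2 * Real.pi) := fun φ => by
      change ‖(Ψ : ℝ × ℝ × ℝ → Spinor) (x, θ, φ + 2 * Real.pi)‖ = _
      rw [hanti, norm_neg]
    obtain ⟨φ', hφ', heq⟩ := hper.exists_mem_Ico₀ Real.two_pi_pos φ
    have : ‖(Ψ : ℝ × ℝ × ℝ → Spinor) (x, θ, φ)‖ = 0 := by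
      refine heq.trans ?_
      rw [hIco x θ hθ φ' (Ico_subset_Icc_self hφ'), norm_zero]
    exact norm_eq_zero.1 this
  · exact h0 x θ φ hx

end TestFunction

/-! ## The operators -/

namespace Exterior

variable (K : Exterior)

theorem w_continuous : Continuous K.w := by
  have h1 := K.r_continuous
  have h2 : Continuous K.Δ := by unfold Δ Delta; fun_prop
  exact (Real.continuous_sqrt.comp (h2.comp h1)).div (by fun_prop)
    fun y => (K.sq_add_sq_pos (K.rPlus_lt_r y)).ne'

/-- The norms of `L²(Ω₃)⁴` and `L²_S(Ω₃)⁴` are equivalent because of this bound. -/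
theorem abs_coeff_le (p : ℝ × ℝ × ℝ) : |K.a * K.w p.1 * Real.sin p.2.1| ≤ 1 / 2 := by
  have hr := K.rPlus_lt_r p.1
  have h0 := K.rPlus_pos.trans hr
  have h1 : Real.sqrt (K.Δ (K.r p.1)) ≤ K.r p.1 :=
    Real.sqrt_le_iff.2 ⟨h0.le, K.Δ_le_sq hr⟩
  have h2 := K.sq_add_sq_pos hr
  have h3 : |K.a| * K.w p.1 ≤ 1 / 2 := by
    rw [w, ← mul_div_assoc, div_le_div_iff₀ h2 two_pos]
    nlinarith [mul_le_mul_of_nonneg_left h1 (abs_nonneg K.a), sq_nonneg (K.r p.1 - |K.a|),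
      sq_abs K.a]
  have h4 : 0 ≤ K.w p.1 := div_nonneg (Real.sqrt_nonneg _) h2.le
  rw [abs_mul, abs_mul, abs_of_nonneg h4]
  calc |K.a| * K.w p.1 * |Real.sin p.2.1| ≤ |K.a| * K.w p.1 * 1 :=
        mul_le_mul_of_nonneg_left (Real.abs_sin_le_one _) (mul_nonneg (abs_nonneg _) h4)
    _ ≤ 1 / 2 := by linarith

theorem h_add (m e : ℝ) (Ψ Φ : TestFunction) :
    K.h m e ((Ψ : ℝ × ℝ × ℝ → Spinor) + Φ) = K.h m e Ψ + K.h m e Φ := by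
  have e1 : dx ((Ψ : ℝ × ℝ × ℝ → Spinor) + Φ) = dx Ψ + dx Φ :=
    funext fun p => ((Ψ.hasDerivAt_dx p).add (Φ.hasDerivAt_dx p)).deriv.trans (by
      rw [Ψ.dx_eq, Φ.dx_eq]; rfl)
  have e2 : dθ ((Ψ : ℝ × ℝ × ℝ → Spinor) + Φ) = dθ Ψ + dθ Φ :=
    funext fun p => ((Ψ.hasDerivAt_dθ p).add (Φ.hasDerivAt_dθ p)).deriv.trans (by
      rw [Ψ.dθ_eq, Φ.dθ_eq]; rfl)
  have e3 : dφ ((Ψ : ℝ × ℝ × ℝ → Spinor) + Φ) = dφ Ψ + dφ Φ :=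
    funext fun p => ((Ψ.hasDerivAt_dφ p).add (Φ.hasDerivAt_dφ p)).deriv.trans (by
      rw [Ψ.dφ_eq, Φ.dφ_eq]; rfl)
  funext p
  simp only [h, h₁, h₂, e1, e2, e3, Pi.add_apply, smul_add, map_add]
  abel

theorem h_smul (m e : ℝ) (c : ℂ) (Ψ : TestFunction) :
    K.h m e (c • (Ψ : ℝ × ℝ × ℝ → Spinor)) = c • K.h m e Ψ := by
  have e1 : dx (c • (Ψ : ℝ × ℝ × ℝ → Spinor)) = c • dx Ψ :=
    funext fun p => ((Ψ.hasDerivAt_dx p).const_smul c).deriv.trans (by rw [Ψ.dx_eq]; rfl)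
  have e2 : dθ (c • (Ψ : ℝ × ℝ × ℝ → Spinor)) = c • dθ Ψ :=
    funext fun p => ((Ψ.hasDerivAt_dθ p).const_smul c).deriv.trans (by rw [Ψ.dθ_eq]; rfl)
  have e3 : dφ (c • (Ψ : ℝ × ℝ × ℝ → Spinor)) = c • dφ Ψ :=
    funext fun p => ((Ψ.hasDerivAt_dφ p).const_smul c).deriv.trans (by rw [Ψ.dφ_eq]; rfl)
  funext p
  simp only [h, h₁, h₂, e1, e2, e3, Pi.smul_apply, map_smul]
  module

theorem h_continuousOn (m e : ℝ) (Ψ : TestFunction) :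
    ContinuousOn (K.h m e Ψ) (univ ×ˢ Ioo 0 Real.pi ×ˢ univ) := by
  have c0 : Continuous (Ψ : ℝ × ℝ × ℝ → Spinor) := Ψ.contDiff.continuous
  have c1 : Continuous (dx Ψ) := by rw [Ψ.dx_eq]; exact Ψ.continuous_fderiv_apply _
  have c2 : Continuous (dθ Ψ) := by rw [Ψ.dθ_eq]; exact Ψ.continuous_fderiv_apply _
  have c3 : Continuous (dφ Ψ) := by rw [Ψ.dφ_eq]; exact Ψ.continuous_fderiv_apply _
  have cr := K.r_continuous
  have cw := K.w_continuous
  have cs : ContinuousOn (fun p : ℝ × ℝ × ℝ => ((1 / Real.sin p.2.1 : ℝ) : ℂ))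
      (univ ×ˢ Ioo 0 Real.pi ×ˢ univ) :=
    Complex.continuous_ofReal.comp_continuousOn (continuousOn_const.div (by fun_prop)
      fun p hp => (Real.sin_pos_of_mem_Ioo hp.2.1).ne')
  have cq : Continuous (fun p : ℝ × ℝ × ℝ => ((1 / (K.r p.1 ^ 2 + K.a ^ 2) : ℝ) : ℂ)) :=
    Complex.continuous_ofReal.comp (continuous_const.div (by fun_prop)
      fun p => (K.sq_add_sq_pos (K.rPlus_lt_r p.1)).ne')
  unfold h h₁ h₂
  fun_prop

theorem exists_support_h (m e : ℝ) (Ψ : TestFunction) :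
    ∃ C : Set (ℝ × ℝ), IsCompact C ∧ C ⊆ univ ×ˢ Ioo 0 Real.pi ∧
      ∀ x θ φ, (x, θ) ∉ C → K.h m e Ψ (x, θ, φ) = 0 := by
  obtain ⟨C, hC, hCs, h0⟩ := Ψ.exists_support
  refine ⟨C, hC, hCs, fun x θ φ hx => ?_⟩
  obtain ⟨h1, h2⟩ := h0 x θ φ hx
  simp [h, h₁, h₂, Ψ.dx_eq, Ψ.dθ_eq, Ψ.dφ_eq, h1, h2]

theorem h_memLp (m e : ℝ) (Ψ : TestFunction) :
    MemLp (K.h m e Ψ) 2 (volume.restrict Ω₃) := by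
  obtain ⟨C, hC, hCs, h0⟩ := K.exists_support_h m e Ψ
  exact memLp_of_support (K.h_continuousOn m e Ψ) hC hCs h0

/-- `Ψ ↦ h Ψ` as a linear map from test functions to `L²(Ω₃)⁴`. -/
def hL2 (m e : ℝ) : TestFunction →ₗ[ℂ] L2 where
  toFun Ψ := (K.h_memLp m e Ψ).toLp _
  map_add' Ψ Φ := by
    rw [← MemLp.toLp_add (K.h_memLp m e Ψ) (K.h_memLp m e Φ)]
    exact MemLp.toLp_congr _ _ (K.h_add m e Ψ Φ).eventuallyEq
  map_smul' c Ψ := by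
    rw [RingHom.id_apply, ← MemLp.toLp_const_smul c (K.h_memLp m e Ψ)]
    exact MemLp.toLp_congr _ _ (K.h_smul m e c Ψ).eventuallyEq

/-- The operator `H₀ Ψ = h Ψ` in `L²(Ω₃)⁴` with domain `C₀^∞(Ω₃)⁴`. -/
def H₀ (m e : ℝ) : L2 →ₗ.[ℂ] L2 :=
  operatorOnTestFunctions TestFunction.toL2 (K.hL2 m e) TestFunction.toL2_injective

/-! ## The matrix `S` and the weighted space -/

theorem block_mul_self : block σ₂ 0 0 (-σ₂) * block σ₂ 0 0 (-σ₂) = 1 := by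
  have h2 : σ₂ * σ₂ = 1 := by
    ext i j; fin_cases i <;> fin_cases j <;> simp [σ₂, Matrix.mul_apply, Fin.sum_univ_two]
  rw [block, Matrix.submatrix_mul_equiv, Matrix.fromBlocks_multiply]
  simp [h2]

theorem block_conjTranspose : (block σ₂ 0 0 (-σ₂))ᴴ = block σ₂ 0 0 (-σ₂) := by
  have h2 : σ₂ᴴ = σ₂ := by
    ext i j; fin_cases i <;> fin_cases j <;> simp [σ₂, Matrix.conjTranspose_apply]
  rw [block, Matrix.conjTranspose_submatrix, Matrix.fromBlocks_conjTranspose]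
  simp [h2]

theorem inner_act_block (v u : Spinor) :
    inner ℂ (act (block σ₂ 0 0 (-σ₂)) v) u = inner ℂ v (act (block σ₂ 0 0 (-σ₂)) u) := by
  have h1 : ContinuousLinearMap.adjoint (act (block σ₂ 0 0 (-σ₂)))
      = act (block σ₂ 0 0 (-σ₂)) := by
    rw [← ContinuousLinearMap.star_eq_adjoint, act, ← map_star, Matrix.star_eq_conjTranspose,
      block_conjTranspose]
  rw [← ContinuousLinearMap.adjoint_inner_right, h1]

theorem norm_act_block (v : Spinor) : ‖act (block σ₂ 0 0 (-σ₂)) v‖ = ‖v‖ := by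
  have h1 : act (block σ₂ 0 0 (-σ₂)) (act (block σ₂ 0 0 (-σ₂)) v) = v := by
    rw [act, ← mul_apply_eq_comp, ← map_mul, block_mul_self, map_one]; rfl
  have h2 := inner_act_block v (act (block σ₂ 0 0 (-σ₂)) v)
  rw [h1, inner_self_eq_norm_sq_to_K, inner_self_eq_norm_sq_to_K] at h2
  have h3 : ‖act (block σ₂ 0 0 (-σ₂)) v‖ ^ 2 = ‖v‖ ^ 2 := by exact_mod_cast h2
  exact (pow_left_inj₀ (norm_nonneg _) (norm_nonneg _) two_ne_zero).1 h3

theorem act_S (p : ℝ × ℝ × ℝ) (v : Spinor) : act (K.S p) v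
    = v + ((K.a * K.w p.1 * Real.sin p.2.1 : ℝ) : ℂ) • act (block σ₂ 0 0 (-σ₂)) v := by
  simp [act, S, map_add, map_smul, map_one]

theorem inner_act_S (p : ℝ × ℝ × ℝ) (v u : Spinor) :
    inner ℂ (act (K.S p) v) u = inner ℂ v (act (K.S p) u) := by
  rw [act_S, act_S, inner_add_left, inner_add_right, inner_smul_left, inner_smul_right,
    inner_act_block, Complex.conj_ofReal]

theorem norm_act_S_le (p : ℝ × ℝ × ℝ) (v : Spinor) : ‖act (K.S p) v‖ ≤ 2 * ‖v‖ := by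
  rw [act_S]
  refine (norm_add_le _ _).trans ?_
  rw [norm_smul, norm_act_block, Complex.norm_real, Real.norm_eq_abs]
  nlinarith [K.abs_coeff_le p, norm_nonneg v]

theorem le_re_inner_act_S (p : ℝ × ℝ × ℝ) (v : Spinor) :
    1 / 2 * ‖v‖ ^ 2 ≤ (inner ℂ v (act (K.S p) v)).re := by
  rw [act_S, inner_add_right, inner_smul_right, Complex.add_re, Complex.re_ofReal_mul]
  have h1 : (inner ℂ v v).re = ‖v‖ ^ 2 := inner_self_eq_norm_sq (𝕜 := ℂ) v
  have h2 : |(inner ℂ v (act (block σ₂ 0 0 (-σ₂)) v)).re| ≤ ‖v‖ ^ 2 := by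
    refine (Complex.abs_re_le_norm _).trans ((norm_inner_le_norm _ _).trans ?_)
    rw [norm_act_block, sq]
  have h3 : |(K.a * K.w p.1 * Real.sin p.2.1) *
      (inner ℂ v (act (block σ₂ 0 0 (-σ₂)) v)).re| ≤ 1 / 2 * ‖v‖ ^ 2 := by
    rw [abs_mul]
    exact mul_le_mul (K.abs_coeff_le p) h2 (abs_nonneg _) (by norm_num)
  rw [h1]
  linarith [neg_abs_le ((K.a * K.w p.1 * Real.sin p.2.1) *
      (inner ℂ v (act (block σ₂ 0 0 (-σ₂)) v)).re)]

theorem S_inv (p : ℝ × ℝ × ℝ) : (K.S p)⁻¹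
    = (((1 - (K.a * K.w p.1 * Real.sin p.2.1) ^ 2)⁻¹ : ℝ) : ℂ) •
      (1 - ((K.a * K.w p.1 * Real.sin p.2.1 : ℝ) : ℂ) • block σ₂ 0 0 (-σ₂)) := by
  refine Matrix.inv_eq_right_inv ?_
  have h1 := K.abs_coeff_le p
  rw [S]
  generalize K.a * K.w p.1 * Real.sin p.2.1 = c at *
  have h2 : (1 - c ^ 2 : ℝ) ≠ 0 := by
    have := abs_le.1 h1
    nlinarith
  rw [mul_smul_comm, mul_sub, mul_one, add_mul, one_mul, smul_mul_assoc, mul_smul_comm,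
    block_mul_self]
  have h3 : (1 : Matrix (Fin 4) (Fin 4) ℂ) + (c : ℂ) • block σ₂ 0 0 (-σ₂)
      - ((c : ℂ) • block σ₂ 0 0 (-σ₂) + (c : ℂ) • (c : ℂ) • (1 : Matrix (Fin 4) (Fin 4) ℂ))
      = ((1 - c ^ 2 : ℝ) : ℂ) • 1 := by
    push_cast; module
  rw [h3, smul_smul, ← Complex.ofReal_mul, inv_mul_cancel₀ h2, Complex.ofReal_one,
    one_smul]

theorem Sinv_h_memLp (m e : ℝ) (Ψ : TestFunction) :
    MemLp (fun p => act (K.S p)⁻¹ (K.h m e Ψ p)) 2 (volume.restrict Ω₃) := by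
  obtain ⟨C, hC, hCs, h0⟩ := K.exists_support_h m e Ψ
  refine memLp_of_support ?_ hC hCs fun x θ φ hx => by rw [h0 x θ φ hx, map_zero]
  have e1 : (fun p => act (K.S p)⁻¹ (K.h m e Ψ p)) = fun p =>
      (((1 - (K.a * K.w p.1 * Real.sin p.2.1) ^ 2)⁻¹ : ℝ) : ℂ) •
      (K.h m e Ψ p - ((K.a * K.w p.1 * Real.sin p.2.1 : ℝ) : ℂ) •
        act (block σ₂ 0 0 (-σ₂)) (K.h m e Ψ p)) := by
    funext p
    rw [S_inv]
    simp [act, map_sub, map_smul, map_one]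
  rw [e1]
  have c1 := K.h_continuousOn m e Ψ
  have cw := K.w_continuous
  have c2 : Continuous fun p : ℝ × ℝ × ℝ =>
      (((1 - (K.a * K.w p.1 * Real.sin p.2.1) ^ 2)⁻¹ : ℝ) : ℂ) := by
    refine Complex.continuous_ofReal.comp (Continuous.inv₀ (by fun_prop) fun p => ?_)
    have := abs_le.1 (K.abs_coeff_le p)
    nlinarith
  have c3 : Continuous fun p : ℝ × ℝ × ℝ => ((K.a * K.w p.1 * Real.sin p.2.1 : ℝ) : ℂ) := by
    fun_prop
  exact c2.continuousOn.smul (c1.sub (c3.continuousOn.smul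
    ((act (block σ₂ 0 0 (-σ₂))).continuous.comp_continuousOn c1)))

theorem act_S_memLp {f : ℝ × ℝ × ℝ → Spinor} (hf : MemLp f 2 (volume.restrict Ω₃)) :
    MemLp (fun p => act (K.S p) (f p)) 2 (volume.restrict Ω₃) := by
  refine hf.of_le_mul (c := 2) ?_ (Filter.Eventually.of_forall fun p => K.norm_act_S_le p (f p))
  have e1 : (fun p => act (K.S p) (f p)) = fun p =>
      f p + ((K.a * K.w p.1 * Real.sin p.2.1 : ℝ) : ℂ) • act (block σ₂ 0 0 (-σ₂)) (f p) :=
    funext fun p => K.act_S p (f p)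
  rw [e1]
  have cw := K.w_continuous
  have c1 : Continuous fun p : ℝ × ℝ × ℝ => ((K.a * K.w p.1 * Real.sin p.2.1 : ℝ) : ℂ) := by
    fun_prop
  exact hf.1.add (c1.aestronglyMeasurable.smul
    ((act (block σ₂ 0 0 (-σ₂))).continuous.comp_aestronglyMeasurable hf.1))

/-- The vector space underlying `L²_S(Ω₃)⁴`, that is `L²(Ω₃)⁴`. It carries another scalar
product, and the corresponding norm. -/
def L2S (_ : Exterior) : Type := L2

instance : AddCommGroup K.L2S := inferInstanceAs (AddCommGroup L2)

instance : Module ℂ K.L2S := inferInstanceAs (Module ℂ L2)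

/-- The identity map from `L²(Ω₃)⁴` to `L²_S(Ω₃)⁴`. -/
def toL2S : L2 ≃ₗ[ℂ] K.L2S := LinearEquiv.refl ℂ L2

/-- The scalar product `(Ψ, Φ)_S = ∫ ⟨Ψ, S Φ⟩ dx dθ dφ` over `Ω₃`. -/
def innerS (f g : L2) : ℂ := ∫ p in Ω₃, inner ℂ (f p) (act (K.S p) (g p))

theorem innerS_integrable (f g : L2) :
    Integrable (fun p => inner ℂ (f p) (act (K.S p) (g p))) (volume.restrict Ω₃) := by
  have h := L2.integrable_inner (𝕜 := ℂ) f ((K.act_S_memLp (Lp.memLp g)).toLp _)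
  refine h.congr ?_
  filter_upwards [MemLp.coeFn_toLp (K.act_S_memLp (Lp.memLp g))] with p hp
  rw [hp]

theorem le_re_innerS (f : L2) : 1 / 2 * ‖f‖ ^ 2 ≤ (K.innerS f f).re := by
  have h1 : ‖f‖ ^ 2 = ∫ p in Ω₃, ‖f p‖ ^ 2 := by
    have h := inner_self_eq_norm_sq (𝕜 := ℂ) f
    rw [L2.inner_def] at h
    rw [← h]
    refine (integral_re (L2.integrable_inner (𝕜 := ℂ) f f)).symm.trans ?_
    exact integral_congr_ae (Filter.Eventually.of_forall fun p =>
      inner_self_eq_norm_sq (𝕜 := ℂ) (f p))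
  have h2 : (K.innerS f f).re = ∫ p in Ω₃, (inner ℂ (f p) (act (K.S p) (f p))).re :=
    (integral_re (K.innerS_integrable f f)).symm
  rw [h1, h2, ← integral_const_mul]
  refine integral_mono ?_ (K.innerS_integrable f f).re fun p => K.le_re_inner_act_S p (f p)
  exact ((Lp.memLp f).integrable_norm_pow two_ne_zero).const_mul _

theorem re_innerS_le (f : L2) : (K.innerS f f).re ≤ 2 * ‖f‖ ^ 2 := by
  have e1 : K.innerS f f = inner ℂ f ((K.act_S_memLp (Lp.memLp f)).toLp _) := by
    rw [L2.inner_def]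
    refine integral_congr_ae ?_
    filter_upwards [MemLp.coeFn_toLp (K.act_S_memLp (Lp.memLp f))] with p hp
    rw [hp]
  rw [e1]
  have h2 : ‖(K.act_S_memLp (Lp.memLp f)).toLp _‖ ≤ 2 * ‖f‖ := by
    refine Lp.norm_le_mul_norm_of_ae_le_mul ?_
    filter_upwards [MemLp.coeFn_toLp (K.act_S_memLp (Lp.memLp f))] with p hp
    rw [hp]
    exact K.norm_act_S_le p (f p)
  calc _ ≤ ‖inner ℂ f ((K.act_S_memLp (Lp.memLp f)).toLp _)‖ := Complex.re_le_norm _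
    _ ≤ ‖f‖ * ‖(K.act_S_memLp (Lp.memLp f)).toLp _‖ := norm_inner_le_norm _ _
    _ ≤ 2 * ‖f‖ ^ 2 := by nlinarith [norm_nonneg f]

/-- `(·, ·)_S` is a scalar product on `L²(Ω₃)⁴`. -/
@[reducible]
def coreS : InnerProductSpace.Core ℂ K.L2S where
  inner f g := K.innerS (K.toL2S.symm f) (K.toL2S.symm g)
  conj_inner_symm f g := by
    change (starRingEnd ℂ) (∫ p in Ω₃, _) = ∫ p in Ω₃, _
    rw [← integral_conj]
    refine integral_congr_ae (Filter.Eventually.of_forall fun p => ?_)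
    change (starRingEnd ℂ) (inner ℂ _ _) = inner ℂ _ _
    rw [inner_conj_symm, inner_act_S]
  re_inner_nonneg f := (by positivity : (0 : ℝ) ≤ _).trans (K.le_re_innerS (K.toL2S.symm f))
  add_left f g k := by
    rw [map_add]
    change (∫ p in Ω₃, _) = (∫ p in Ω₃, _) + ∫ p in Ω₃, _
    rw [← integral_add (K.innerS_integrable _ _) (K.innerS_integrable _ _)]
    refine integral_congr_ae ?_
    filter_upwards [Lp.coeFn_add (K.toL2S.symm f) (K.toL2S.symm g)] with p hp
    rw [hp, Pi.add_apply, inner_add_left]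
  smul_left f g c := by
    rw [map_smul]
    change (∫ p in Ω₃, _) = _ * ∫ p in Ω₃, _
    rw [← integral_const_mul]
    refine integral_congr_ae ?_
    filter_upwards [Lp.coeFn_smul c (K.toL2S.symm f)] with p hp
    rw [hp, Pi.smul_apply, inner_smul_left]
  definite f hf := by
    have h1 := K.le_re_innerS (K.toL2S.symm f)
    have h2 : K.innerS (K.toL2S.symm f) (K.toL2S.symm f) = 0 := hf
    rw [h2, Complex.zero_re] at h1
    have h3 : ‖K.toL2S.symm f‖ = 0 := by nlinarith [norm_nonneg (K.toL2S.symm f)]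
    simpa using h3

instance : NormedAddCommGroup K.L2S := K.coreS.toNormedAddCommGroup

instance : InnerProductSpace ℂ K.L2S := InnerProductSpace.ofCore K.coreS.toCore

theorem inner_L2S (f g : L2) : inner ℂ (K.toL2S f) (K.toL2S g)
    = ∫ p in Ω₃, inner ℂ (f p) (act (K.S p) (g p)) := rfl

theorem norm_toL2S_sq (f : L2) : ‖K.toL2S f‖ ^ 2 = (K.innerS f f).re :=
  (inner_self_eq_norm_sq (𝕜 := ℂ) (K.toL2S f)).symm

theorem norm_toL2S_le (f : L2) : ‖K.toL2S f‖ ≤ 2 * ‖f‖ := by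
  refine abs_le_of_sq_le_sq' ?_ (by positivity) |>.2
  rw [norm_toL2S_sq]
  nlinarith [K.re_innerS_le f, sq_nonneg ‖f‖]

theorem norm_le_norm_toL2S (f : L2) : ‖f‖ ≤ 2 * ‖K.toL2S f‖ := by
  refine abs_le_of_sq_le_sq' ?_ (by positivity) |>.2
  rw [mul_pow, norm_toL2S_sq]
  nlinarith [K.le_re_innerS f, sq_nonneg ‖f‖]

instance : CompleteSpace K.L2S :=
  let e : L2 ≃L[ℂ] K.L2S :=
    K.toL2S.toContinuousLinearEquivOfBounds 2 2 K.norm_toL2S_le fun f => by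
      simpa using K.norm_le_norm_toL2S (K.toL2S.symm f)
  (completeSpace_congr (e := e.toEquiv) e.isUniformEmbedding).1 inferInstance

/-- `Ψ ↦ S⁻¹ h Ψ` as a linear map from test functions to `L²_S(Ω₃)⁴`. -/
def SinvhL2S (m e : ℝ) : TestFunction →ₗ[ℂ] K.L2S where
  toFun Ψ := K.toL2S ((K.Sinv_h_memLp m e Ψ).toLp _)
  map_add' Ψ Φ := by
    rw [← map_add, ← MemLp.toLp_add (K.Sinv_h_memLp m e Ψ) (K.Sinv_h_memLp m e Φ)]
    refine congrArg K.toL2S (MemLp.toLp_congr _ _ (Filter.Eventually.of_forall fun p => ?_))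
    change act _ (K.h m e ((Ψ : ℝ × ℝ × ℝ → Spinor) + Φ) p) = act _ _ + act _ _
    rw [h_add, Pi.add_apply, map_add]
  map_smul' c Ψ := by
    rw [RingHom.id_apply, ← map_smul, ← MemLp.toLp_const_smul c (K.Sinv_h_memLp m e Ψ)]
    refine congrArg K.toL2S (MemLp.toLp_congr _ _ (Filter.Eventually.of_forall fun p => ?_))
    change act _ (K.h m e (c • (Ψ : ℝ × ℝ × ℝ → Spinor)) p) = c • act _ _
    rw [h_smul, Pi.smul_apply, map_smul]

/-- The operator `S⁻¹ H₀` in `L²_S(Ω₃)⁴` with domain `C₀^∞(Ω₃)⁴`. -/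
def SinvH₀ (m e : ℝ) : K.L2S →ₗ.[ℂ] K.L2S :=
  operatorOnTestFunctions (K.toL2S.toLinearMap ∘ₗ TestFunction.toL2) (K.SinvhL2S m e)
    (K.toL2S.injective.comp TestFunction.toL2_injective)

end Exterior

end KerrNewman

end

/-! Part (1) is a computation. The factor `(sin θ)^{1/2}` absorbs `cot θ / 2`, the tortoise
coordinate turns `Δ ∂_r` into `(r² + a²) ∂_x`, and after a permutation of the components and
multiplication by nonvanishing factors the Dirac system reads `i S ∂_t Ψ = h Ψ`
(`act_S_sub_h_rescale`). Since `|a √Δ sin θ / (r² + a²)| ≤ 1/2`, the matrix `S` is invertible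
(`dirac_iff_cauchy`).

For (2), symmetry holds because `⟨Ψ, hΦ⟩ - ⟨hΨ, Φ⟩` is a sum of derivatives whose coefficients do
not depend on the variable of differentiation (`inner_h_sub`); the boundary terms in `φ` cancel
because products of two antiperiodic functions are periodic. It remains to see that a vector `u`
with `⟨u, hΨ⟩ = ± i ⟨u, Ψ⟩` for all test functions vanishes. The functions with factor `e^{ikφ}`, `k
∈ ℤ + 1/2`, are total, so it suffices to study one `k`. There the operator is `-i s ∂_x - w A + B`
in `L²(ℝ; L²((0, π); ℂ⁴))`, with `s = diag(σ₃, -σ₃)`, `w = √Δ / (r² + a²)`, an angular Dirac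
operator `A`, and `B` bounded and symmetric.

The angular operator anticommutes with `s`. It is bounded below by a Poincaré inequality
(`integral_norm_sq_le`), and its range is dense because the solutions `tan(θ/2)^{±k}` of the
homogeneous equation are not square integrable when `|k| ≥ 1/2` (`denseRange_angDirac`). Hence it
has a bounded symmetric injective inverse `R` which anticommutes with `s`.

No eigenfunction expansion of `A` is used. If `u` is a deficiency vector of `D - w A`, where `D = -i
s ∂_x`, then testing with vectors `R η` shows that `R u` lies in the domain of `D*` and `D* R u = -w
u - z̄ R u`. The form of `D*` is real, because `D` is essentially selfadjoint by a scalar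
first-order equation, and `⟨R u, w u⟩` is real, because `R` and `w` commute and are symmetric. So
`Im z ‖R u‖² = 0`, and `u = 0` (`hasTrivialDeficiency_modeDirac`). Trivial deficiency spaces make
the quadratic form of the adjoint real (`IsSymmRel.hasRealAdjoint`), and this property survives the
addition of `B`.

The same property gives (3): a deficiency vector `v` of `S⁻¹ H₀` in the weighted space satisfies
`H₀* v = z̄ S v`, so `Im z (v, S v) = 0` and `v = 0`. -/

open MeasureTheory Set
open scoped Matrix ContDiff BoundedContinuousFunction

noncomputable section

/-! ## Symmetric relations in a Hilbert space -/

section Relations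

variable {E : Type*} [NormedAddCommGroup E] [InnerProductSpace ℂ E]

/-- A linear relation is symmetric if it is contained in its adjoint. -/
def IsSymmRel (G : Submodule ℂ (E × E)) : Prop :=
  ∀ p ∈ G, ∀ q ∈ G, inner ℂ p.1 q.2 = inner ℂ p.2 q.1

/-- `(u, f)` belongs to the adjoint of the relation `G`. -/
def IsAdjPair (G : Submodule ℂ (E × E)) (u f : E) : Prop :=
  ∀ p ∈ G, inner ℂ u p.2 = inner ℂ f p.1

/-- The deficiency spaces of `G` at `± i` are trivial. -/
def HasTrivialDeficiency (G : Submodule ℂ (E × E)) : Prop :=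
  ∀ z : ℂ, z = Complex.I ∨ z = -Complex.I → ∀ u : E,
    (∀ p ∈ G, inner ℂ u p.2 = z * inner ℂ u p.1) → u = 0

/-- The quadratic form of the adjoint of `G` is real. -/
def HasRealAdjoint (G : Submodule ℂ (E × E)) : Prop :=
  ∀ u f : E, IsAdjPair G u f → (inner ℂ u f).im = 0

theorem IsSymmRel.topologicalClosure {G : Submodule ℂ (E × E)} (hG : IsSymmRel G) :
    IsSymmRel G.topologicalClosure := by
  have h1 : ∀ p ∈ G, ∀ q ∈ G.topologicalClosure, inner ℂ p.1 q.2 = inner ℂ p.2 q.1 := by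
    intro p hp q hq
    have hcl : IsClosed {q : E × E | inner ℂ p.1 q.2 = inner ℂ p.2 q.1} :=
      isClosed_eq (by fun_prop) (by fun_prop)
    exact closure_minimal (fun q hq => hG p hp q hq) hcl hq
  intro p hp q hq
  have hcl : IsClosed {p : E × E | inner ℂ p.1 q.2 = inner ℂ p.2 q.1} :=
    isClosed_eq (by fun_prop) (by fun_prop)
  exact closure_minimal (fun p hp => h1 p hp q hq) hcl hp

theorem isSymmRel_span {s : Set (E × E)}
    (hs : ∀ p ∈ s, ∀ q ∈ s, inner ℂ p.1 q.2 = inner ℂ p.2 q.1) :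
    IsSymmRel (Submodule.span ℂ s) := by
  intro p hp q hq
  induction hp, hq using Submodule.span_induction₂ with
  | mem_mem p q hp hq => exact hs p hp q hq
  | zero_left q hq => simp
  | zero_right p hp => simp
  | add_left p p' q _ _ _ h1 h2 => simp [h1, h2]
  | add_right p q q' _ _ _ h1 h2 => simp [h1, h2]
  | smul_left c p q _ _ h => simp [h]
  | smul_right c p q _ _ h => simp [h]

theorem isAdjPair_span {s : Set (E × E)} {u f : E} :
    IsAdjPair (Submodule.span ℂ s) u f ↔ ∀ p ∈ s, inner ℂ u p.2 = inner ℂ f p.1 := by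
  refine ⟨fun h p hp => h p (Submodule.subset_span hp), fun h p hp => ?_⟩
  induction hp using Submodule.span_induction with
  | mem p hp => exact h p hp
  | zero => simp
  | add p q _ _ h1 h2 => simp [h1, h2]
  | smul c p _ h1 => simp [h1]

/-- For a symmetric relation `⟨f, u⟩` is real, so the cross term in `‖f + i u‖²` vanishes and the
square equals `‖f‖² + ‖u‖²`. The bound makes the range of `f + i u` over a closed symmetric relation
closed. -/
theorem IsSymmRel.norm_le {G : Submodule ℂ (E × E)} (hG : IsSymmRel G) {p : E × E}
    (hp : p ∈ G) : ‖p‖ ≤ ‖p.2 + Complex.I • p.1‖ := by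
  have h1 : ‖p.2 + Complex.I • p.1‖ ^ 2 = ‖p.2‖ ^ 2 + ‖p.1‖ ^ 2 := by
    rw [@norm_add_sq ℂ]
    have h2 : (inner ℂ p.2 p.1).im = 0 := by
      rw [← Complex.conj_eq_iff_im, inner_conj_symm]
      exact hG p hp p hp
    simp [inner_smul_right, norm_smul, h2]
  rw [Prod.norm_def]
  refine max_le ?_ ?_ <;> refine abs_le_of_sq_le_sq' ?_ (norm_nonneg _) |>.2 <;> rw [h1] <;>
    nlinarith [sq_nonneg ‖p.1‖, sq_nonneg ‖p.2‖]

/-- The basic criterion: a symmetric relation with trivial deficiency spaces has a selfadjoint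
closure. -/
theorem IsSymmRel.mem_topologicalClosure [CompleteSpace E] {G : Submodule ℂ (E × E)}
    (hG : IsSymmRel G) (hd : HasTrivialDeficiency G) {u f : E} (huf : IsAdjPair G u f) :
    (u, f) ∈ G.topologicalClosure := by
  have hGc := hG.topologicalClosure
  let L : G.topologicalClosure →L[ℂ] E :=
    (ContinuousLinearMap.snd ℂ E E + Complex.I • ContinuousLinearMap.fst ℂ E E).comp
      G.topologicalClosure.subtypeL
  have hLa : ∀ p, L p = p.1.2 + Complex.I • p.1.1 := fun p => rfl
  have hanti : AntilipschitzWith 1 L := by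
    refine ContinuousLinearMap.antilipschitz_of_bound _ fun p => ?_
    simpa [hLa] using hGc.norm_le p.2
  have hclosed : IsClosed (LinearMap.range L.toLinearMap : Set E) := by
    exact hanti.isClosed_range L.uniformContinuous
  have hcomplete : CompleteSpace (LinearMap.range L.toLinearMap) := hclosed.completeSpace_coe
  -- The range is closed, and a vector orthogonal to it is a deficiency vector for `-i`, hence zero.
  have htop : LinearMap.range L.toLinearMap = ⊤ := by
    rw [← Submodule.orthogonal_eq_bot_iff, Submodule.eq_bot_iff]
    intro v hv
    refine hd (-Complex.I) (Or.inr rfl) v fun p hp => ?_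
    have h1 := (Submodule.mem_orthogonal' _ _).1 hv _
      (LinearMap.mem_range_self L.toLinearMap ⟨p, G.le_topologicalClosure hp⟩)
    change inner ℂ v (p.2 + Complex.I • p.1) = 0 at h1
    rw [inner_add_right, inner_smul_right] at h1
    linear_combination h1
  obtain ⟨⟨q, hq⟩, hq2⟩ : f + Complex.I • u ∈ LinearMap.range L.toLinearMap :=
    htop ▸ Submodule.mem_top
  change q.2 + Complex.I • q.1 = f + Complex.I • u at hq2
  -- `q` lies in the closure and has the same value of `f + i u` as the given pair. The difference
  -- of the two pairs is therefore an adjoint pair `(v, -i v)`, so its first component is a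
  -- deficiency vector for `i`.
  have hw : u - q.1 = 0 := by
    refine hd Complex.I (Or.inl rfl) _ fun p hp => ?_
    have h1 := huf p hp
    have h2 := hGc q hq p (G.le_topologicalClosure hp)
    have h3 : f - q.2 = -Complex.I • (u - q.1) := by
      have h : f = q.2 + Complex.I • q.1 - Complex.I • u := by rw [hq2, add_sub_cancel_right]
      rw [h]
      module
    have h4 : inner ℂ (f - q.2) p.1 = Complex.I * inner ℂ (u - q.1) p.1 := by
      rw [h3, inner_smul_left, map_neg, Complex.conj_I, neg_neg]
    rw [← h4, inner_sub_left, inner_sub_left, h1, h2]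
  have hu : u = q.1 := sub_eq_zero.1 hw
  have hf : f = q.2 := by rw [hu] at hq2; exact (add_right_cancel hq2).symm
  rw [hu, hf]
  exact hq

/-- The adjoint pairs lie in the closure of `G`, which is symmetric. Essential selfadjointness is
passed on in this form because it is insensitive to bounded symmetric perturbations and to a change
of the scalar product. -/
theorem IsSymmRel.hasRealAdjoint [CompleteSpace E] {G : Submodule ℂ (E × E)}
    (hG : IsSymmRel G) (hd : HasTrivialDeficiency G) : HasRealAdjoint G := by
  intro u f huf
  have hm := hG.mem_topologicalClosure hd huf
  rw [← Complex.conj_eq_iff_im, inner_conj_symm]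
  exact (hG.topologicalClosure _ hm _ hm).symm

/-- Stability under bounded symmetric perturbations: the deficiency spaces of `G + B` are
trivial. -/
theorem HasRealAdjoint.eq_zero_of_isAdjPair {G : Submodule ℂ (E × E)} (h : HasRealAdjoint G)
    {B : E →L[ℂ] E} (hB : ∀ u v, inner ℂ (B u) v = inner ℂ u (B v)) {z : ℂ}
    (hz : z = Complex.I ∨ z = -Complex.I) {u : E}
    (hu : IsAdjPair G u ((starRingEnd ℂ) z • u - B u)) : u = 0 := by
  -- The form is real on the pair `(u, z̄ u - B u)` and `⟨u, B u⟩` is real, so only `Im z̄ ‖u‖² = 0`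
  -- remains.
  have h2 := h _ _ hu
  have h3 : (inner ℂ u (B u)).im = 0 := by
    rw [← Complex.conj_eq_iff_im, inner_conj_symm, hB]
  rw [inner_sub_right, inner_smul_right, Complex.sub_im, h3, inner_self_eq_norm_sq_to_K] at h2
  have h4 : ‖u‖ ^ 2 = 0 := by
    rcases hz with rfl | rfl <;> simpa [← Complex.ofReal_pow, Complex.mul_im] using h2
  simpa using h4

end Relations

/-! ### Essential selfadjointness from trivial deficiency spaces -/

/-- A criterion for essential selfadjointness. -/
theorem isEssentiallySelfAdjoint_of_deficiency {E : Type*} [NormedAddCommGroup E]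
    [InnerProductSpace ℂ E] [CompleteSpace E] {T : E →ₗ.[ℂ] E} (hT : Dense (T.domain : Set E))
    (hs : IsSymmRel T.graph) (hd : HasTrivialDeficiency T.graph) :
    IsEssentiallySelfAdjoint T := by
  have hf : T.IsFormalAdjoint T := fun x y =>
    (hs _ (T.mem_graph x) _ (T.mem_graph y)).symm
  have hle : T ≤ T.adjoint := hf.le_adjoint hT
  have hcl : T.adjoint.IsClosed := by
    exact LinearPMap.adjoint_isClosed hT
  have hc : T.IsClosable := hcl.isClosable.leIsClosable hle
  have hTc : Dense (T.closure.domain : Set E) := hT.mono T.le_closure.1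
  refine ⟨hT, hf, hc, ?_⟩
  rw [LinearPMap.isSelfAdjoint_def]
  refine LinearPMap.eq_of_eq_graph (le_antisymm ?_ ?_)
  · rw [LinearPMap.adjoint_graph_eq_graph_adjoint hTc, ← hc.graph_closure_eq_closure_graph]
    rintro ⟨u, f⟩ huf
    -- The adjoint of the closure is contained in the closure by the basic criterion; the reverse
    -- inclusion below is the symmetry of the closure.
    refine hs.mem_topologicalClosure hd fun p hp => ?_
    have h := (Submodule.mem_adjoint_iff _ _).1 huf p.1 p.2 (T.graph.le_topologicalClosure hp)
    have h2 := congrArg (starRingEnd ℂ) (sub_eq_zero.1 h)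
    simpa only [inner_conj_symm] using h2
  · rw [LinearPMap.adjoint_graph_eq_graph_adjoint hTc, ← hc.graph_closure_eq_closure_graph]
    rintro ⟨u, f⟩ huf
    refine (Submodule.mem_adjoint_iff _ _).2 fun a b hab => sub_eq_zero.2 ?_
    exact (hs.topologicalClosure _ hab _ huf).symm

/-- The graph of `operatorOnTestFunctions`. -/
theorem graph_operatorOnTestFunctions {V E : Type*} [AddCommGroup V] [Module ℂ V]
    [AddCommGroup E] [Module ℂ E] (ι T : V →ₗ[ℂ] E) (hι : Function.Injective ι) :
    (operatorOnTestFunctions ι T hι).graph = LinearMap.range (ι.prod T) := by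
  ext p
  rw [LinearPMap.mem_graph_iff]
  constructor
  · rintro ⟨⟨_, v, rfl⟩, h1, h2⟩
    refine ⟨v, Prod.ext h1 ?_⟩
    rw [← h2]
    exact (operatorOnTestFunctions_apply ι T hι v).symm
  · rintro ⟨v, rfl⟩
    exact ⟨⟨ι v, LinearMap.mem_range_self ι v⟩, rfl, operatorOnTestFunctions_apply ι T hι v⟩

theorem isEssentiallySelfAdjoint_operatorOnTestFunctions {V E : Type*} [AddCommGroup V]
    [Module ℂ V] [NormedAddCommGroup E] [InnerProductSpace ℂ E] [CompleteSpace E]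
    (ι T : V →ₗ[ℂ] E) (hι : Function.Injective ι)
    (hdense : ∀ u : E, (∀ v, inner ℂ u (ι v) = 0) → u = 0)
    (hsymm : ∀ v w, inner ℂ (ι v) (T w) = inner ℂ (T v) (ι w))
    (hdef : ∀ z : ℂ, z = Complex.I ∨ z = -Complex.I → ∀ u : E,
      (∀ v, inner ℂ u (T v) = z * inner ℂ u (ι v)) → u = 0) :
    IsEssentiallySelfAdjoint (operatorOnTestFunctions ι T hι) := by
  refine isEssentiallySelfAdjoint_of_deficiency ?_ ?_ ?_
  · change Dense (LinearMap.range ι : Set E)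
    rw [Submodule.dense_iff_topologicalClosure_eq_top, Submodule.topologicalClosure_eq_top_iff,
      Submodule.eq_bot_iff]
    exact fun u hu => hdense u fun v =>
      (Submodule.mem_orthogonal' _ _).1 hu _ (LinearMap.mem_range_self ι v)
  · rw [graph_operatorOnTestFunctions]
    rintro _ ⟨v, rfl⟩ _ ⟨w, rfl⟩
    exact hsymm v w
  · rw [graph_operatorOnTestFunctions]
    exact fun z hz u hu => hdef z hz u fun v => hu _ ⟨v, rfl⟩

/-! ## Test functions of one variable -/

/-- Smooth functions with compact support in `U`. -/
structure IsTest {F : Type*} [NormedAddCommGroup F] [NormedSpace ℝ F] (U : Set ℝ) (f : ℝ → F) :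
    Prop where
  contDiff : ContDiff ℝ ∞ f
  hasCompactSupport : HasCompactSupport f
  tsupport_subset : tsupport f ⊆ U

namespace IsTest

variable {F : Type*} [NormedAddCommGroup F] [NormedSpace ℝ F] {U : Set ℝ} {f g : ℝ → F}

theorem eq_zero (hf : IsTest U f) {x : ℝ} (hx : x ∉ U) : f x = 0 :=
  image_eq_zero_of_notMem_tsupport fun h => hx (hf.tsupport_subset h)

theorem add (hf : IsTest U f) (hg : IsTest U g) : IsTest U (f + g) :=
  ⟨hf.contDiff.add hg.contDiff, hf.hasCompactSupport.add hg.hasCompactSupport,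
    (tsupport_add f g).trans (union_subset hf.tsupport_subset hg.tsupport_subset)⟩

theorem zero : IsTest U (0 : ℝ → F) :=
  ⟨contDiff_const, HasCompactSupport.zero, by simp [tsupport]⟩

/-- The image of a test function under a linear map. -/
theorem comp_left {F' : Type*} [NormedAddCommGroup F'] [NormedSpace ℝ F'] (hf : IsTest U f)
    (L : F →L[ℝ] F') : IsTest U (fun x => L (f x)) :=
  ⟨L.contDiff.comp hf.contDiff, hf.hasCompactSupport.comp_left (g := L) (map_zero L),
    (closure_mono (Function.support_comp_subset (g := L) (map_zero L) f)).trans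
      hf.tsupport_subset⟩

theorem deriv (hf : IsTest U f) : IsTest U (deriv f) :=
  ⟨(contDiff_infty_iff_deriv.1 hf.contDiff).2, hf.hasCompactSupport.deriv,
    (closure_minimal support_deriv_subset (isClosed_tsupport f)).trans hf.tsupport_subset⟩

theorem differentiable (hf : IsTest U f) : Differentiable ℝ f :=
  hf.contDiff.differentiable (by simp)

theorem hasDerivAt (hf : IsTest U f) (x : ℝ) : HasDerivAt f (_root_.deriv f x) x :=
  (hf.differentiable x).hasDerivAt

theorem continuous (hf : IsTest U f) : Continuous f := hf.contDiff.continuous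

theorem integrable (hf : IsTest U f) : Integrable f :=
  hf.continuous.integrable_of_hasCompactSupport hf.hasCompactSupport

theorem memLp (hf : IsTest U f) {s : Set ℝ} : MemLp f 2 (volume.restrict s) :=
  (hf.continuous.memLp_of_hasCompactSupport hf.hasCompactSupport).restrict s

/-- Multiplication by a function which is smooth in `U`. -/
theorem smul {q : ℝ → ℝ} (hf : IsTest U f) (hU : IsOpen U) (hq : ContDiffOn ℝ ∞ q U) :
    IsTest U (fun x => q x • f x) := by
  have hsub : tsupport (fun x => q x • f x) ⊆ tsupport f :=
    closure_mono (Function.support_smul_subset_right q f)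
  refine ⟨contDiff_iff_contDiffAt.2 fun x => ?_, hf.hasCompactSupport.mono'
    ((Function.support_smul_subset_right q f).trans subset_closure),
    hsub.trans hf.tsupport_subset⟩
  -- The factor `q` is arbitrary outside `U`; there, and more generally off the support of `f`, the
  -- product vanishes in a neighbourhood of the point.
  by_cases hx : x ∈ tsupport f
  · exact (hq.contDiffAt (hU.mem_nhds (hf.tsupport_subset hx))).smul hf.contDiff.contDiffAt
  · refine (contDiffAt_const (c := (0 : F))).congr_of_eventuallyEq ?_
    filter_upwards [(isClosed_tsupport f).isOpen_compl.mem_nhds hx] with y hy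
    rw [image_eq_zero_of_notMem_tsupport hy, smul_zero]

theorem smul_const {f : ℝ → ℝ} (hf : IsTest U f) (v : F) : IsTest U (fun x => f x • v) :=
  hf.comp_left ((ContinuousLinearMap.id ℝ ℝ).smulRight v)

theorem integrable_smul {f : ℝ → ℝ} {G : ℝ → F} (hf : IsTest U f)
    (hG : LocallyIntegrableOn G U) : Integrable (fun x => f x • G x) := by
  have h1 : IntegrableOn G (tsupport f) :=
    (hG.mono_set hf.tsupport_subset).integrableOn_isCompact hf.hasCompactSupport
  have h2 : IntegrableOn (fun x => f x • G x) (tsupport f) :=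
    h1.continuousOn_smul hf.continuous.continuousOn hf.hasCompactSupport
  refine (integrableOn_iff_integrable_of_support_subset ?_).1 h2
  exact (Function.support_smul_subset_left f G).trans subset_closure

end IsTest

theorem exists_isTest_integral_eq_one {U : Set ℝ} (hU : IsOpen U) (hne : U.Nonempty) :
    ∃ ρ : ℝ → ℝ, IsTest U ρ ∧ ∫ x, ρ x = 1 := by
  obtain ⟨x, hx⟩ := hne
  obtain ⟨f, h1, h2, h3, h4, h5⟩ := exists_contDiff_tsupport_subset (n := ⊤) (hU.mem_nhds hx)
  have hf : IsTest U f := ⟨h3, h2, h1⟩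
  have hpos : 0 < ∫ x, f x :=
    hf.continuous.integral_pos_of_hasCompactSupport_nonneg_nonzero hf.hasCompactSupport
      (fun y => (h4 (mem_range_self y)).1) (by rw [h5]; exact one_ne_zero : f x ≠ 0)
  refine ⟨fun y => (∫ x, f x)⁻¹ • f y, hf.comp_left
    ((∫ x, f x)⁻¹ • ContinuousLinearMap.id ℝ ℝ), ?_⟩
  rw [integral_smul, smul_eq_mul, inv_mul_cancel₀ hpos.ne']

/-- A test function with integral zero is the derivative of a test function. -/
theorem IsTest.exists_primitive {U : Set ℝ} (hUc : U.OrdConnected) {ρ : ℝ → ℝ}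
    (hρ : IsTest U ρ) (h0 : ∫ x, ρ x = 0) : ∃ P : ℝ → ℝ, IsTest U P ∧ _root_.deriv P = ρ := by
  rcases (tsupport ρ).eq_empty_or_nonempty with he | hne
  · have : ρ = 0 := funext fun x => image_eq_zero_of_notMem_tsupport (by simp [he])
    exact ⟨0, .zero, by rw [this]; exact deriv_const' 0⟩
  obtain ⟨a, ha, hal⟩ := hρ.hasCompactSupport.isCompact.exists_isLeast hne
  obtain ⟨b, hb, hbu⟩ := hρ.hasCompactSupport.isCompact.exists_isGreatest hne
  have hab : Icc a b ⊆ U := hUc.out (hρ.tsupport_subset ha) (hρ.tsupport_subset hb)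
  -- This primitive vanishes to the left of the support of `ρ`, and to its right because the total
  -- integral of `ρ` is zero.
  let P : ℝ → ℝ := fun x => ∫ t in Iic x, ρ t
  have hP : ∀ x, HasDerivAt P (ρ x) x := by
    intro x
    have h1 : P = fun x => (∫ t in (0 : ℝ)..x, ρ t) + P 0 := funext fun x => by
      rw [← intervalIntegral.integral_Iic_sub_Iic hρ.integrable.integrableOn
        hρ.integrable.integrableOn]
      simp [P]
    rw [h1]
    exact (intervalIntegral.integral_hasDerivAt_right (hρ.continuous.intervalIntegrable _ _)
      (hρ.continuous.stronglyMeasurableAtFilter _ _) hρ.continuous.continuousAt).add_const _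
  have hd : _root_.deriv P = ρ := funext fun x => (hP x).deriv
  have hsupp : Function.support P ⊆ Icc a b := by
    intro x hx
    by_contra hx'
    refine hx ?_
    rw [mem_Icc, not_and_or, not_le, not_le] at hx'
    rcases hx' with hx' | hx'
    · refine setIntegral_eq_zero_of_forall_eq_zero fun t ht => ?_
      refine image_eq_zero_of_notMem_tsupport fun hts => ?_
      exact absurd (hal hts) (not_le.2 (lt_of_le_of_lt ht hx'))
    · refine (setIntegral_eq_integral_of_forall_compl_eq_zero fun t ht => ?_).trans h0
      refine image_eq_zero_of_notMem_tsupport fun hts => ht ?_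
      exact (hbu hts).trans hx'.le
  have hts : tsupport P ⊆ Icc a b := closure_minimal hsupp isClosed_Icc
  refine ⟨P, ⟨contDiff_infty_iff_deriv.2 ⟨fun x => (hP x).differentiableAt, ?_⟩,
    HasCompactSupport.of_support_subset_isCompact isCompact_Icc hsupp, hts.trans hab⟩, hd⟩
  rw [hd]
  exact hρ.contDiff

/-! ### Weak solutions of first-order scalar equations -/

/-- A function with vanishing weak derivative is constant. -/
theorem exists_ae_eq_const_of_weak_deriv_eq_zero {U : Set ℝ} (hU : IsOpen U)
    (hUc : U.OrdConnected) {G : ℝ → ℂ} (hG : LocallyIntegrableOn G U)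
    (h : ∀ χ : ℝ → ℝ, IsTest U χ → ∫ x, deriv χ x • G x = 0) :
    ∃ c : ℂ, ∀ᵐ x, x ∈ U → G x = c := by
  rcases U.eq_empty_or_nonempty with rfl | hne
  · exact ⟨0, by simp⟩
  obtain ⟨ρ₀, hρ₀, h1⟩ := exists_isTest_integral_eq_one hU hne
  let c : ℂ := ∫ x, ρ₀ x • G x
  refine ⟨c, ?_⟩
  have hGc : LocallyIntegrableOn (fun x => G x - c) U :=
    hG.sub (locallyIntegrableOn_const c)
  have key := hU.ae_eq_zero_of_integral_contDiff_smul_eq_zero hGc fun ρ k1 k2 k3 => by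
    have hρ : IsTest U ρ := ⟨k1, k2, k3⟩
    -- Since `ρ₀` has integral one, `ρ - m ρ₀` has integral zero, is the derivative of a test
    -- function and annihilates `G`. Thus `∫ ρ G = m c`.
    let m : ℝ := ∫ x, ρ x
    have hφ : IsTest U (ρ + fun x => (-m) • ρ₀ x) :=
      hρ.add (hρ₀.comp_left ((-m) • ContinuousLinearMap.id ℝ ℝ))
    have hφ0 : ∫ x, (ρ + fun x => (-m) • ρ₀ x) x = 0 := by
      simp only [Pi.add_apply]
      have hi : Integrable (fun x => (-m) • ρ₀ x) := hρ₀.integrable.const_mul (-m)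
      rw [integral_add hρ.integrable hi, integral_smul, h1]
      simp [m]
    obtain ⟨P, hP, hd⟩ := hφ.exists_primitive hUc hφ0
    have h2 := h P hP
    rw [hd] at h2
    have e1 : ∀ x, (ρ + fun x => (-m) • ρ₀ x) x • G x = ρ x • G x - m • (ρ₀ x • G x) := by
      intro x
      simp only [Pi.add_apply]
      module
    simp only [e1] at h2
    have hi : Integrable (fun x => m • ρ₀ x • G x) := (hρ₀.integrable_smul hG).smul m
    rw [integral_sub (hρ.integrable_smul hG) hi,
      integral_smul] at h2
    simp only [smul_sub]
    rw [integral_sub (hρ.integrable_smul hG) (hρ.integrable.smul_const c),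
      integral_smul_const]
    exact h2
  filter_upwards [key] with x hx hxU using sub_eq_zero.1 (hx hxU)

/-- Weak solutions of `G' = -q G` are multiples of `1 / E` if `E' = q E`. -/
theorem exists_ae_eq_div_of_weak_solution {U : Set ℝ} (hU : IsOpen U)
    (hUc : U.OrdConnected) {q W : ℝ → ℝ} (hW : ContDiffOn ℝ ∞ W U) (hW0 : ∀ x ∈ U, W x ≠ 0)
    (hWd : ∀ x ∈ U, HasDerivAt W (q x * W x) x) {G : ℝ → ℂ} (hG : LocallyIntegrableOn G U)
    (h : ∀ χ : ℝ → ℝ, IsTest U χ → ∫ x, (deriv χ x - q x * χ x) • G x = 0) :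
    ∃ c : ℂ, ∀ᵐ x, x ∈ U → G x = c * ((W x)⁻¹ : ℝ) := by
  have hWG : LocallyIntegrableOn (fun x => W x • G x) U :=
    hG.continuousOn_smul hU.isLocallyClosed hW.continuousOn
  -- Integrating factor: inserting the test function `W χ` into the weak equation removes `q`,
  -- because `(W χ)' - q W χ = W χ'`.
  obtain ⟨c, hc⟩ := exists_ae_eq_const_of_weak_deriv_eq_zero hU hUc hWG fun χ hχ => by
    rw [← h _ (hχ.smul hU hW)]
    refine integral_congr_ae (Filter.Eventually.of_forall fun x => ?_)
    by_cases hx : x ∈ U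
    · have h1 : deriv (fun x => W x • χ x) x = q x * W x * χ x + W x * deriv χ x := by
        refine ((hWd x hx).mul (hχ.hasDerivAt x)).deriv.trans ?_
        ring
      simp only [h1]
      rw [smul_smul]
      congr 1
      simp only [smul_eq_mul]
      ring
    · simp only [hχ.deriv.eq_zero hx, (hχ.smul hU hW).deriv.eq_zero hx, hχ.eq_zero hx]
      simp
  refine ⟨c, ?_⟩
  filter_upwards [hc] with x hx hxU
  have h1 := hx hxU
  have h2 : (W x : ℂ) ≠ 0 := by exact_mod_cast hW0 x hxU
  rw [Complex.real_smul] at h1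
  rw [← h1, Complex.ofReal_inv]
  field_simp

/-- A square integrable weak solution of `G' = -q G` vanishes if `1 / W` is not square
integrable. -/
theorem ae_eq_zero_of_weak_solution {U : Set ℝ} (hU : IsOpen U)
    (hUc : U.OrdConnected) {q W : ℝ → ℝ} (hW : ContDiffOn ℝ ∞ W U) (hW0 : ∀ x ∈ U, W x ≠ 0)
    (hWd : ∀ x ∈ U, HasDerivAt W (q x * W x) x)
    (hWi : ¬ IntegrableOn (fun x => (W x)⁻¹ ^ 2) U)
    {G : ℝ → ℂ} (hG : MemLp G 2 (volume.restrict U))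
    (h : ∀ χ : ℝ → ℝ, IsTest U χ → ∫ x, (deriv χ x - q x * χ x) • G x = 0) :
    G =ᵐ[volume.restrict U] 0 := by
  have hloc : LocallyIntegrableOn G U :=
    (locallyIntegrableOn_of_locallyIntegrable_restrict (hG.locallyIntegrable one_le_two))
  obtain ⟨c, hc⟩ := exists_ae_eq_div_of_weak_solution hU hUc hW hW0 hWd hloc h
  have hc' : ∀ᵐ x ∂volume.restrict U, G x = c * ((W x)⁻¹ : ℝ) :=
    (ae_restrict_iff' hU.measurableSet).2 hc
  by_cases h0 : c = 0
  · filter_upwards [hc'] with x hx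
    rw [hx, h0, zero_mul, Pi.zero_apply]
  · refine absurd ?_ hWi
    have h1 : Integrable (fun x => ‖c‖⁻¹ ^ 2 * ‖G x‖ ^ 2) (volume.restrict U) :=
      (hG.integrable_norm_pow two_ne_zero).const_mul _
    refine h1.congr ?_
    filter_upwards [hc'] with x hx
    rw [hx, norm_mul, mul_pow, Complex.norm_real, Real.norm_eq_abs, sq_abs, ← mul_assoc,
      ← mul_pow, inv_mul_cancel₀ (norm_ne_zero_iff.2 h0), one_pow, one_mul]

/-- The solutions are multiples of `e^{-s x}`. For every real `s`, including zero, such an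
exponential is at least one on a half-line. -/
theorem ae_eq_zero_of_weak_solution_line {s : ℝ} {G : ℝ → ℂ}
    (hG : MemLp G 2) (h : ∀ χ : ℝ → ℝ, IsTest univ χ → ∫ x, (deriv χ x - s * χ x) • G x = 0) :
    G =ᵐ[volume] 0 := by
  have h1 := ae_eq_zero_of_weak_solution isOpen_univ ordConnected_univ (q := fun _ => s)
    (W := fun x => Real.exp (s * x)) (by fun_prop) (fun x _ => (Real.exp_pos _).ne')
    (fun x _ => by simpa [mul_comm] using ((hasDerivAt_id x).const_mul s).exp) ?_
    (G := G) (by simpa using hG) h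
  · simpa using h1
  intro hi
  rw [integrableOn_univ] at hi
  -- If `s x ≤ 0` on `S`, the integrable function `e^{-2 s x}` is at least one there, so `S` has
  -- finite measure. The two half-lines then force opposite signs of `s`.
  have h2 : ∀ S : Set ℝ, MeasurableSet S → volume S = ⊤ → ∃ x ∈ S, 0 < s * x := by
    intro S hS hS'
    by_contra! hx
    have h3 : IntegrableOn (fun _ => (1 : ℝ)) S := by
      refine Integrable.mono' hi.integrableOn aestronglyMeasurable_const ?_
      refine (ae_restrict_iff' hS).2 (Filter.Eventually.of_forall fun x hxS => ?_)
      rw [norm_one, ← Real.exp_neg]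
      exact one_le_pow₀ (Real.one_le_exp (by linarith [hx x hxS]))
    rw [integrableOn_const_iff] at h3
    simp [hS'] at h3
  obtain ⟨x, hx, hx'⟩ := h2 (Ioi 0) measurableSet_Ioi Real.volume_Ioi
  obtain ⟨y, hy, hy'⟩ := h2 (Iio 0) measurableSet_Iio Real.volume_Iio
  rw [mem_Ioi] at hx
  rw [mem_Iio] at hy
  nlinarith [mul_pos hx' hx, mul_pos hy' (neg_pos.2 hy), (pos_of_mul_pos_left hx' hx.le)]

/-! ### The singular equation on the arc `(0, π)` -/

/-- The function `log tan (θ / 2)`, a primitive of `1 / sin θ`. -/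
def logTan (θ : ℝ) : ℝ := Real.log (Real.sin (θ / 2)) - Real.log (Real.cos (θ / 2))

theorem sin_half_pos {θ : ℝ} (hθ : θ ∈ Ioo 0 Real.pi) : 0 < Real.sin (θ / 2) :=
  Real.sin_pos_of_pos_of_lt_pi (by linarith [hθ.1]) (by linarith [hθ.1, hθ.2])

theorem cos_half_pos {θ : ℝ} (hθ : θ ∈ Ioo 0 Real.pi) : 0 < Real.cos (θ / 2) :=
  Real.cos_pos_of_mem_Ioo ⟨by linarith [hθ.1, hθ.2], by linarith [hθ.2]⟩

theorem hasDerivAt_logTan {θ : ℝ} (hθ : θ ∈ Ioo 0 Real.pi) :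
    HasDerivAt logTan (1 / Real.sin θ) θ := by
  have hs := sin_half_pos hθ
  have hc := cos_half_pos hθ
  have h0 : HasDerivAt (fun θ : ℝ => θ / 2) (1 / 2) θ := (hasDerivAt_id θ).div_const 2
  refine ((h0.sin.log hs.ne').sub (h0.cos.log hc.ne')).congr_deriv ?_
  have h1 : Real.sin θ = 2 * Real.sin (θ / 2) * Real.cos (θ / 2) := by
    rw [← Real.sin_two_mul]; ring_nf
  rw [h1]
  field_simp
  rw [sub_neg_eq_add, Real.cos_sq_add_sin_sq]

theorem contDiffOn_logTan : ContDiffOn ℝ ∞ logTan (Ioo 0 Real.pi) := by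
  refine ContDiffOn.sub (ContDiffOn.log (by fun_prop) fun θ hθ => (sin_half_pos hθ).ne')
    (ContDiffOn.log (by fun_prop) fun θ hθ => (cos_half_pos hθ).ne')

/-- The exponential is `cot (θ/2)`, and `cos (θ/2) ≥ 1/2`, `sin (θ/2) ≤ θ/2`. The sign of the
logarithm is recorded so that a power at least one of the cotangent can be bounded below by the
cotangent itself. -/
theorem inv_le_exp_neg_logTan {θ : ℝ} (h0 : 0 < θ) (h1 : θ < Real.pi / 2) :
    θ⁻¹ ≤ Real.exp (-logTan θ) ∧ logTan θ ≤ 0 := by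
  have hpi := Real.pi_pos
  have hθ : θ ∈ Ioo 0 Real.pi := ⟨h0, by linarith⟩
  have hs := sin_half_pos hθ
  have hc := cos_half_pos hθ
  have h2 : 1 / 2 ≤ Real.cos (θ / 2) := by
    rw [← Real.cos_pi_div_three]
    exact Real.cos_le_cos_of_nonneg_of_le_pi (by linarith) (by linarith) (by linarith)
  have h3 : Real.sin (θ / 2) ≤ θ / 2 := Real.sin_le (by linarith)
  constructor
  · rw [logTan, neg_sub, Real.exp_sub, Real.exp_log hs, Real.exp_log hc, inv_eq_one_div,
      div_le_div_iff₀ h0 hs]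
    nlinarith
  · rw [logTan, sub_nonpos]
    refine Real.log_le_log hs ?_
    rw [← Real.sin_pi_div_two_sub]
    exact Real.sin_le_sin_of_le_of_le_pi_div_two (by linarith) (by linarith) (by linarith)

theorem logTan_pi_sub (θ : ℝ) : logTan (Real.pi - θ) = -logTan θ := by
  have h : (Real.pi - θ) / 2 = Real.pi / 2 - θ / 2 := by ring
  rw [logTan, logTan, h, Real.sin_pi_div_two_sub, Real.cos_pi_div_two_sub]
  ring

/-- The integrand is `cot (θ/2)^{2κ}`. It dominates `1/θ` near `0` if `2κ ≥ 1` and, by reflection,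
`1/(π - θ)` near `π` if `2κ ≤ -1`. The threshold `1/2` is the least modulus of a half-integer; this
is what the antiperiodic boundary condition provides. -/
theorem not_integrableOn_exp_logTan {κ : ℝ} (hκ : 1 / 2 ≤ |κ|) :
    ¬ IntegrableOn (fun θ => (Real.exp (κ * logTan θ))⁻¹ ^ 2) (Ioo 0 Real.pi) := by
  have hpi := Real.pi_pos
  intro hi
  have e1 : ∀ θ, (Real.exp (κ * logTan θ))⁻¹ ^ 2 = Real.exp (-(2 * κ * logTan θ)) := by
    intro θ
    rw [← Real.exp_neg, ← Real.exp_nat_mul]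
    congr 1
    push_cast
    ring
  simp only [e1] at hi
  rcases le_abs.1 hκ with hκ | hκ
  · have h1 : IntervalIntegrable (fun x : ℝ => x⁻¹) volume 0 (Real.pi / 2) := by
      rw [intervalIntegrable_iff_integrableOn_Ioo_of_le (by linarith)]
      refine Integrable.mono' (hi.mono_set (Ioo_subset_Ioo_right (by linarith)))
        measurable_inv.aestronglyMeasurable ?_
      refine (ae_restrict_iff' measurableSet_Ioo).2 (Filter.Eventually.of_forall fun θ hθ => ?_)
      obtain ⟨h1, h2⟩ := inv_le_exp_neg_logTan hθ.1 hθ.2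
      rw [Real.norm_of_nonneg (inv_nonneg.2 hθ.1.le)]
      refine h1.trans (Real.exp_le_exp.2 ?_)
      nlinarith
    rw [intervalIntegrable_inv_iff] at h1
    rcases h1 with h1 | h1
    · linarith
    · exact h1 left_mem_uIcc
  · have h1 : IntervalIntegrable (fun x : ℝ => (x - Real.pi)⁻¹) volume (Real.pi / 2) Real.pi := by
      rw [intervalIntegrable_iff_integrableOn_Ioo_of_le (by linarith)]
      refine Integrable.mono' (hi.mono_set (Ioo_subset_Ioo_left (by linarith)))
        (by fun_prop) ?_
      refine (ae_restrict_iff' measurableSet_Ioo).2 (Filter.Eventually.of_forall fun θ hθ => ?_)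
      obtain ⟨h1, h2⟩ := inv_le_exp_neg_logTan (θ := Real.pi - θ) (by linarith [hθ.2])
        (by linarith [hθ.1])
      rw [logTan_pi_sub] at h1 h2
      rw [← neg_sub, inv_neg, norm_neg, Real.norm_of_nonneg (inv_nonneg.2 (by linarith [hθ.2]))]
      refine h1.trans (Real.exp_le_exp.2 ?_)
      nlinarith
    rw [intervalIntegrable_sub_inv_iff] at h1
    rcases h1 with h1 | h1
    · linarith
    · exact h1 right_mem_uIcc

theorem ae_eq_zero_of_weak_solution_arc {κ : ℝ} (hκ : 1 / 2 ≤ |κ|) {G : ℝ → ℂ}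
    (hG : MemLp G 2 (volume.restrict (Ioo 0 Real.pi)))
    (h : ∀ χ : ℝ → ℝ, IsTest (Ioo 0 Real.pi) χ →
      ∫ θ, (deriv χ θ - κ / Real.sin θ * χ θ) • G θ = 0) :
    G =ᵐ[volume.restrict (Ioo 0 Real.pi)] 0 := by
  refine ae_eq_zero_of_weak_solution isOpen_Ioo ordConnected_Ioo
    (W := fun θ => Real.exp (κ * logTan θ)) (contDiffOn_const.mul contDiffOn_logTan).exp
    (fun θ _ => (Real.exp_pos _).ne') (fun θ hθ => ?_) (not_integrableOn_exp_logTan hκ) hG h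
  convert ((hasDerivAt_logTan hθ).const_mul κ).exp using 1
  ring

/-! ## Bounded inverses of symmetric operators -/

/-- A symmetric operator with dense range which is bounded below has a bounded symmetric injective
inverse; it anticommutes with `s` if the operator does. -/
theorem exists_symmetric_inverse {V E : Type*} [AddCommGroup V] [Module ℂ V]
    [NormedAddCommGroup E] [InnerProductSpace ℂ E] [CompleteSpace E] (ι A : V →ₗ[ℂ] E) {C : ℝ}
    (hC : ∀ v, ‖ι v‖ ≤ C * ‖A v‖) (hι : ∀ u : E, (∀ v, inner ℂ u (ι v) = 0) → u = 0)
    (hA : DenseRange A) (hs : ∀ v w, inner ℂ (ι v) (A w) = inner ℂ (A v) (ι w))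
    (s : E →L[ℂ] E) (s' : V → V) (h1 : ∀ v, ι (s' v) = s (ι v)) (h2 : ∀ v, A (s' v) = -s (A v)) :
    ∃ R : E →L[ℂ] E, (∀ v, R (A v) = ι v) ∧ (∀ u v, inner ℂ (R u) v = inner ℂ u (R v)) ∧
      (∀ u, R u = 0 → u = 0) ∧ ∀ u, R (s u) = -s (R u) := by
  -- The lower bound makes `A v ↦ ι v` well defined and bounded on the dense range of `A`; `R` is
  -- its continuous extension.
  let R : E →L[ℂ] E := ι.extendOfNorm A
  have hR : ∀ v, R (A v) = ι v := fun v => LinearMap.extendOfNorm_eq hA ⟨C, hC⟩ v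
  have hsym : ∀ u v, inner ℂ (R u) v = inner ℂ u (R v) := by
    intro u v
    refine hA.induction_on₂ (p := fun u v => inner ℂ (R u) v = inner ℂ u (R v))
      (isClosed_eq (by fun_prop) (by fun_prop)) (fun v w => ?_) u v
    rw [hR, hR, hs]
  refine ⟨R, hR, hsym, fun u hu => hι u fun v => ?_, fun u => ?_⟩
  -- Injectivity: `⟨u, ι v⟩ = ⟨u, R A v⟩ = ⟨R u, A v⟩ = 0`, and the vectors `ι v` are total.
  · rw [← hR, ← hsym, hu, inner_zero_left]
  · refine hA.induction_on (p := fun u => R (s u) = -s (R u)) u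
      (isClosed_eq (by fun_prop) (by fun_prop)) fun v => ?_
    rw [hR, ← h1, ← hR (s' v), h2, map_neg, neg_neg]

namespace KerrNewman

/-! ## Matrices in block form -/

theorem act_block_apply (A B C D : Matrix (Fin 2) (Fin 2) ℂ) (v : Spinor) :
    act (block A B C D) v = !₂[A 0 0 * v 0 + A 0 1 * v 1 + B 0 0 * v 2 + B 0 1 * v 3,
      A 1 0 * v 0 + A 1 1 * v 1 + B 1 0 * v 2 + B 1 1 * v 3,
      C 0 0 * v 0 + C 0 1 * v 1 + D 0 0 * v 2 + D 0 1 * v 3,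
      C 1 0 * v 0 + C 1 1 * v 1 + D 1 0 * v 2 + D 1 1 * v 3] := by
  have e0 : (finSumFinEquiv (m := 2) (n := 2)).symm 0 = Sum.inl 0 := rfl
  have e1 : (finSumFinEquiv (m := 2) (n := 2)).symm 1 = Sum.inl 1 := rfl
  have e2 : (finSumFinEquiv (m := 2) (n := 2)).symm 2 = Sum.inr 0 := rfl
  have e3 : (finSumFinEquiv (m := 2) (n := 2)).symm 3 = Sum.inr 1 := rfl
  ext i
  rw [act, Matrix.ofLp_toEuclideanCLM, Matrix.mulVec, dotProduct, Fin.sum_univ_four]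
  fin_cases i <;> simp [block, e0, e1, e2, e3]

theorem act_act (A B : Matrix (Fin 4) (Fin 4) ℂ) (v : Spinor) :
    act A (act B v) = act (A * B) v := by
  rw [act, act, act, map_mul]; rfl

theorem act_conjTranspose_inner (A : Matrix (Fin 4) (Fin 4) ℂ) (v u : Spinor) :
    inner ℂ (act Aᴴ v) u = inner ℂ v (act A u) := by
  have h1 : ContinuousLinearMap.adjoint (act A) = act Aᴴ := by
    rw [← ContinuousLinearMap.star_eq_adjoint, act, ← map_star, Matrix.star_eq_conjTranspose]; rfl
  rw [← h1, ContinuousLinearMap.adjoint_inner_left]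
  
theorem inner_act_block_of_isHermitian {A B C D : Matrix (Fin 2) (Fin 2) ℂ}
    (hA : A.IsHermitian) (hD : D.IsHermitian) (hB : Bᴴ = C) (v u : Spinor) :
    inner ℂ (act (block A B C D) v) u = inner ℂ v (act (block A B C D) u) := by
  subst hB
  rw [← act_conjTranspose_inner, block, Matrix.conjTranspose_submatrix,
    Matrix.fromBlocks_conjTranspose,
    hA, hD, Matrix.conjTranspose_conjTranspose]

theorem block_mul_block (A B C D A' B' C' D' : Matrix (Fin 2) (Fin 2) ℂ) :
    block A B C D * block A' B' C' D' =
      block (A * A' + B * C') (A * B' + B * D') (C * A' + D * C') (C * B' + D * D') := by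
  rw [block, block, Matrix.submatrix_mul_equiv, Matrix.fromBlocks_multiply]; rfl

/-- The matrix `diag(M, -M)`. -/
abbrev diagBlock (M : Matrix (Fin 2) (Fin 2) ℂ) : Matrix (Fin 4) (Fin 4) ℂ := block M 0 0 (-M)

theorem inner_act_diagBlock {M : Matrix (Fin 2) (Fin 2) ℂ} (hM : M.IsHermitian) (v u : Spinor) :
    inner ℂ (act (diagBlock M) v) u = inner ℂ v (act (diagBlock M) u) :=
  inner_act_block_of_isHermitian hM hM.neg (by simp) v u

theorem act_diagBlock_anticomm {M N : Matrix (Fin 2) (Fin 2) ℂ} (h : M * N = -(N * M))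
    (v : Spinor) : act (diagBlock M) (act (diagBlock N) v)
      = -act (diagBlock N) (act (diagBlock M) v) := by
  have h1 : diagBlock M * diagBlock N = -(diagBlock N * diagBlock M) := by
    rw [block_mul_block, block_mul_block]
    simp only [mul_zero, zero_mul, add_zero, zero_add, neg_mul_neg, h]
    have h2 : Matrix.fromBlocks (-(N * M)) 0 0 (-(N * M))
        = -Matrix.fromBlocks (N * M) 0 0 (N * M) := by
      rw [Matrix.fromBlocks_neg, neg_zero]
    rw [block, block, h2]
    rfl
  rw [act_act, act_act, h1, act, act, map_neg]
  rfl

theorem isHermitian_σ₁ : σ₁.IsHermitian := by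
  ext i j; fin_cases i <;> fin_cases j <;> simp [σ₁, Matrix.conjTranspose_apply]

theorem isHermitian_σ₂ : σ₂.IsHermitian := by
  ext i j; fin_cases i <;> fin_cases j <;> simp [σ₂, Matrix.conjTranspose_apply]

theorem isHermitian_σ₃ : σ₃.IsHermitian := by
  ext i j; fin_cases i <;> fin_cases j <;> simp [σ₃, Matrix.conjTranspose_apply]

theorem σ₃_mul_σ₁ : σ₃ * σ₁ = -(σ₁ * σ₃) := by
  ext i j; fin_cases i <;> fin_cases j <;> simp [σ₁, σ₃, Matrix.mul_apply]

theorem σ₃_mul_σ₂ : σ₃ * σ₂ = -(σ₂ * σ₃) := by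
  ext i j; fin_cases i <;> fin_cases j <;> simp [σ₂, σ₃, Matrix.mul_apply]

theorem act_σ₃_act_σ₃ (v : Spinor) : act (diagBlock σ₃) (act (diagBlock σ₃) v) = v := by
  rw [act_block_apply, act_block_apply]
  ext i
  fin_cases i <;> simp [σ₃]

/-! ## The angular operator -/

/-- The space `C₀^∞((0, π); ℂ⁴)`. -/
def angTest : Submodule ℂ (ℝ → Spinor) where
  carrier := {f | IsTest (Ioo 0 Real.pi) f}
  zero_mem' := .zero
  add_mem' := IsTest.add
  smul_mem' c _ hf := hf.comp_left ((c • ContinuousLinearMap.id ℂ Spinor).restrictScalars ℝ)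

/-- The Hilbert space `L²((0, π); ℂ⁴)`. -/
abbrev AngL2 : Type := Lp Spinor 2 (volume.restrict (Ioo 0 Real.pi))

/-- The inclusion of test functions into `L²((0, π); ℂ⁴)`. -/
def angTest.toL2 : angTest →ₗ[ℂ] AngL2 where
  toFun f := f.2.memLp.toLp _
  map_add' f g := MemLp.toLp_add f.2.memLp g.2.memLp
  map_smul' c f := MemLp.toLp_const_smul c f.2.memLp

theorem isTest_act {U : Set ℝ} {f : ℝ → Spinor} (A : Matrix (Fin 4) (Fin 4) ℂ) (hf : IsTest U f) :
    IsTest U (fun θ => act A (f θ)) := hf.comp_left ((act A).restrictScalars ℝ)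

/-- The operator `σ₁ i ∂_θ + σ₂ (1 / sin θ) i ∂_φ`, repeated with opposite signs, on functions with
angular dependence `e^{ikφ}`. -/
def angDirac (k : ℝ) (f : ℝ → Spinor) (θ : ℝ) : Spinor :=
  act (diagBlock σ₁) (Complex.I • deriv f θ) + (-(k / Real.sin θ)) • act (diagBlock σ₂) (f θ)

theorem contDiffOn_div_sin (k : ℝ) :
    ContDiffOn ℝ ∞ (fun θ => -(k / Real.sin θ)) (Ioo 0 Real.pi) :=
  (contDiffOn_const.div Real.contDiff_sin.contDiffOn fun _ hθ =>
    (Real.sin_pos_of_mem_Ioo hθ).ne').neg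

theorem isTest_angDirac (k : ℝ) {f : ℝ → Spinor} (hf : IsTest (Ioo 0 Real.pi) f) :
    IsTest (Ioo 0 Real.pi) (angDirac k f) :=
  (hf.deriv.comp_left (((act (diagBlock σ₁)).comp
    (Complex.I • ContinuousLinearMap.id ℂ Spinor)).restrictScalars ℝ)).add
    ((isTest_act (diagBlock σ₂) hf).smul isOpen_Ioo (contDiffOn_div_sin k))

/-- The angular operator as an operator on test functions. -/
def angDiracTest (k : ℝ) : angTest →ₗ[ℂ] angTest where
  toFun f := ⟨angDirac k f, isTest_angDirac k f.2⟩
  map_add' f g := Subtype.ext (funext fun θ => by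
    change angDirac k ((f : ℝ → Spinor) + g) θ = angDirac k f θ + angDirac k g θ
    simp only [angDirac, deriv_add (f.2.differentiable θ) (g.2.differentiable θ), Pi.add_apply,
      map_add, smul_add]
    abel)
  map_smul' c f := Subtype.ext (funext fun θ => by
    change angDirac k (c • (f : ℝ → Spinor)) θ = c • angDirac k f θ
    simp only [angDirac, deriv_const_smul c (f.2.differentiable θ), Pi.smul_apply,
      map_smul, smul_add]
    rw [smul_comm Complex.I c, smul_comm (-(k / Real.sin θ)) c])

/-- Multiplication by `diag(σ₃, -σ₃)` on test functions. -/
def actTest (A : Matrix (Fin 4) (Fin 4) ℂ) (f : angTest) : angTest :=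
  ⟨fun θ => act A (f.1 θ), isTest_act A f.2⟩

/-- The matrix `σ₃` anticommutes with `σ₁` and `σ₂`, and it is constant in `θ`. The inverse of the
angular operator inherits this anticommutation, on which the treatment of a mode rests. -/
theorem angDirac_act_σ₃ (k : ℝ) (f : angTest) (θ : ℝ) :
    angDirac k (fun θ => act (diagBlock σ₃) (f.1 θ)) θ
      = -act (diagBlock σ₃) (angDirac k f.1 θ) := by
  have h1 : deriv (fun θ => act (diagBlock σ₃) (f.1 θ)) θ
      = act (diagBlock σ₃) (deriv f.1 θ) :=
    (((act (diagBlock σ₃)).restrictScalars ℝ).hasFDerivAt.comp_hasDerivAt θ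
      (f.2.hasDerivAt θ)).deriv
  simp only [angDirac, h1, map_add, map_smul]
  rw [ContinuousLinearMap.map_smul_of_tower (act (diagBlock σ₃)),
    act_diagBlock_anticomm σ₃_mul_σ₁, act_diagBlock_anticomm σ₃_mul_σ₂]
  module

/-- Integrals over `(0, π)` of derivatives of test functions vanish. -/
theorem _root_.IsTest.integral_deriv_eq_zero {F : Type*} [NormedAddCommGroup F] [NormedSpace ℝ F]
    [CompleteSpace F] {U : Set ℝ} {f : ℝ → F} (hf : IsTest U f) : ∫ x, _root_.deriv f x = 0 :=
  integral_eq_zero_of_hasDerivAt_of_integrable (fun x => hf.hasDerivAt x) hf.deriv.integrable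
    hf.integrable

theorem _root_.IsTest.innerProd {F : Type*} [NormedAddCommGroup F] (𝕜 : Type*) [RCLike 𝕜]
    [InnerProductSpace 𝕜 F] [NormedSpace ℝ F] [IsScalarTower ℝ 𝕜 F] {U : Set ℝ} {f g : ℝ → F}
    (hf : IsTest U f) (hg : IsTest U g) : IsTest U (fun x => Inner.inner 𝕜 (f x) (g x)) := by
  have h : Function.support (fun x => Inner.inner 𝕜 (f x) (g x)) ⊆ Function.support f :=
    fun x hx hx' => hx (by simp only [hx', inner_zero_left])
  exact ⟨hf.contDiff.inner 𝕜 hg.contDiff, hf.hasCompactSupport.mono h,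
    (closure_mono h).trans hf.tsupport_subset⟩

/-! ### Lower bound, symmetry and dense range of the angular operator -/

/-- A Poincaré inequality for the operator `∂_θ - κ / sin θ`. -/
theorem integral_norm_sq_le {κ : ℝ} {φ : ℝ → ℂ} (hφ : IsTest (Ioo 0 Real.pi) φ) :
    ∫ θ, ‖φ θ‖ ^ 2 ≤
      4 * Real.pi ^ 2 * ∫ θ, ‖deriv φ θ + (-(κ / Real.sin θ)) • φ θ‖ ^ 2 := by
  have hpi := Real.pi_pos
  -- The weight `θ - c` vanishes at the endpoint selected by the sign of `κ`, so that the singular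
  -- term `(θ - c) κ / sin θ ‖φ‖²` is nonnegative and can be dropped.
  obtain ⟨c, hc⟩ : ∃ c : ℝ, ∀ θ ∈ Ioo 0 Real.pi,
      0 ≤ κ * (θ - c) ∧ |θ - c| ≤ Real.pi := by
    rcases le_total 0 κ with h | h
    · exact ⟨0, fun θ hθ => ⟨mul_nonneg h (by linarith [hθ.1]),
        abs_le.2 ⟨by linarith [hθ.1], by linarith [hθ.2]⟩⟩⟩
    · exact ⟨Real.pi, fun θ hθ => ⟨mul_nonneg_of_nonpos_of_nonpos h (by linarith [hθ.2]),
        abs_le.2 ⟨by linarith [hθ.1], by linarith [hθ.2]⟩⟩⟩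
  have hsq : IsTest (Ioo 0 Real.pi) (fun θ => ‖φ θ‖ ^ 2) := by
    simpa only [real_inner_self_eq_norm_sq] using hφ.innerProd ℝ hφ
  have hF : IsTest (Ioo 0 Real.pi) (fun θ => (θ - c) • ‖φ θ‖ ^ 2) :=
    hsq.smul isOpen_Ioo (by fun_prop)
  let ψ : ℝ → ℂ := fun θ => deriv φ θ + (-(κ / Real.sin θ)) • φ θ
  have hψ : IsTest (Ioo 0 Real.pi) ψ := hφ.deriv.add (hφ.smul isOpen_Ioo (contDiffOn_div_sin κ))
  have hψsq : IsTest (Ioo 0 Real.pi) (fun θ => ‖ψ θ‖ ^ 2) := by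
    simpa only [real_inner_self_eq_norm_sq] using hψ.innerProd ℝ hψ
  -- The derivative of `(θ - c) ‖φ‖²` is `‖φ‖² + 2 (θ - c) Re ⟨φ, φ'⟩` with `φ' = ψ + κ φ / sin θ`.
  -- The cross term is absorbed by `2π ‖φ‖ ‖ψ‖ ≤ ‖φ‖² / 2 + 2π² ‖ψ‖²`.
  have hpt : ∀ θ, 1 / 2 * ‖φ θ‖ ^ 2 ≤ deriv (fun θ => (θ - c) • ‖φ θ‖ ^ 2) θ
      + 2 * Real.pi ^ 2 * ‖ψ θ‖ ^ 2 := by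
    intro θ
    by_cases hθ : θ ∈ Ioo 0 Real.pi
    · have hd : deriv (fun θ => (θ - c) • ‖φ θ‖ ^ 2) θ
          = (θ - c) * (2 * inner ℝ (φ θ) (deriv φ θ)) + 1 * ‖φ θ‖ ^ 2 :=
        (((hasDerivAt_id θ).sub_const c).smul (hφ.hasDerivAt θ).norm_sq).deriv
      obtain ⟨h1, h2⟩ := hc θ hθ
      have hs := Real.sin_pos_of_mem_Ioo hθ
      have e1 : deriv φ θ = ψ θ + (κ / Real.sin θ) • φ θ := by simp only [ψ]; module
      rw [hd, e1, inner_add_right, real_inner_smul_right, real_inner_self_eq_norm_sq]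
      have h3 : |(θ - c) * inner ℝ (φ θ) (ψ θ)| ≤ Real.pi * (‖φ θ‖ * ‖ψ θ‖) := by
        rw [abs_mul]
        exact mul_le_mul h2 (abs_real_inner_le_norm _ _) (abs_nonneg _) hpi.le
      have h4 : 0 ≤ (θ - c) * (κ / Real.sin θ * ‖φ θ‖ ^ 2) := by
        have : 0 ≤ (κ * (θ - c)) / Real.sin θ * ‖φ θ‖ ^ 2 := by positivity
        calc _ ≤ _ := this
          _ = _ := by ring
      have h5 := (abs_le.1 h3).1
      nlinarith [sq_nonneg (‖φ θ‖ - 2 * Real.pi * ‖ψ θ‖)]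
    · rw [hφ.eq_zero hθ, hψ.eq_zero hθ, hF.deriv.eq_zero hθ]
      simp
  have hint := integral_mono (hsq.integrable.const_mul (1 / 2))
    (hF.deriv.integrable.add (hψsq.integrable.const_mul (2 * Real.pi ^ 2))) hpt
  simp only [Pi.add_apply] at hint
  rw [integral_add hF.deriv.integrable (hψsq.integrable.const_mul _), hF.integral_deriv_eq_zero,
    integral_const_mul, integral_const_mul] at hint
  change _ ≤ 4 * Real.pi ^ 2 * ∫ θ, ‖ψ θ‖ ^ 2
  linarith

/-- The matrices `σ₁` and `σ₂` only exchange components within each pair, so the operator splits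
into four scalar operators `∂_θ ∓ k / sin θ` up to unimodular factors. Bounds and kernels can thus
be studied for scalar functions. -/
theorem angDirac_apply (k : ℝ) {f : ℝ → Spinor} (hf : IsTest (Ioo 0 Real.pi) f) (θ : ℝ) :
    angDirac k f θ = !₂[
      Complex.I * (deriv (fun θ => f θ 1) θ + (-(-k / Real.sin θ)) • f θ 1),
      Complex.I * (deriv (fun θ => f θ 0) θ + (-(k / Real.sin θ)) • f θ 0),
      -(Complex.I * (deriv (fun θ => f θ 3) θ + (-(-k / Real.sin θ)) • f θ 3)),
      -(Complex.I * (deriv (fun θ => f θ 2) θ + (-(k / Real.sin θ)) • f θ 2))] := by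
  have h : ∀ i, deriv (fun θ => f θ i) θ = deriv f θ i := fun i =>
    (((EuclideanSpace.proj i : EuclideanSpace ℂ (Fin 4) →L[ℂ] ℂ).restrictScalars ℝ).hasFDerivAt.comp_hasDerivAt θ
      (hf.hasDerivAt θ)).deriv
  rw [angDirac, act_block_apply, act_block_apply]
  simp only [h]
  ext i
  fin_cases i <;> simp [σ₁, σ₂] <;> ring

theorem norm_toLp_sq {F : Type*} [NormedAddCommGroup F] [InnerProductSpace ℂ F]
    {α : Type*} [MeasurableSpace α] {μ : Measure α} {f : α → F} (hf : MemLp f 2 μ) :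
    ‖hf.toLp f‖ ^ 2 = ∫ x, ‖f x‖ ^ 2 ∂μ := by
  rw [← inner_self_eq_norm_sq (𝕜 := ℂ), L2.inner_def, ← integral_re]
  · refine integral_congr_ae ?_
    filter_upwards [hf.coeFn_toLp] with x hx
    rw [hx, inner_self_eq_norm_sq]
  · exact L2.integrable_inner _ _

theorem inner_toLp {F : Type*} [NormedAddCommGroup F] [InnerProductSpace ℂ F]
    {α : Type*} [MeasurableSpace α] {μ : Measure α} {f g : α → F} (hf : MemLp f 2 μ)
    (hg : MemLp g 2 μ) : inner ℂ (hf.toLp f) (hg.toLp g) = ∫ x, inner ℂ (f x) (g x) ∂μ := by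
  rw [L2.inner_def]
  refine integral_congr_ae ?_
  filter_upwards [hf.coeFn_toLp, hg.coeFn_toLp] with x hx hx'
  rw [hx, hx']

theorem _root_.IsTest.setIntegral_eq {F F' : Type*} [NormedAddCommGroup F] [NormedSpace ℝ F]
    [NormedAddCommGroup F'] [NormedSpace ℝ F'] {U : Set ℝ}
    {f : ℝ → F} (hf : IsTest U f) {g : ℝ → F'} (h : ∀ x, f x = 0 → g x = 0) :
    ∫ x in U, g x = ∫ x, g x :=
  setIntegral_eq_integral_of_forall_compl_eq_zero fun x hx => h x (hf.eq_zero hx)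

theorem _root_.IsTest.apply {U : Set ℝ} {f : ℝ → Spinor} (hf : IsTest U f) (i : Fin 4) :
    IsTest U (fun θ => f θ i) :=
  hf.comp_left ((EuclideanSpace.proj i : EuclideanSpace ℂ (Fin 4) →L[ℂ] ℂ).restrictScalars ℝ)

theorem norm_angTest_le (k : ℝ) (f : angTest) :
    ‖angTest.toL2 f‖ ≤ 2 * Real.pi * ‖angTest.toL2 (angDiracTest k f)‖ := by
  have hpi := Real.pi_pos
  refine abs_le_of_sq_le_sq' ?_ (by positivity) |>.2
  have hsq : ∀ {F : Type} [NormedAddCommGroup F] [InnerProductSpace ℝ F] {g : ℝ → F},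
      IsTest (Ioo 0 Real.pi) g → Integrable (fun θ => ‖g θ‖ ^ 2) := by
    intro F _ _ g hg
    simpa only [real_inner_self_eq_norm_sq] using (hg.innerProd ℝ hg).integrable
  have h1 : ‖angTest.toL2 f‖ ^ 2 = ∑ i, ∫ θ, ‖f.1 θ i‖ ^ 2 := by
    refine (norm_toLp_sq f.2.memLp).trans ?_
    rw [f.2.setIntegral_eq (by intro x hx; rw [hx]; simp),
      ← integral_finsetSum _ fun i _ => hsq (f.2.apply i)]
    simp only [EuclideanSpace.norm_sq_eq]
  have h2 : ‖angTest.toL2 (angDiracTest k f)‖ ^ 2 = ∑ i, ∫ θ, ‖angDirac k f.1 θ i‖ ^ 2 := by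
    refine (norm_toLp_sq (isTest_angDirac k f.2).memLp).trans ?_
    rw [(isTest_angDirac k f.2).setIntegral_eq (by intro x hx; rw [hx]; simp),
      ← integral_finsetSum _ fun i _ => hsq ((isTest_angDirac k f.2).apply i)]
    simp only [EuclideanSpace.norm_sq_eq]
  have h3 := fun i κ => integral_norm_sq_le (κ := κ) (f.2.apply i)
  rw [mul_pow, h1, h2, Fin.sum_univ_four, Fin.sum_univ_four]
  simp only [angDirac_apply k f.2]
  simp only [Matrix.cons_val, norm_neg, norm_mul, Complex.norm_I, one_mul]
  have e : (2 * Real.pi) ^ 2 = 4 * Real.pi ^ 2 := by ring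
  rw [e]
  linarith [h3 0 k, h3 1 (-k), h3 2 k, h3 3 (-k)]

/-- The integrand of the difference is the derivative of `⟨f, diag(σ₁, -σ₁) i g⟩`, whose integral
vanishes; the term with `1 / sin θ` is a real multiple of a Hermitian matrix and cancels pointwise.
-/
theorem inner_angDiracTest (k : ℝ) (f g : angTest) :
    inner ℂ (angTest.toL2 f) (angTest.toL2 (angDiracTest k g))
      = inner ℂ (angTest.toL2 (angDiracTest k f)) (angTest.toL2 g) := by
  have hf := isTest_angDirac k f.2
  have hg := isTest_angDirac k g.2
  refine (inner_toLp f.2.memLp hg.memLp).trans (Eq.trans ?_ (inner_toLp hf.memLp g.2.memLp).symm)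
  rw [f.2.setIntegral_eq (by intro x hx; rw [hx, inner_zero_left]),
    g.2.setIntegral_eq (by intro x hx; rw [hx, inner_zero_right]), ← sub_eq_zero,
    ← integral_sub (f.2.innerProd ℂ hg).integrable (hf.innerProd ℂ g.2).integrable]
  have hI : IsTest (Ioo 0 Real.pi) (fun θ => act (diagBlock σ₁) (Complex.I • g.1 θ)) :=
    g.2.comp_left (((act (diagBlock σ₁)).comp
      (Complex.I • ContinuousLinearMap.id ℂ Spinor)).restrictScalars ℝ)
  have hd : ∀ θ, HasDerivAt (fun θ => act (diagBlock σ₁) (Complex.I • g.1 θ))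
      (act (diagBlock σ₁) (Complex.I • deriv g.1 θ)) θ := fun θ =>
    (((act (diagBlock σ₁)).comp (Complex.I • ContinuousLinearMap.id ℂ Spinor)).restrictScalars
      ℝ).hasFDerivAt.comp_hasDerivAt θ (g.2.hasDerivAt θ)
  rw [← (f.2.innerProd ℂ hI).integral_deriv_eq_zero]
  refine integral_congr_ae (Filter.Eventually.of_forall fun θ => ?_)
  change _ = deriv (fun θ => inner ℂ (f.1 θ) (act (diagBlock σ₁) (Complex.I • g.1 θ))) θ
  rw [((f.2.hasDerivAt θ).inner ℂ (hd θ)).deriv]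
  change inner ℂ (f.1 θ) (angDirac k g.1 θ) - inner ℂ (angDirac k f.1 θ) (g.1 θ) = _
  rw [angDirac, angDirac, inner_add_left, inner_add_right,
    RCLike.real_smul_eq_coe_smul (K := ℂ) (-(k / Real.sin θ)),
    RCLike.real_smul_eq_coe_smul (K := ℂ) (-(k / Real.sin θ)), inner_smul_left, inner_smul_right,
    RCLike.conj_ofReal, inner_act_diagBlock isHermitian_σ₂, inner_act_diagBlock isHermitian_σ₁,
    inner_smul_left, map_smul, map_smul, inner_smul_right, inner_smul_right, Complex.conj_I]
  ring

theorem angTest_total {u : AngL2} (hu : ∀ f : angTest, inner ℂ u (angTest.toL2 f) = 0) : u = 0 := by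
  refine Lp.eq_zero_iff_ae_eq_zero.2 ?_
  have hloc : LocallyIntegrableOn u (Ioo 0 Real.pi) :=
    locallyIntegrableOn_of_locallyIntegrable_restrict
      ((Lp.memLp u).locallyIntegrable one_le_two)
  refine (ae_restrict_iff' measurableSet_Ioo).2 ?_
  refine isOpen_Ioo.ae_eq_zero_of_integral_contDiff_smul_eq_zero hloc fun g h1 h2 h3 => ?_
  have hg : IsTest (Ioo 0 Real.pi) g := ⟨h1, h2, h3⟩
  refine ext_inner_left ℂ fun v => ?_
  rw [inner_zero_right, ← integral_inner (hg.integrable_smul hloc)]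
  have h := hu ⟨fun θ => g θ • v, hg.smul_const v⟩
  rw [L2.inner_def] at h
  have h' := congrArg (starRingEnd ℂ) h
  rw [← integral_conj, map_zero] at h'
  rw [← h', ← hg.setIntegral_eq (U := Ioo 0 Real.pi) (by intro x hx; simp [hx])]
  refine integral_congr_ae ?_
  filter_upwards [(hg.smul_const v).memLp.coeFn_toLp] with x hx
  rw [inner_conj_symm]
  change _ = inner ℂ (((hg.smul_const v).memLp.toLp _ : AngL2) x) (u x)
  rw [hx, RCLike.real_smul_eq_coe_smul (K := ℂ), RCLike.real_smul_eq_coe_smul (K := ℂ),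
    inner_smul_left, inner_smul_right, RCLike.conj_ofReal]

/-- The range of the angular operator is dense. -/
theorem denseRange_angDirac {k : ℝ} (hk : 1 / 2 ≤ |k|) :
    DenseRange (angTest.toL2 ∘ₗ angDiracTest k) := by
  change Dense (LinearMap.range (angTest.toL2 ∘ₗ angDiracTest k) : Set AngL2)
  rw [Submodule.dense_iff_topologicalClosure_eq_top, Submodule.topologicalClosure_eq_top_iff,
    Submodule.eq_bot_iff]
  intro u hu
  have hu' : ∀ f : angTest, inner ℂ u (angTest.toL2 (angDiracTest k f)) = 0 := fun f =>
    (Submodule.mem_orthogonal' _ _).1 hu _ (LinearMap.mem_range_self _ f)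
  -- A test function with the single component `i` is mapped to the single component `j`.
  -- Orthogonality of `u` to the range is then the weak scalar equation for the conjugate of the
  -- component `j` of `u`, the scalar product being antilinear in `u`.
  have key : ∀ (i j : Fin 4) (κ : ℝ) (c : ℂ), 1 / 2 ≤ |κ| → c ≠ 0 →
      (∀ φ : ℝ → ℝ, IsTest (Ioo 0 Real.pi) φ → ∀ θ, angDirac k
        (fun θ => φ θ • EuclideanSpace.single i 1) θ
          = ((deriv φ θ - κ / Real.sin θ * φ θ : ℝ) : ℂ) • EuclideanSpace.single j c) →
      (fun θ => u θ j) =ᵐ[volume.restrict (Ioo 0 Real.pi)] 0 := by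
    intro i j κ c hκ hc h
    have h1 : (fun θ => (starRingEnd ℂ) (u θ j)) =ᵐ[volume.restrict (Ioo 0 Real.pi)] 0 := by
      refine ae_eq_zero_of_weak_solution_arc hκ ?_ fun φ hφ => ?_
      · refine MemLp.of_le (Lp.memLp u) ?_ (Filter.Eventually.of_forall fun θ => ?_)
        · exact (Complex.continuous_conj.comp (EuclideanSpace.proj (𝕜 := ℂ) j :
            EuclideanSpace ℂ (Fin 4) →L[ℂ] ℂ).continuous).comp_aestronglyMeasurable
              (Lp.aestronglyMeasurable u)
        · rw [RCLike.norm_conj]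
          exact PiLp.norm_apply_le _ _
      · have hf : IsTest (Ioo 0 Real.pi) (fun θ => φ θ • (EuclideanSpace.single i 1 : Spinor)) :=
          hφ.smul_const _
        have h2 := hu' ⟨_, hf⟩
        rw [L2.inner_def] at h2
        have hq : IsTest (Ioo 0 Real.pi) (fun θ => deriv φ θ - κ / Real.sin θ * φ θ) := by
          have := hφ.deriv.add (hφ.smul isOpen_Ioo (contDiffOn_div_sin κ))
          convert this using 2 with θ
          simp [sub_eq_add_neg]
        rw [← hq.setIntegral_eq (U := Ioo 0 Real.pi) (by intro x hx; simp [hx])]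
        refine (mul_eq_zero.1
          ((integral_const_mul c _).symm.trans (Eq.trans ?_ h2))).resolve_left hc
        refine integral_congr_ae ?_
        filter_upwards [(isTest_angDirac k hf).memLp.coeFn_toLp] with θ hθ
        change _ = inner ℂ (u θ) (((isTest_angDirac k hf).memLp.toLp _ : AngL2) θ)
        rw [hθ, h φ hφ, inner_smul_right, EuclideanSpace.inner_single_right, Complex.real_smul]
        ring
    filter_upwards [h1] with θ hθ
    simpa using hθ
  have hk' : 1 / 2 ≤ |-k| := by rwa [abs_neg]
  have hda : ∀ (φ : ℝ → ℝ), IsTest (Ioo 0 Real.pi) φ → ∀ θ,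
      deriv (fun θ => (φ θ : ℂ)) θ = ((deriv φ θ : ℝ) : ℂ) := fun φ hφ θ =>
    (hφ.hasDerivAt θ).ofReal_comp.deriv
  have e1 := key 0 1 k Complex.I hk Complex.I_ne_zero fun φ hφ θ => by
    rw [angDirac_apply k (hφ.smul_const _)]
    ext i
    fin_cases i <;> simp [hda φ hφ] <;> ring
  have e0 := key 1 0 (-k) Complex.I hk' Complex.I_ne_zero fun φ hφ θ => by
    rw [angDirac_apply k (hφ.smul_const _)]
    ext i
    fin_cases i <;> simp [hda φ hφ] <;> ring
  have e3 := key 2 3 k (-Complex.I) hk (neg_ne_zero.2 Complex.I_ne_zero) fun φ hφ θ => by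
    rw [angDirac_apply k (hφ.smul_const _)]
    ext i
    fin_cases i <;> simp [hda φ hφ] <;> ring
  have e2 := key 3 2 (-k) (-Complex.I) hk' (neg_ne_zero.2 Complex.I_ne_zero) fun φ hφ θ => by
    rw [angDirac_apply k (hφ.smul_const _)]
    ext i
    fin_cases i <;> simp [hda φ hφ] <;> ring
  refine Lp.eq_zero_iff_ae_eq_zero.2 ?_
  filter_upwards [e0, e1, e2, e3] with θ h0 h1 h2 h3
  ext i
  fin_cases i <;> assumption

theorem toL2_actTest (A : Matrix (Fin 4) (Fin 4) ℂ) (f : angTest) :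
    angTest.toL2 (actTest A f) = (act A).compLpL 2 _ (angTest.toL2 f) := by
  have h1 := (actTest A f).2.memLp (s := Ioo 0 Real.pi).coeFn_toLp
  have h2 := f.2.memLp (s := Ioo 0 Real.pi).coeFn_toLp
  refine Lp.ext ((h1.trans ?_).trans (ContinuousLinearMap.coeFn_compLpL (act A) _).symm)
  filter_upwards [h2] with θ h2
  exact (congrArg (act A) h2).symm

/-- The inverse of the angular operator. -/
theorem exists_angular_inverse {k : ℝ} (hk : 1 / 2 ≤ |k|) :
    ∃ R : AngL2 →L[ℂ] AngL2, (∀ f, R (angTest.toL2 (angDiracTest k f)) = angTest.toL2 f) ∧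
      (∀ u v, inner ℂ (R u) v = inner ℂ u (R v)) ∧ (∀ u, R u = 0 → u = 0) ∧
      ∀ u, R ((act (diagBlock σ₃)).compLpL 2 _ u) = -(act (diagBlock σ₃)).compLpL 2 _ (R u) := by
  refine exists_symmetric_inverse angTest.toL2 (angTest.toL2 ∘ₗ angDiracTest k)
    (norm_angTest_le k) (fun u hu => angTest_total hu) (denseRange_angDirac hk)
    (inner_angDiracTest k) _ (actTest (diagBlock σ₃))
    (toL2_actTest _) fun f => ?_
  rw [LinearMap.comp_apply, LinearMap.comp_apply, ← toL2_actTest, ← map_neg]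
  exact congrArg _ (Subtype.ext (funext fun θ => angDirac_act_σ₃ k f θ))

end KerrNewman

/-! ## Operators in `L²(ℝ; X)` -/

section VectorValued

variable {X : Type*} [NormedAddCommGroup X] [InnerProductSpace ℂ X]

theorem memLp_boundedContinuous_smul {α : Type*} [TopologicalSpace α] [MeasurableSpace α]
    [OpensMeasurableSpace α] {μ : Measure α} (b : α →ᵇ ℝ) {f : α → X} (hf : MemLp f 2 μ) :
    MemLp (fun x => (b x : ℂ) • f x) 2 μ :=
  hf.of_le_mul (c := ‖b‖)
    ((Complex.continuous_ofReal.comp b.continuous).aestronglyMeasurable.smul hf.1)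
    (Filter.Eventually.of_forall fun x => by
      rw [norm_smul, Complex.norm_real]
      exact mul_le_mul_of_nonneg_right (b.norm_coe_le_norm x) (norm_nonneg _))

/-- Multiplication by a bounded continuous function. -/
def mulOp {α : Type*} [TopologicalSpace α] [MeasurableSpace α] [OpensMeasurableSpace α]
    (μ : Measure α) (X : Type*) [NormedAddCommGroup X] [InnerProductSpace ℂ X]
    (b : α →ᵇ ℝ) : Lp X 2 μ →L[ℂ] Lp X 2 μ :=
  have hm : ∀ f : Lp X 2 μ, MemLp (fun x => (b x : ℂ) • f x) 2 μ := fun f =>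
    memLp_boundedContinuous_smul b (Lp.memLp f)
  LinearMap.mkContinuous
    { toFun := fun f => (hm f).toLp _
      map_add' := fun f g => by
        rw [← MemLp.toLp_add (hm f) (hm g)]
        refine MemLp.toLp_congr _ _ ?_
        filter_upwards [Lp.coeFn_add f g] with x hx
        rw [hx, Pi.add_apply, Pi.add_apply, smul_add]
      map_smul' := fun c f => by
        rw [RingHom.id_apply, ← MemLp.toLp_const_smul c (hm f)]
        refine MemLp.toLp_congr _ _ ?_
        filter_upwards [Lp.coeFn_smul c f] with x hx
        rw [hx, Pi.smul_apply, Pi.smul_apply, smul_comm] } ‖b‖ fun f => by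
      refine Lp.norm_le_mul_norm_of_ae_le_mul ?_
      filter_upwards [(hm f).coeFn_toLp] with x hx
      change ‖((hm f).toLp _ : Lp X 2 μ) x‖ ≤ _
      rw [hx, norm_smul, Complex.norm_real]
      exact mul_le_mul_of_nonneg_right (b.norm_coe_le_norm x) (norm_nonneg _)

section mulOp

variable {α : Type*} [TopologicalSpace α] [MeasurableSpace α] [OpensMeasurableSpace α]
    {μ : Measure α}

theorem coeFn_mulOp (b : α →ᵇ ℝ) (f : Lp X 2 μ) :
    mulOp μ X b f =ᵐ[μ] fun x => (b x : ℂ) • f x :=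
  (memLp_boundedContinuous_smul b (Lp.memLp f)).coeFn_toLp

theorem inner_mulOp (b : α →ᵇ ℝ) (f g : Lp X 2 μ) :
    inner ℂ (mulOp μ X b f) g = inner ℂ f (mulOp μ X b g) := by
  rw [L2.inner_def, L2.inner_def]
  refine integral_congr_ae ?_
  filter_upwards [coeFn_mulOp b f, coeFn_mulOp b g] with x h1 h2
  rw [h1, h2, inner_smul_left, inner_smul_right, Complex.conj_ofReal]

theorem mulOp_compLpL {Y : Type*} [NormedAddCommGroup Y] [InnerProductSpace ℂ Y] (b : α →ᵇ ℝ)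
    (T : X →L[ℂ] Y) (f : Lp X 2 μ) :
    mulOp μ Y b (T.compLpL 2 μ f) = T.compLpL 2 μ (mulOp μ X b f) := by
  refine Lp.ext (((coeFn_mulOp b _).trans ?_).trans
    (ContinuousLinearMap.coeFn_compLpL T _).symm)
  filter_upwards [coeFn_mulOp b f, ContinuousLinearMap.coeFn_compLpL (p := 2) T f] with x h1 h2
  rw [h1, h2, map_smul]

theorem mulOp_toLp (b : α →ᵇ ℝ) {f : α → X} (hf : MemLp f 2 μ)
    (hf' : MemLp (fun x => (b x : ℂ) • f x) 2 μ) : mulOp μ X b (hf.toLp f) = hf'.toLp _ := by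
  refine Lp.ext (((coeFn_mulOp b _).trans ?_).trans hf'.coeFn_toLp.symm)
  filter_upwards [hf.coeFn_toLp] with x h1
  rw [h1]

end mulOp

theorem inner_compLpL {α : Type*} [MeasurableSpace α] {μ : Measure α} {Y : Type*}
    [NormedAddCommGroup Y] [InnerProductSpace ℂ Y] {T : X →L[ℂ] Y}
    {T' : Y →L[ℂ] X} (hT : ∀ u v, inner ℂ (T u) v = inner ℂ u (T' v)) (f : Lp X 2 μ)
    (g : Lp Y 2 μ) : inner ℂ (T.compLpL 2 μ f) g = inner ℂ f (T'.compLpL 2 μ g) := by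
  rw [L2.inner_def, L2.inner_def]
  refine integral_congr_ae ?_
  filter_upwards [ContinuousLinearMap.coeFn_compLpL (p := 2) T f,
    ContinuousLinearMap.coeFn_compLpL (p := 2) T' g] with x h1 h2
  rw [h1, h2, hT]

/-- The product of a vector and a square integrable function. -/
def tens : X →L[ℂ] Lp ℂ 2 (volume : Measure ℝ) →L[ℂ] Lp X 2 (volume : Measure ℝ) :=
  (ContinuousLinearMap.lsmul ℂ ℂ : ℂ →L[ℂ] X →L[ℂ] X).flip.compLpL₂ 2 volume

theorem coeFn_tens (f : X) (g : Lp ℂ 2 (volume : Measure ℝ)) :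
    tens f g =ᵐ[volume] fun x => g x • f := by
  rw [tens, ContinuousLinearMap.compLpL₂_apply_apply]
  exact ContinuousLinearMap.coeFn_compLp _ _

theorem inner_tens (u : Lp X 2 (volume : Measure ℝ)) (f : X) (g : Lp ℂ 2 (volume : Measure ℝ)) :
    inner ℂ u (tens f g) = ∫ x, g x * inner ℂ (u x) f := by
  rw [L2.inner_def]
  refine integral_congr_ae ?_
  filter_upwards [coeFn_tens f g] with x hx
  rw [hx, inner_smul_right]

theorem inner_tens_tens (f f' : X) (g g' : Lp ℂ 2 (volume : Measure ℝ)) :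
    inner ℂ (tens f g) (tens f' g') = inner ℂ f f' * inner ℂ g g' := by
  rw [L2.inner_def, L2.inner_def, ← integral_const_mul]
  refine integral_congr_ae ?_
  filter_upwards [coeFn_tens f g, coeFn_tens f' g'] with x h1 h2
  rw [h1, h2, inner_smul_left, inner_smul_right, RCLike.inner_apply']
  ring

theorem compLpL_tens {Y : Type*} [NormedAddCommGroup Y] [InnerProductSpace ℂ Y] (T : X →L[ℂ] Y)
    (f : X) (g : Lp ℂ 2 (volume : Measure ℝ)) :
    T.compLpL 2 volume (tens f g) = tens (T f) g := by
  refine Lp.ext (((ContinuousLinearMap.coeFn_compLpL T _).trans ?_).trans (coeFn_tens _ _).symm)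
  filter_upwards [coeFn_tens f g] with x h1
  rw [h1, map_smul]

theorem mulOp_tens (b : ℝ →ᵇ ℝ) (f : X) (g : Lp ℂ 2 (volume : Measure ℝ)) :
    mulOp volume X b (tens f g) = tens f (mulOp volume ℂ b g) := by
  rw [tens, ContinuousLinearMap.compLpL₂_apply_apply, ContinuousLinearMap.compLpL₂_apply_apply]
  exact mulOp_compLpL b _ g

/-- The class in `L²(ℝ)` of a real test function. -/
def lineTest {χ : ℝ → ℝ} (hχ : IsTest univ χ) : Lp ℂ 2 (volume : Measure ℝ) :=
  MemLp.toLp (fun x => (χ x : ℂ)) <| by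
    simpa using (hχ.comp_left Complex.ofRealCLM).memLp (s := univ)

theorem coeFn_lineTest {χ : ℝ → ℝ} (hχ : IsTest univ χ) :
    lineTest hχ =ᵐ[volume] fun x => (χ x : ℂ) := MemLp.coeFn_toLp _

theorem inner_lineTest_deriv {χ ρ : ℝ → ℝ} (hχ : IsTest univ χ) (hρ : IsTest univ ρ) :
    inner ℂ (lineTest hχ) (lineTest hρ.deriv) = -inner ℂ (lineTest hχ.deriv) (lineTest hρ) := by
  have h : ∀ {f g : ℝ → ℝ} (hf : IsTest univ f) (hg : IsTest univ g),
      inner ℂ (lineTest hf) (lineTest hg) = ((∫ x, f x * g x : ℝ) : ℂ) := by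
    intro f g hf hg
    rw [← integral_complex_ofReal]
    refine (KerrNewman.inner_toLp _ _).trans
      (integral_congr_ae (Filter.Eventually.of_forall fun x => ?_))
    simp only [RCLike.inner_apply', Complex.conj_ofReal, Complex.ofReal_mul]
  rw [h, h, ← Complex.ofReal_neg]
  congr 1
  have hi : ∀ {f g : ℝ → ℝ} (hf : IsTest univ f) (hg : IsTest univ g),
    Integrable (fun x => f x * g x) := fun hf hg => (hf.smul isOpen_univ hg.contDiff.contDiffOn
      (q := _)).integrable.congr (Filter.Eventually.of_forall fun x => mul_comm _ _)
  exact integral_mul_deriv_eq_deriv_mul_of_integrable (fun x _ => hχ.hasDerivAt x)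
    (fun x _ => hρ.hasDerivAt x) (hi hχ hρ.deriv) (hi hχ.deriv hρ) (hi hχ hρ)

/-- The operator `-i s ∂_x` on products of test functions and vectors. -/
def lineDirac (s : X →L[ℂ] X) :
    Submodule ℂ (Lp X 2 (volume : Measure ℝ) × Lp X 2 (volume : Measure ℝ)) :=
  Submodule.span ℂ {p | ∃ (χ : ℝ → ℝ) (hχ : IsTest univ χ) (η : X),
    p = (tens η (lineTest hχ), -Complex.I • tens (s η) (lineTest hχ.deriv))}

theorem isSymmRel_lineDirac {s : X →L[ℂ] X} (hs : ∀ u v, inner ℂ (s u) v = inner ℂ u (s v)) :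
    IsSymmRel (lineDirac s) := by
  refine isSymmRel_span ?_
  rintro _ ⟨χ, hχ, η, rfl⟩ _ ⟨ρ, hρ, ξ, rfl⟩
  simp only [inner_smul_left, inner_smul_right, inner_tens_tens, hs, inner_lineTest_deriv hχ hρ,
    map_neg, Complex.conj_I]
  ring

/-- Products of test functions and vectors are total in `L²(ℝ; X)`. -/
theorem eq_zero_of_inner_tens_lineTest [SecondCountableTopology X]
    {u : Lp X 2 (volume : Measure ℝ)} {S : Set X} (hS : Dense S)
    (h : ∀ η ∈ S, ∀ (χ : ℝ → ℝ) (hχ : IsTest univ χ), inner ℂ u (tens η (lineTest hχ)) = 0) :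
    u = 0 := by
  have h' : ∀ (χ : ℝ → ℝ) (hχ : IsTest univ χ) (η : X), inner ℂ u (tens η (lineTest hχ)) = 0 := by
    intro χ hχ η
    exact hS.induction (P := fun η => inner ℂ u (tens η (lineTest hχ)) = 0)
      (fun η hη => h η hη χ hχ) (isClosed_eq (by fun_prop) continuous_const) η
  refine Lp.eq_zero_iff_ae_eq_zero.2 (ae_eq_zero_of_forall_inner (𝕜 := ℂ) fun η => ?_)
  have hc : MemLp (fun x => inner ℂ (u x) η) 2 := (Lp.memLp u).inner_const η
  have h2 := isOpen_univ.ae_eq_zero_of_integral_contDiff_smul_eq_zero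
    ((hc.locallyIntegrable one_le_two).locallyIntegrableOn univ) fun g h1 h2 h3 => by
    have hg : IsTest univ g := ⟨h1, h2, h3⟩
    rw [← h' g hg η, inner_tens]
    refine integral_congr_ae ?_
    filter_upwards [coeFn_lineTest hg] with x hx
    rw [hx, Complex.real_smul]
  filter_upwards [h2] with x hx
  rw [← inner_conj_symm, hx (mem_univ x), map_zero, Pi.zero_apply]

/-- On eigenvectors of the involution `s` the operator is `∓ i ∂_x`. The pairing of a deficiency
vector with an eigenvector is a square integrable weak solution of `G' = -κ G` with `κ = ±1`, hence
zero. -/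
theorem hasTrivialDeficiency_lineDirac [SecondCountableTopology X] {s : X →L[ℂ] X}
    (hs2 : ∀ v, s (s v) = v) : HasTrivialDeficiency (lineDirac s) := by
  intro z hz u hu
  have key : ∀ (η : X) (σ : ℝ), σ = 1 ∨ σ = -1 → s η = (σ : ℂ) • η →
      (fun x => inner ℂ (u x) η) =ᵐ[volume] 0 := by
    intro η σ hσ hη
    obtain ⟨κ, hκ⟩ : ∃ κ : ℝ, z = -Complex.I * σ * κ := by
      rcases hz with rfl | rfl <;> rcases hσ with rfl | rfl
      · exact ⟨-1, by simp⟩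
      · exact ⟨1, by simp⟩
      · exact ⟨1, by simp⟩
      · exact ⟨-1, by simp⟩
    have hσ0 : (-Complex.I * σ : ℂ) ≠ 0 := by
      rcases hσ with rfl | rfl <;> simp
    have hc : MemLp (fun x => inner ℂ (u x) η) 2 := (Lp.memLp u).inner_const η
    refine ae_eq_zero_of_weak_solution_line (s := κ) hc fun χ hχ => ?_
    have h1 := hu _ (Submodule.subset_span ⟨χ, hχ, η, rfl⟩)
    simp only [hη, map_smul, smul_apply, inner_smul_right, inner_tens] at h1
    have hloc := (hc.locallyIntegrable one_le_two).locallyIntegrableOn univ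
    simp only [sub_smul, mul_smul]
    have hi : Integrable (fun x => κ • χ x • inner ℂ (u x) η) :=
      (hχ.integrable_smul hloc).smul κ
    rw [integral_sub (hχ.deriv.integrable_smul hloc) hi, integral_smul]
    refine mul_left_cancel₀ hσ0 ?_
    have e : ∀ {f : ℝ → ℝ} (hf : IsTest univ f), ∫ x, lineTest hf x * inner ℂ (u x) η
        = ∫ x, f x • inner ℂ (u x) η := fun hf => integral_congr_ae (by
      filter_upwards [coeFn_lineTest hf] with x hx
      rw [hx, Complex.real_smul])
    rw [e, e, hκ] at h1
    rw [Complex.real_smul]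
    linear_combination h1
  refine Lp.eq_zero_iff_ae_eq_zero.2 (ae_eq_zero_of_forall_inner (𝕜 := ℂ) fun η => ?_)
  -- Every `η` is half the sum of the eigenvectors `η + s η` and `η - s η`.
  have h1 := key (η + s η) 1 (Or.inl rfl) (by rw [map_add, hs2, Complex.ofReal_one, one_smul,
    add_comm])
  have h2 := key (η - s η) (-1) (Or.inr rfl) (by
    rw [map_sub, hs2, Complex.ofReal_neg, Complex.ofReal_one, neg_smul, one_smul, neg_sub])
  filter_upwards [h1, h2] with x h1 h2
  simp only [inner_add_right, inner_sub_right, Pi.zero_apply] at h1 h2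
  rw [← inner_conj_symm, Pi.zero_apply,
    show inner ℂ (u x) η = 0 by linear_combination (h1 + h2) / 2,
    map_zero]

/-! ### The operator of one mode, without its bounded part -/

/-- The operator `-i s ∂_x - w A`. -/
def modeDirac {V : Type*} [AddCommGroup V] [Module ℂ V] (s : X →L[ℂ] X) (w : ℝ →ᵇ ℝ)
    (ι A : V →ₗ[ℂ] X) :
    Submodule ℂ (Lp X 2 (volume : Measure ℝ) × Lp X 2 (volume : Measure ℝ)) :=
  Submodule.span ℂ {p | ∃ (χ : ℝ → ℝ) (hχ : IsTest univ χ) (f : V),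
    p = (tens (ι f) (lineTest hχ), -Complex.I • tens (s (ι f)) (lineTest hχ.deriv)
      - tens (A f) (mulOp volume ℂ w (lineTest hχ)))}

variable {V : Type*} [AddCommGroup V] [Module ℂ V] {s : X →L[ℂ] X} {w : ℝ →ᵇ ℝ}
  {ι A : V →ₗ[ℂ] X}

theorem isSymmRel_modeDirac (hs : ∀ u v, inner ℂ (s u) v = inner ℂ u (s v))
    (hA : ∀ v w, inner ℂ (ι v) (A w) = inner ℂ (A v) (ι w)) :
    IsSymmRel (modeDirac s w ι A) := by
  refine isSymmRel_span ?_
  rintro _ ⟨χ, hχ, f, rfl⟩ _ ⟨ρ, hρ, g, rfl⟩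
  simp only [inner_sub_left, inner_sub_right, inner_smul_left, inner_smul_right, inner_tens_tens,
    hs, inner_lineTest_deriv hχ hρ, map_neg, Complex.conj_I, hA, inner_mulOp]
  ring

/-- The operator `-i s ∂_x - w A` is essentially selfadjoint if `A` has a bounded inverse which
anticommutes with `s`. -/
theorem hasTrivialDeficiency_modeDirac [CompleteSpace X] [SecondCountableTopology X]
    (hs : ∀ u v, inner ℂ (s u) v = inner ℂ u (s v))
    (hs2 : ∀ v, s (s v) = v) (hA : DenseRange A) {R : X →L[ℂ] X} (hR : ∀ v, R (A v) = ι v)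
    (hRs : ∀ u v, inner ℂ (R u) v = inner ℂ u (R v)) (hR0 : ∀ u, R u = 0 → u = 0)
    (hRa : ∀ u, R (s u) = -s (R u)) : HasTrivialDeficiency (modeDirac s w ι A) := by
  have hD := (isSymmRel_lineDirac hs).hasRealAdjoint (hasTrivialDeficiency_lineDirac hs2)
  intro z hz u hu
  obtain ⟨R', hR's, hR't, hR'm, hR'c⟩ :
      ∃ R' : Lp X 2 (volume : Measure ℝ) →L[ℂ] Lp X 2 (volume : Measure ℝ),
      (∀ u v, inner ℂ (R' u) v = inner ℂ u (R' v)) ∧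
      (∀ f g, R' (tens f g) = tens (R f) g) ∧
      (∀ u, mulOp volume X w (R' u) = R' (mulOp volume X w u)) ∧
      ∀ u, R' u =ᵐ[volume] fun x => R (u x) :=
    ⟨R.compLpL 2 volume, inner_compLpL hRs, compLpL_tens R, mulOp_compLpL w R,
      ContinuousLinearMap.coeFn_compLpL R⟩
  -- By density of the range it is enough to test with `η = A f`, for which `R η = ι f` is an
  -- admissible vector for `u`. Moving `R` from the test vector to `u` costs a sign in the term with
  -- `s`, and it cancels the unbounded operator `A`.
  have hadj : IsAdjPair (lineDirac s) (R' u)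
      (-mulOp volume X w u - (starRingEnd ℂ) z • R' u) := by
    refine isAdjPair_span.2 ?_
    rintro _ ⟨χ, hχ, η, rfl⟩
    refine hA.induction_on (p := fun η => inner ℂ (R' u) (-Complex.I • tens (s η)
      (lineTest hχ.deriv)) = inner ℂ (-mulOp volume X w u - (starRingEnd ℂ) z • R' u)
        (tens η (lineTest hχ))) η (isClosed_eq (by fun_prop) (by fun_prop)) fun f => ?_
    have h1 := hu _ (Submodule.subset_span ⟨χ, hχ, f, rfl⟩)
    simp only [← hR, ← mulOp_tens] at h1
    have e1 : s (R (A f)) = -R (s (A f)) := by rw [hRa, neg_neg]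
    rw [e1, map_neg, neg_apply, ← hR't, ← hR't,
      inner_sub_right, inner_smul_right, inner_neg_right, ← hR's, ← hR's, ← inner_mulOp] at h1
    rw [inner_sub_left, inner_neg_left, inner_smul_left, inner_smul_right, Complex.conj_conj]
    linear_combination -h1
  have h1 := hD _ _ hadj
  -- `R'` acts in the fibres and commutes with multiplication by `w(x)`; a product of commuting
  -- symmetric operators is symmetric.
  have h2 : (inner ℂ (R' u) (mulOp volume X w u)).im = 0 := by
    rw [← Complex.conj_eq_iff_im, inner_conj_symm, inner_mulOp, hR's, hR'm]
  rw [inner_sub_right, inner_neg_right, inner_smul_right, Complex.sub_im, Complex.neg_im, h2,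
    inner_self_eq_norm_sq_to_K] at h1
  have h3 : ‖R' u‖ ^ 2 = 0 := by
    rcases hz with rfl | rfl <;> simpa [← Complex.ofReal_pow, Complex.mul_im] using h1
  have h4 : R' u = 0 := by simpa using h3
  refine Lp.eq_zero_iff_ae_eq_zero.2 ?_
  filter_upwards [Lp.eq_zero_iff_ae_eq_zero.1 h4, hR'c u] with x h5 h6
  exact hR0 _ (h6.symm.trans h5)

end VectorValued

/-! ## Products of functions of three variables -/

section Triple

variable {α β γ : Type*} [MeasurableSpace α] [MeasurableSpace β] [MeasurableSpace γ]
  {μ : Measure α} {ν : Measure β} {ρ : Measure γ}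
  {F : Type*} [NormedAddCommGroup F] [InnerProductSpace ℂ F]

/-- The function `g(x) h(z) f(y)` of `(x, y, z)`. -/
def triFun (g : α → ℂ) (f : β → F) (h : γ → ℂ) (p : α × β × γ) : F :=
  (g p.1 * h p.2.2) • f p.2.1

theorem ae_fst [SFinite ν] [SFinite ρ] {P : α → Prop}
    (h : ∀ᵐ x ∂μ, P x) : ∀ᵐ p ∂μ.prod (ν.prod ρ), P p.1 :=
  Measure.quasiMeasurePreserving_fst.ae h

theorem ae_mid [SFinite ν] [SFinite ρ] {P : β → Prop}
    (h : ∀ᵐ x ∂ν, P x) : ∀ᵐ p ∂μ.prod (ν.prod ρ), P p.2.1 :=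
  Measure.quasiMeasurePreserving_snd.ae (p := fun q : β × γ => P q.1)
    (Measure.quasiMeasurePreserving_fst.ae h)

theorem ae_snd [SFinite ν] [SFinite ρ] {P : γ → Prop}
    (h : ∀ᵐ x ∂ρ, P x) : ∀ᵐ p ∂μ.prod (ν.prod ρ), P p.2.2 :=
  Measure.quasiMeasurePreserving_snd.ae (p := fun q : β × γ => P q.2)
    (Measure.quasiMeasurePreserving_snd.ae h)

theorem memLp_triFun {g : α → ℂ} {f : β → F} {h : γ → ℂ} (hg : MemLp g 2 μ) (hf : MemLp f 2 ν)
    (hh : MemLp h 2 ρ) : MemLp (triFun g f h) 2 (μ.prod (ν.prod ρ)) := by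
  have hm : AEStronglyMeasurable (triFun g f h) (μ.prod (ν.prod ρ)) :=
    (hg.1.comp_fst.mul hh.1.comp_snd.comp_snd).smul hf.1.comp_fst.comp_snd
  rw [memLp_two_iff_integrable_sq_norm hm]
  have h1 := (hg.integrable_norm_pow two_ne_zero).mul_prod
    ((hf.integrable_norm_pow two_ne_zero).mul_prod (hh.integrable_norm_pow two_ne_zero))
  refine h1.congr (Filter.Eventually.of_forall fun p => ?_)
  simp only [triFun, norm_smul, norm_mul]
  ring

variable [SFinite μ] [SFinite ν] [SFinite ρ]

/-- The product `g(x) h(z) f(y)` as a square integrable function. -/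
def tri (g : Lp ℂ 2 μ) (f : Lp F 2 ν) (h : Lp ℂ 2 ρ) : Lp F 2 (μ.prod (ν.prod ρ)) :=
  (memLp_triFun (Lp.memLp g) (Lp.memLp f) (Lp.memLp h)).toLp _

theorem coeFn_tri (g : Lp ℂ 2 μ) (f : Lp F 2 ν) (h : Lp ℂ 2 ρ) :
    tri g f h =ᵐ[μ.prod (ν.prod ρ)] triFun g f h :=
  (memLp_triFun (Lp.memLp g) (Lp.memLp f) (Lp.memLp h)).coeFn_toLp

theorem toLp_triFun {g : α → ℂ} {f : β → F} {h : γ → ℂ} (hg : MemLp g 2 μ) (hf : MemLp f 2 ν)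
    (hh : MemLp h 2 ρ) : (memLp_triFun hg hf hh).toLp _
      = tri (hg.toLp g) (hf.toLp f) (hh.toLp h) := by
  refine MemLp.toLp_congr _ _ ?_
  filter_upwards [ae_fst (ν := ν) (ρ := ρ) hg.coeFn_toLp, ae_mid (μ := μ) (ρ := ρ) hf.coeFn_toLp,
    ae_snd (μ := μ) (ν := ν) hh.coeFn_toLp] with p h1 h2 h3
  simp only [triFun, h1, h2, h3]

theorem inner_tri (g g' : Lp ℂ 2 μ) (f f' : Lp F 2 ν) (h h' : Lp ℂ 2 ρ) :
    inner ℂ (tri g f h) (tri g' f' h') = inner ℂ g g' * (inner ℂ f f' * inner ℂ h h') := by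
  rw [L2.inner_def, L2.inner_def, L2.inner_def, L2.inner_def, ← integral_prod_mul,
    ← integral_prod_mul]
  refine integral_congr_ae ?_
  filter_upwards [coeFn_tri g f h, coeFn_tri g' f' h'] with p h1 h2
  rw [h1, h2, triFun, triFun, inner_smul_left, inner_smul_right, RCLike.inner_apply',
    RCLike.inner_apply', map_mul]
  ring

theorem norm_tri (g : Lp ℂ 2 μ) (f : Lp F 2 ν) (h : Lp ℂ 2 ρ) :
    ‖tri g f h‖ = ‖g‖ * ‖f‖ * ‖h‖ := by
  have h1 : (‖tri g f h‖ : ℂ) ^ 2 = (‖g‖ : ℂ) ^ 2 * ((‖f‖ : ℂ) ^ 2 * (‖h‖ : ℂ) ^ 2) := by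
    have := inner_tri g g f f h h
    simp only [inner_self_eq_norm_sq_to_K] at this
    exact this
  have h2 : ‖tri g f h‖ ^ 2 = (‖g‖ * ‖f‖ * ‖h‖) ^ 2 := by
    have : ((‖tri g f h‖ ^ 2 : ℝ) : ℂ) = (((‖g‖ * ‖f‖ * ‖h‖) ^ 2 : ℝ) : ℂ) := by
      push_cast
      refine h1.trans ?_
      ring
    exact_mod_cast this
  exact (pow_left_inj₀ (norm_nonneg _) (by positivity) two_ne_zero).1 h2

/-- `tri` as a function of its first argument. -/
def triFst (f : Lp F 2 ν) (h : Lp ℂ 2 ρ) : Lp ℂ 2 μ →L[ℂ] Lp F 2 (μ.prod (ν.prod ρ)) :=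
  LinearMap.mkContinuous
    { toFun := fun g => tri g f h
      map_add' := fun g g' => by
        refine Lp.ext ?_
        filter_upwards [coeFn_tri (g + g') f h, coeFn_tri g f h, coeFn_tri g' f h,
          Lp.coeFn_add (tri g f h) (tri g' f h), ae_fst (ν := ν) (ρ := ρ) (Lp.coeFn_add g g')]
          with p h1 h2 h3 h4 h5
        simp only [h1, h4, Pi.add_apply, h2, h3, triFun, h5]
        module
      map_smul' := fun c g => by
        refine Lp.ext ?_
        filter_upwards [coeFn_tri (c • g) f h, coeFn_tri g f h,
          Lp.coeFn_smul c (tri g f h), ae_fst (ν := ν) (ρ := ρ) (Lp.coeFn_smul c g)]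
          with p h1 h2 h3 h4
        simp only [RingHom.id_apply, h1, h3, Pi.smul_apply, h2, triFun, h4]
        module } (‖f‖ * ‖h‖) fun g => by
    change ‖tri g f h‖ ≤ _
    rw [norm_tri]
    exact le_of_eq (by ring)

/-- `tri` as a function of its second argument. -/
def triMid (g : Lp ℂ 2 μ) (h : Lp ℂ 2 ρ) : Lp F 2 ν →L[ℂ] Lp F 2 (μ.prod (ν.prod ρ)) :=
  LinearMap.mkContinuous
    { toFun := fun f => tri g f h
      map_add' := fun f f' => by
        refine Lp.ext ?_
        filter_upwards [coeFn_tri g (f + f') h, coeFn_tri g f h, coeFn_tri g f' h,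
          Lp.coeFn_add (tri g f h) (tri g f' h), ae_mid (μ := μ) (ρ := ρ) (Lp.coeFn_add f f')]
          with p h1 h2 h3 h4 h5
        simp only [h1, h4, Pi.add_apply, h2, h3, triFun, h5, smul_add]
      map_smul' := fun c f => by
        refine Lp.ext ?_
        filter_upwards [coeFn_tri g (c • f) h, coeFn_tri g f h,
          Lp.coeFn_smul c (tri g f h), ae_mid (μ := μ) (ρ := ρ) (Lp.coeFn_smul c f)]
          with p h1 h2 h3 h4
        simp only [RingHom.id_apply, h1, h3, Pi.smul_apply, h2, triFun, h4]
        module } (‖g‖ * ‖h‖) fun f => by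
    change ‖tri g f h‖ ≤ _
    rw [norm_tri]
    exact le_of_eq (by ring)

/-- `tri` as a function of its third argument. -/
def triSnd (g : Lp ℂ 2 μ) (f : Lp F 2 ν) : Lp ℂ 2 ρ →L[ℂ] Lp F 2 (μ.prod (ν.prod ρ)) :=
  LinearMap.mkContinuous
    { toFun := fun h => tri g f h
      map_add' := fun h h' => by
        refine Lp.ext ?_
        filter_upwards [coeFn_tri g f (h + h'), coeFn_tri g f h, coeFn_tri g f h',
          Lp.coeFn_add (tri g f h) (tri g f h'), ae_snd (μ := μ) (ν := ν) (Lp.coeFn_add h h')]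
          with p h1 h2 h3 h4 h5
        simp only [h1, h4, Pi.add_apply, h2, h3, triFun, h5]
        module
      map_smul' := fun c h => by
        refine Lp.ext ?_
        filter_upwards [coeFn_tri g f (c • h), coeFn_tri g f h,
          Lp.coeFn_smul c (tri g f h), ae_snd (μ := μ) (ν := ν) (Lp.coeFn_smul c h)]
          with p h1 h2 h3 h4
        simp only [RingHom.id_apply, h1, h3, Pi.smul_apply, h2, triFun, h4]
        module } (‖g‖ * ‖f‖) fun h => (norm_tri g f h).le

/-- A function whose integrals over a generating `π`-system vanish is zero. -/
theorem setIntegral_eq_zero_of_generateFrom {Z : Type*} {m : MeasurableSpace Z} {η : Measure Z}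
    {φ : Z → ℂ} (hφ : Integrable φ η) {S : Set (Set Z)}
    (hm : m = MeasurableSpace.generateFrom S) (hS : IsPiSystem S) (huniv : univ ∈ S)
    (h : ∀ s ∈ S, ∫ x in s, φ x ∂η = 0) {s : Set Z} (hs : MeasurableSet s) :
    ∫ x in s, φ x ∂η = 0 := by
  refine MeasurableSpace.induction_on_inter (C := fun s _ => ∫ x in s, φ x ∂η = 0) hm hS ?_ h ?_ ?_
    s hs
  · simp
  · intro t ht h1
    have h2 := integral_add_compl ht hφ
    have h3 := h _ huniv
    rw [setIntegral_univ] at h3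
    rwa [h1, h3, zero_add] at h2
  · intro f hd hf h1
    rw [integral_iUnion hf hd hφ.integrableOn]
    simp [h1]

/-- Products of functions of one variable are total. -/
theorem eq_zero_of_inner_tri {μ : Measure α} [SigmaFinite μ] [IsFiniteMeasure ν]
    [IsFiniteMeasure ρ] [CompleteSpace F]
    [SecondCountableTopology F]
    {u : Lp F 2 (μ.prod (ν.prod ρ))} (hu : ∀ g f h, inner ℂ u (tri g f h) = 0) : u = 0 := by
  refine Lp.eq_zero_iff_ae_eq_zero.2 (ae_eq_zero_of_forall_inner (𝕜 := ℂ) fun v => ?_)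
  have hc : MemLp (fun p => inner ℂ (u p) v) 2 (μ.prod (ν.prod ρ)) := (Lp.memLp u).inner_const v
  have hmeas : MeasurableSpace.generateFrom (image2 (fun x1 x2 => x1 ×ˢ x2)
      {s : Set α | MeasurableSet s} (image2 (fun x1 x2 => x1 ×ˢ x2)
        {s : Set β | MeasurableSet s} {s : Set γ | MeasurableSet s})) = Prod.instMeasurableSpace :=
    generateFrom_eq_prod MeasurableSpace.generateFrom_measurableSet generateFrom_prod
      isCountablySpanning_measurableSet
      (isCountablySpanning_measurableSet.prod isCountablySpanning_measurableSet)
  have hpi : IsPiSystem (image2 (fun x1 x2 => x1 ×ˢ x2)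
      {s : Set α | MeasurableSet s} (image2 (fun x1 x2 => x1 ×ˢ x2)
        {s : Set β | MeasurableSet s} {s : Set γ | MeasurableSet s})) :=
    MeasurableSpace.isPiSystem_measurableSet.prod
      (MeasurableSpace.isPiSystem_measurableSet.prod MeasurableSpace.isPiSystem_measurableSet)
  -- The indicator of a box, times `v`, is a product function. Boxes form a generating `π`-system;
  -- the exhaustion of `α` by sets of finite measure below makes the square integrable function
  -- integrable, as the passage from boxes to all measurable sets requires.
  have hrect : ∀ (s : Set α) (t : Set β) (r : Set γ), MeasurableSet s → MeasurableSet t →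
      MeasurableSet r → μ s ≠ ⊤ →
      ∫ p in s ×ˢ (t ×ˢ r), inner ℂ (u p) v ∂(μ.prod (ν.prod ρ)) = 0 := by
    intro s t r hs ht hr hfin
    have h1 := hu (indicatorConstLp 2 hs hfin 1) (indicatorConstLp 2 ht (measure_ne_top _ _) v)
      (indicatorConstLp 2 hr (measure_ne_top _ _) 1)
    rw [L2.inner_def] at h1
    rw [← integral_indicator (hs.prod (ht.prod hr)), ← h1]
    refine integral_congr_ae ?_
    filter_upwards [coeFn_tri (indicatorConstLp 2 hs hfin (1 : ℂ))
        (indicatorConstLp 2 ht (measure_ne_top ν _) v)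
        (indicatorConstLp 2 hr (measure_ne_top ρ _) (1 : ℂ)),
      ae_fst (ν := ν) (ρ := ρ) (indicatorConstLp_coeFn (p := 2) (hs := hs) (hμs := hfin)
        (c := (1 : ℂ))),
      ae_mid (μ := μ) (ρ := ρ) (indicatorConstLp_coeFn (p := 2) (hs := ht)
        (hμs := measure_ne_top ν _) (c := v)),
      ae_snd (μ := μ) (ν := ν) (indicatorConstLp_coeFn (p := 2) (hs := hr)
        (hμs := measure_ne_top ρ _) (c := (1 : ℂ)))] with p h1 h2 h3 h4
    rw [h1, triFun, h2, h3, h4]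
    by_cases k1 : p.1 ∈ s <;> by_cases k2 : p.2.1 ∈ t <;> by_cases k3 : p.2.2 ∈ r <;>
      simp [indicator, k1, k2, k3]
  have hn : ∀ n : ℕ, ∀ᵐ p ∂μ.prod (ν.prod ρ), p ∈ (spanningSets μ n) ×ˢ (univ : Set (β × γ)) →
      inner ℂ (u p) v = 0 := by
    intro n
    have hms := measurableSet_spanningSets μ n
    have hfin : (μ.prod (ν.prod ρ)) ((spanningSets μ n) ×ˢ univ) < ⊤ := by
      rw [Measure.prod_prod]
      exact ENNReal.mul_lt_top (measure_spanningSets_lt_top μ n) (measure_lt_top _ _)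
    have hM : MeasurableSet ((spanningSets μ n) ×ˢ (univ : Set (β × γ))) := hms.prod .univ
    have : IsFiniteMeasure ((μ.prod (ν.prod ρ)).restrict ((spanningSets μ n) ×ˢ univ)) :=
      ⟨by rw [Measure.restrict_apply_univ]; exact hfin⟩
    have hi : Integrable (fun p => inner ℂ (u p) v)
        ((μ.prod (ν.prod ρ)).restrict ((spanningSets μ n) ×ˢ univ)) :=
      (hc.restrict _).integrable one_le_two
    refine (ae_restrict_iff' hM).1 (hi.ae_eq_zero_of_forall_setIntegral_eq_zero fun s hs _ => ?_)
    refine setIntegral_eq_zero_of_generateFrom hi hmeas.symm hpi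
      ⟨univ, .univ, univ, ⟨univ, .univ, univ, .univ, univ_prod_univ⟩, univ_prod_univ⟩ ?_ hs
    rintro _ ⟨s, hs, _, ⟨t, ht, r, hr, rfl⟩, rfl⟩
    have hs' : MeasurableSet s := hs
    rw [Measure.restrict_restrict (hs'.prod (MeasurableSet.prod ht hr)), prod_inter_prod,
      inter_univ]
    exact hrect _ t r (hs'.inter hms) ht hr
      ((measure_mono inter_subset_right).trans_lt (measure_spanningSets_lt_top μ n)).ne
  filter_upwards [ae_all_iff.2 hn] with p hp
  have hp' : p.1 ∈ ⋃ n, spanningSets μ n := by rw [iUnion_spanningSets]; trivial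
  obtain ⟨n, hn⟩ := mem_iUnion.1 hp'
  rw [← inner_conj_symm, hp n ⟨hn, trivial⟩, map_zero, Pi.zero_apply]

end Triple

/-- The isometric embedding of `L²(ℝ; L²(ν; F))` into a space of functions of three variables
with fixed dependence on the last one. -/
theorem exists_tens_eq_tri {β γ : Type*} [MeasurableSpace β] [MeasurableSpace γ]
    {ν : Measure β} {ρ : Measure γ} [SigmaFinite ν] [SigmaFinite ρ]
    {F : Type*} [NormedAddCommGroup F] [InnerProductSpace ℂ F] [CompleteSpace F]
    {h : Lp ℂ 2 ρ} (hh : inner ℂ h h = (1 : ℂ)) :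
    ∃ J : Lp (Lp F 2 ν) 2 (volume : Measure ℝ) →L[ℂ] Lp F 2 ((volume : Measure ℝ).prod (ν.prod ρ)),
      ∀ f g, J (tens f g) = tri g f h := by
  classical
  obtain ⟨ι, b, -⟩ := exists_hilbertBasis ℂ (Lp F 2 ν)
  have hb := orthonormal_iff_ite.1 b.orthonormal
  let V : ι → Lp ℂ 2 (volume : Measure ℝ) →ₗᵢ[ℂ] Lp (Lp F 2 ν) 2 (volume : Measure ℝ) := fun i =>
    (tens (b i)).toLinearMap.isometryOfInner fun g g' => by
      change inner ℂ (tens (b i) g) (tens (b i) g') = _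
      rw [inner_tens_tens, hb, if_pos rfl, one_mul]
  let V' : ι → Lp ℂ 2 (volume : Measure ℝ) →ₗᵢ[ℂ] Lp F 2 ((volume : Measure ℝ).prod (ν.prod ρ)) :=
    fun i => (triFst (b i) h).toLinearMap.isometryOfInner fun g g' => by
      change inner ℂ (tri g (b i) h) (tri g' (b i) h) = _
      rw [inner_tri, hb, if_pos rfl, hh, one_mul, mul_one]
  have hV : OrthogonalFamily ℂ (fun _ => Lp ℂ 2 (volume : Measure ℝ)) V := by
    intro i j hij g g'
    change inner ℂ (tens (b i) g) (tens (b j) g') = _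
    rw [inner_tens_tens, hb, if_neg hij, zero_mul]
  have hV' : OrthogonalFamily ℂ (fun _ => Lp ℂ 2 (volume : Measure ℝ)) V' := by
    intro i j hij g g'
    change inner ℂ (tri g (b i) h) (tri g' (b j) h) = _
    rw [inner_tri, hb, if_neg hij, zero_mul, mul_zero]
  -- For a Hilbert basis `b` of the fibre, both families of isometries `g ↦ b i g` and `g ↦ g h b i`
  -- have orthogonal ranges. `J` reads off the coefficients by the adjoint of the first sum and
  -- reassembles them by the second.
  let J := hV'.linearIsometry.toContinuousLinearMap ∘SL
    ContinuousLinearMap.adjoint hV.linearIsometry.toContinuousLinearMap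
  have hJ : ∀ i g, J (tens (b i) g) = tri g (b i) h := by
    intro i g
    have h1 : tens (b i) g = hV.linearIsometry (lp.single 2 i g) :=
      (hV.linearIsometry_apply_single g).symm
    have h2 := congrArg (fun T => T (lp.single 2 i g))
      (LinearIsometry.adjoint_comp_self hV.linearIsometry)
    change hV'.linearIsometry (ContinuousLinearMap.adjoint
      hV.linearIsometry.toContinuousLinearMap (tens (b i) g)) = _
    rw [h1]
    refine (congrArg hV'.linearIsometry h2).trans ?_
    exact hV'.linearIsometry_apply_single g
  refine ⟨J, fun f g => ?_⟩
  have hdense : Dense (Submodule.span ℂ (range b) : Set (Lp F 2 ν)) :=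
    Submodule.dense_iff_topologicalClosure_eq_top.2 b.dense_span
  refine hdense.induction (P := fun f => J (tens f g) = triMid g h f) (fun f hf => ?_)
    (isClosed_eq (by fun_prop) (by fun_prop)) f
  induction hf using Submodule.span_induction with
  | mem f hf => obtain ⟨i, rfl⟩ := hf; exact hJ i g
  | zero => simp
  | add f f' _ _ h1 h2 => simp [h1, h2]
  | smul c f _ h1 => simp [h1]

theorem exists_tens_eq_tri' {β γ : Type*} [MeasurableSpace β] [MeasurableSpace γ]
    {ν : Measure β} {ρ : Measure γ} [SigmaFinite ν] [SigmaFinite ρ]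
    {F : Type*} [NormedAddCommGroup F] [InnerProductSpace ℂ F] [CompleteSpace F] (h : Lp ℂ 2 ρ) :
    ∃ J : Lp (Lp F 2 ν) 2 (volume : Measure ℝ) →L[ℂ] Lp F 2 ((volume : Measure ℝ).prod (ν.prod ρ)),
      ∀ f g, J (tens f g) = tri g f h := by
  have hs : ∀ (g : Lp ℂ 2 (volume : Measure ℝ)) (f : Lp F 2 ν) (c : ℂ) (h : Lp ℂ 2 ρ),
      tri g f (c • h) = c • tri g f h := fun g f c h => (triSnd g f).map_smul c h
  by_cases h0 : h = 0
  · exact ⟨0, fun f g => by simpa [h0] using (hs g f 0 0).symm⟩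
  have hn : (‖h‖ : ℂ) ≠ 0 := by exact_mod_cast norm_ne_zero_iff.2 h0
  obtain ⟨J, hJ⟩ := exists_tens_eq_tri (ν := ν) (F := F) (h := (‖h‖ : ℂ)⁻¹ • h) (by
    rw [inner_smul_left, inner_smul_right, inner_self_eq_norm_sq_to_K, map_inv₀,
      Complex.conj_ofReal]
    change (‖h‖ : ℂ)⁻¹ * ((‖h‖ : ℂ)⁻¹ * (‖h‖ : ℂ) ^ 2) = 1
    field_simp)
  refine ⟨(‖h‖ : ℂ) • J, fun f g => ?_⟩
  rw [smul_apply, hJ, hs, smul_smul, mul_inv_cancel₀ hn, one_smul]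

/-! ## Fourier series -/

/-- A square integrable function on `[0, 2π)` with vanishing Fourier coefficients of half-integer
order is zero. -/
theorem ae_eq_zero_of_halfInteger_fourierCoeff {c : ℝ → ℂ}
    (hc : MemLp c 2 (volume.restrict (Ico 0 (2 * Real.pi))))
    (h : ∀ n : ℤ, ∫ φ in Ico 0 (2 * Real.pi),
      c φ * Complex.exp (Complex.I * ((n + 1 / 2 : ℝ) * φ)) = 0) :
    c =ᵐ[volume.restrict (Ico 0 (2 * Real.pi))] 0 := by
  have hpi := Real.two_pi_pos
  -- The unimodular factor `e^{iφ/2}` shifts half-integer frequencies to integer ones, where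
  -- Parseval's identity applies.
  let d : ℝ → ℂ := fun φ => c φ * Complex.exp (Complex.I * (φ / 2))
  have hn : ∀ φ, ‖d φ‖ = ‖c φ‖ := fun φ => by
    have : Complex.I * ((φ : ℂ) / 2) = ((φ / 2 : ℝ) : ℂ) * Complex.I := by push_cast; ring
    rw [norm_mul, this, Complex.norm_exp_ofReal_mul_I, mul_one]
  have hIoc : volume.restrict (Ioc 0 (2 * Real.pi)) = volume.restrict (Ico 0 (2 * Real.pi)) :=
    Measure.restrict_congr_set (Ioc_ae_eq_Icc.trans Ico_ae_eq_Icc.symm)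
  have hd : MemLp d 2 (volume.restrict (Ioc 0 (2 * Real.pi))) := by
    rw [hIoc]
    exact hc.of_le (hc.1.mul (by fun_prop : Continuous fun φ : ℝ =>
      Complex.exp (Complex.I * (φ / 2))).aestronglyMeasurable)
      (Filter.Eventually.of_forall fun φ => (hn φ).le)
  have h1 := hasSum_sq_fourierCoeffOn hpi hd
  have h2 : ∀ n : ℤ, fourierCoeffOn hpi d n = 0 := by
    intro n
    rw [fourierCoeffOn_eq_integral, intervalIntegral.integral_of_le hpi.le, hIoc]
    refine smul_eq_zero_of_right _ ?_
    -- The coefficient of order `n` integrates against `e^{-inφ}`, so that the total frequency is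
    -- `-n + 1/2`.
    rw [← h (-n)]
    refine integral_congr_ae (Filter.Eventually.of_forall fun φ => ?_)
    simp only [fourier_coe_apply, smul_eq_mul, d]
    rw [mul_left_comm, ← Complex.exp_add]
    congr 2
    have hpi' : (Real.pi : ℂ) ≠ 0 := by exact_mod_cast Real.pi_ne_zero
    push_cast
    field_simp
    ring
  simp only [h2, norm_zero, ne_eq, OfNat.ofNat_ne_zero, not_false_eq_true, zero_pow] at h1
  have h3 := h1.unique hasSum_zero
  rw [sub_zero, smul_eq_zero, or_iff_right (inv_ne_zero hpi.ne'),
    intervalIntegral.integral_of_le hpi.le, integral_eq_zero_iff_of_nonneg (fun _ => by positivity)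
      (hd.integrable_norm_pow two_ne_zero), hIoc] at h3
  filter_upwards [h3] with φ hφ
  simpa [hn] using hφ

/-- The deficiency spaces of a bounded symmetric perturbation of `-i s ∂_x - w A` are trivial. -/
theorem eq_zero_of_modeDirac_add {X V : Type*} [NormedAddCommGroup X] [InnerProductSpace ℂ X]
    [CompleteSpace X] [SecondCountableTopology X] [AddCommGroup V] [Module ℂ V] {s : X →L[ℂ] X}
    {w : ℝ →ᵇ ℝ} {ι A : V →ₗ[ℂ] X} (hs : ∀ u v, inner ℂ (s u) v = inner ℂ u (s v))
    (hs2 : ∀ v, s (s v) = v) (hsymm : ∀ v w, inner ℂ (ι v) (A w) = inner ℂ (A v) (ι w))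
    (hA : DenseRange A) {R : X →L[ℂ] X} (hR : ∀ v, R (A v) = ι v)
    (hRs : ∀ u v, inner ℂ (R u) v = inner ℂ u (R v)) (hR0 : ∀ u, R u = 0 → u = 0)
    (hRa : ∀ u, R (s u) = -s (R u))
    {B : Lp X 2 (volume : Measure ℝ) →L[ℂ] Lp X 2 (volume : Measure ℝ)}
    (hB : ∀ u v, inner ℂ (B u) v = inner ℂ u (B v)) {z : ℂ}
    (hz : z = Complex.I ∨ z = -Complex.I) {u : Lp X 2 (volume : Measure ℝ)}
    (hu : ∀ (χ : ℝ → ℝ) (hχ : IsTest univ χ) (f : V),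
      inner ℂ u (-Complex.I • tens (s (ι f)) (lineTest hχ.deriv)
        - tens (A f) (mulOp volume ℂ w (lineTest hχ)) + B (tens (ι f) (lineTest hχ)))
        = z * inner ℂ u (tens (ι f) (lineTest hχ))) : u = 0 := by
  refine ((isSymmRel_modeDirac hs hsymm).hasRealAdjoint (hasTrivialDeficiency_modeDirac (w := w)
    hs hs2 hA hR hRs hR0 hRa)).eq_zero_of_isAdjPair hB hz (isAdjPair_span.2 ?_)
  rintro _ ⟨χ, hχ, f, rfl⟩
  have h1 := hu χ hχ f
  rw [inner_add_right] at h1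
  rw [inner_sub_left, inner_smul_left, Complex.conj_conj, hB]
  exact eq_sub_of_add_eq h1

namespace KerrNewman

/-! ## Separation of the angle `φ` -/

theorem restrict_Ω₃ : (volume : Measure (ℝ × ℝ × ℝ)).restrict Ω₃
    = (volume : Measure ℝ).prod ((volume.restrict (Ioo 0 Real.pi)).prod
      (volume.restrict (Ico 0 (2 * Real.pi)))) := by
  rw [Measure.prod_restrict, ← Measure.volume_eq_prod]
  conv_rhs => rw [← Measure.restrict_univ (μ := (volume : Measure ℝ)), Measure.prod_restrict]
  rw [← Measure.volume_eq_prod]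
  rfl

/-- The function `e^{i (n + 1/2) φ}`. -/
def expMode (n : ℤ) (φ : ℝ) : ℂ := Complex.exp (Complex.I * ((n + 1 / 2 : ℝ) * φ))

theorem memLp_expMode (n : ℤ) : MemLp (expMode n) 2 (volume.restrict (Ico 0 (2 * Real.pi))) := by
  refine MemLp.of_bound (by unfold expMode; fun_prop) 1 (Filter.Eventually.of_forall fun φ => ?_)
  have : Complex.I * (((n + 1 / 2 : ℝ) : ℂ) * φ) = (((n + 1 / 2 : ℝ) * φ : ℝ) : ℂ) * Complex.I := by
    push_cast; ring
  rw [expMode, this, Complex.norm_exp_ofReal_mul_I]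

theorem contDiff_expMode (n : ℤ) : ContDiff ℝ ∞ (expMode n) :=
  (contDiff_const.mul (contDiff_const.mul Complex.ofRealCLM.contDiff)).cexp

theorem hasDerivAt_expMode (n : ℤ) (φ : ℝ) :
    HasDerivAt (expMode n) (Complex.I * (n + 1 / 2 : ℝ) * expMode n φ) φ := by
  have h1 : HasDerivAt (fun φ : ℝ => Complex.I * (((n + 1 / 2 : ℝ) : ℂ) * φ))
      (Complex.I * ((n + 1 / 2 : ℝ) * 1)) φ :=
    ((Complex.ofRealCLM.hasDerivAt (x := φ)).const_mul _).const_mul _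
  refine h1.cexp.congr_deriv ?_
  rw [expMode]
  ring

theorem expMode_add_two_pi (n : ℤ) (φ : ℝ) : expMode n (φ + 2 * Real.pi) = -expMode n φ := by
  have : Complex.I * (((n + 1 / 2 : ℝ) : ℂ) * ((φ + 2 * Real.pi : ℝ) : ℂ))
      = Complex.I * (((n + 1 / 2 : ℝ) : ℂ) * φ) + n * (2 * Real.pi * Complex.I)
        + Real.pi * Complex.I := by
    push_cast; ring
  rw [expMode, this, Complex.exp_add, Complex.exp_add, Complex.exp_int_mul_two_pi_mul_I,
    Complex.exp_pi_mul_I, expMode]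
  ring

theorem memLp_triFun_expMode {g : ℝ → ℂ} {f : ℝ → Spinor} (n : ℤ) (hg : MemLp g 2 volume)
    (hf : MemLp f 2 (volume.restrict (Ioo 0 Real.pi))) :
    MemLp (triFun g f (expMode n)) 2 (volume.restrict Ω₃) := by
  rw [restrict_Ω₃]
  exact memLp_triFun hg hf (memLp_expMode n)

/-- The embedding of `L²(ℝ; L²((0, π); ℂ⁴))` as the subspace of functions with angular dependence
`e^{i (n + 1/2) φ}`. -/
theorem exists_modeMap (n : ℤ) :
    ∃ J : Lp AngL2 2 (volume : Measure ℝ) →L[ℂ] L2, ∀ (g : ℝ → ℂ) (f : ℝ → Spinor)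
      (hg : MemLp g 2 volume) (hf : MemLp f 2 (volume.restrict (Ioo 0 Real.pi))),
      J (tens (hf.toLp f) (hg.toLp g)) = (memLp_triFun_expMode n hg hf).toLp _ := by
  -- The measure on `Ω₃` is only provably equal to the product measure, and the type `Lp` depends on
  -- it; a variable measure allows substitution.
  have main : ∀ η : Measure (ℝ × ℝ × ℝ), η = (volume : Measure ℝ).prod
      ((volume.restrict (Ioo 0 Real.pi)).prod (volume.restrict (Ico 0 (2 * Real.pi)))) →
      ∃ J : Lp AngL2 2 (volume : Measure ℝ) →L[ℂ] Lp Spinor 2 η, ∀ (g : ℝ → ℂ) (f : ℝ → Spinor)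
      (hg : MemLp g 2 volume) (hf : MemLp f 2 (volume.restrict (Ioo 0 Real.pi)))
      (hm : MemLp (triFun g f (expMode n)) 2 η),
      J (tens (hf.toLp f) (hg.toLp g)) = hm.toLp _ := by
    rintro η rfl
    obtain ⟨J, hJ⟩ := exists_tens_eq_tri' (ν := volume.restrict (Ioo 0 Real.pi)) (F := Spinor)
      ((memLp_expMode n).toLp _)
    exact ⟨J, fun g f hg hf hm => (hJ _ _).trans (toLp_triFun hg hf (memLp_expMode n)).symm⟩
  obtain ⟨J, hJ⟩ := main _ restrict_Ω₃
  exact ⟨J, fun g f hg hf => hJ g f hg hf _⟩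

/-- The modes are total in `L²(Ω₃)⁴`. -/
theorem eq_zero_of_inner_modes {u : L2} (hu : ∀ (n : ℤ) (g : ℝ → ℂ) (f : ℝ → Spinor)
    (hg : MemLp g 2 volume) (hf : MemLp f 2 (volume.restrict (Ioo 0 Real.pi))),
    inner ℂ u ((memLp_triFun_expMode n hg hf).toLp _) = 0) : u = 0 := by
  have main : ∀ η : Measure (ℝ × ℝ × ℝ), η = (volume : Measure ℝ).prod
      ((volume.restrict (Ioo 0 Real.pi)).prod (volume.restrict (Ico 0 (2 * Real.pi)))) →
      ∀ u : Lp Spinor 2 η, (∀ (n : ℤ) (g : ℝ → ℂ) (f : ℝ → Spinor)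
      (_ : MemLp g 2 volume) (_ : MemLp f 2 (volume.restrict (Ioo 0 Real.pi)))
      (hm : MemLp (triFun g f (expMode n)) 2 η), inner ℂ u (hm.toLp _) = 0) → u = 0 := by
    rintro η rfl u hu
    refine eq_zero_of_inner_tri fun g f h => ?_
    -- This is the function of `φ` left after pairing `u` with `g(x) f(θ)`; the hypothesis says that
    -- its half-integer Fourier coefficients vanish.
    have hc : ContinuousLinearMap.adjoint (triSnd g f) u = 0 := by
      refine Lp.eq_zero_iff_ae_eq_zero.2 ?_
      have h1 := ae_eq_zero_of_halfInteger_fourierCoeff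
        (c := fun φ => (starRingEnd ℂ) (ContinuousLinearMap.adjoint (triSnd g f) u φ))
        (Lp.memLp (ContinuousLinearMap.adjoint (triSnd g f) u)).star fun n => by
        have h2 : inner ℂ (ContinuousLinearMap.adjoint (triSnd g f) u)
            ((memLp_expMode n).toLp _) = 0 := by
          rw [ContinuousLinearMap.adjoint_inner_left]
          have h3 := hu n g f (Lp.memLp g) (Lp.memLp f)
            (memLp_triFun (Lp.memLp g) (Lp.memLp f) (memLp_expMode n))
          rw [toLp_triFun (Lp.memLp g) (Lp.memLp f) (memLp_expMode n), Lp.toLp_coeFn,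
            Lp.toLp_coeFn] at h3
          exact h3
        rw [L2.inner_def] at h2
        rw [← h2]
        refine integral_congr_ae ?_
        filter_upwards [(memLp_expMode n).coeFn_toLp] with φ hφ
        rw [hφ, RCLike.inner_apply']
        rfl
      filter_upwards [h1] with φ hφ
      simpa using hφ
    change inner ℂ u (triSnd g f h) = 0
    rw [← ContinuousLinearMap.adjoint_inner_left, hc, inner_zero_left]
  exact main _ restrict_Ω₃ u fun n g f hg hf hm => hu n g f hg hf

/-- The test function `χ(x) e^{i (n + 1/2) φ} f(θ)`. -/
def modeTest (n : ℤ) {χ : ℝ → ℝ} (hχ : IsTest univ χ) (f : angTest) : TestFunction :=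
  ⟨triFun (fun x => (χ x : ℂ)) f.1 (expMode n), by
    refine ⟨?_, fun x θ φ => ?_, tsupport χ ×ˢ tsupport f.1, ?_, ?_, fun x θ φ hx => ?_⟩
    · have h1 := hχ.contDiff
      have h2 := f.2.contDiff
      have h3 := contDiff_expMode n
      have h4 : ContDiff ℝ ∞ (fun p : ℝ × ℝ × ℝ => (χ p.1 : ℂ)) :=
        Complex.ofRealCLM.contDiff.comp (h1.comp contDiff_fst)
      exact (h4.mul (h3.comp contDiff_snd.snd')).smul (h2.comp contDiff_fst.snd')
    · simp only [triFun, expMode_add_two_pi, mul_neg, neg_smul]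
    · exact hχ.hasCompactSupport.isCompact.prod f.2.hasCompactSupport.isCompact
    · exact prod_mono (subset_univ _) f.2.tsupport_subset
    · rw [mem_prod, not_and_or] at hx
      rcases hx with hx | hx
      · simp [triFun, image_eq_zero_of_notMem_tsupport hx]
      · simp [triFun, image_eq_zero_of_notMem_tsupport hx]⟩

namespace Exterior

variable (K : Exterior)

theorem inv_le_one_div (x : ℝ) : 1 / (K.r x ^ 2 + K.a ^ 2) ≤ 1 / K.rPlus ^ 2 := by
  have h0 := K.rPlus_pos
  have h1 := K.rPlus_lt_r x
  refine one_div_le_one_div_of_le (by positivity) ?_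
  nlinarith [sq_nonneg K.a]

theorem w_nonneg (x : ℝ) : 0 ≤ K.w x :=
  div_nonneg (Real.sqrt_nonneg _) (K.sq_add_sq_pos (K.rPlus_lt_r x)).le

/-- From `√Δ ≤ r`, both roots of `Δ` being nonnegative. The mass term is therefore bounded although
`r` is not. -/
theorem r_mul_w_le_one (x : ℝ) : K.r x * K.w x ≤ 1 := by
  have hr := K.rPlus_lt_r x
  have h0 := K.rPlus_pos.trans hr
  have h1 : Real.sqrt (K.Δ (K.r x)) ≤ K.r x := Real.sqrt_le_iff.2 ⟨h0.le, K.Δ_le_sq hr⟩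
  rw [w, ← mul_div_assoc, div_le_one (K.sq_add_sq_pos hr)]
  nlinarith [sq_nonneg K.a]

theorem w_le (x : ℝ) : K.w x ≤ 1 / K.rPlus := by
  have h0 := K.rPlus_pos
  rw [le_div_iff₀ h0]
  exact (by nlinarith [K.w_nonneg x, K.rPlus_lt_r x] : _ ≤ K.r x * K.w x).trans
    (K.r_mul_w_le_one x)

theorem invSq_continuous : Continuous fun x => 1 / (K.r x ^ 2 + K.a ^ 2) := by
  have := K.r_continuous
  exact continuous_const.div (by fun_prop) fun y => (K.sq_add_sq_pos (K.rPlus_lt_r y)).ne'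

/-- The function `√Δ / (r² + a²)` as a bounded function. -/
def wB : ℝ →ᵇ ℝ := BoundedContinuousFunction.ofNormedAddCommGroup K.w K.w_continuous
  (1 / K.rPlus) fun x => by
    rw [Real.norm_of_nonneg (K.w_nonneg x)]
    exact K.w_le x

/-- The function `(a k - e Q r) / (r² + a²)`. -/
def potential (e k : ℝ) : ℝ →ᵇ ℝ := BoundedContinuousFunction.ofNormedAddCommGroup
  (fun x => 1 / (K.r x ^ 2 + K.a ^ 2) * (K.a * k - e * K.Q * K.r x))
  (by have := K.r_continuous; exact K.invSq_continuous.mul (by fun_prop))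
  (|K.a * k| * (1 / K.rPlus ^ 2) + |e * K.Q| * (1 / K.rPlus)) fun x => by
    have h0 := K.rPlus_pos
    have h1 := K.inv_le_one_div x
    have hr := K.rPlus_lt_r x
    have hp := K.sq_add_sq_pos hr
    have hp' : 0 ≤ 1 / (K.r x ^ 2 + K.a ^ 2) := by positivity
    have h2 : 1 / (K.r x ^ 2 + K.a ^ 2) * K.r x ≤ 1 / K.rPlus := by
      rw [one_div_mul_eq_div, div_le_div_iff₀ hp h0]
      nlinarith [sq_nonneg K.a]
    have h3 : 0 ≤ 1 / (K.r x ^ 2 + K.a ^ 2) * K.r x := mul_nonneg hp' (h0.trans hr).le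
    have e1 : 1 / (K.r x ^ 2 + K.a ^ 2) * (K.a * k - e * K.Q * K.r x)
        = (K.a * k) * (1 / (K.r x ^ 2 + K.a ^ 2))
          - (e * K.Q) * (1 / (K.r x ^ 2 + K.a ^ 2) * K.r x) := by ring
    rw [e1]
    refine (norm_sub_le _ _).trans (add_le_add ?_ ?_)
    · rw [norm_mul, Real.norm_of_nonneg hp', Real.norm_eq_abs]
      exact mul_le_mul_of_nonneg_left h1 (abs_nonneg _)
    · rw [norm_mul, Real.norm_of_nonneg h3, Real.norm_eq_abs]
      exact mul_le_mul_of_nonneg_left h2 (abs_nonneg _)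

/-- The function `-m r √Δ / (r² + a²)`. -/
def massTerm (m : ℝ) : ℝ →ᵇ ℝ := BoundedContinuousFunction.ofNormedAddCommGroup
  (fun x => -(m * K.r x * K.w x))
  (by have := K.r_continuous; have := K.w_continuous; fun_prop) |m| fun x => by
    have h0 := K.rPlus_pos.trans (K.rPlus_lt_r x)
    rw [norm_neg, mul_assoc, norm_mul, Real.norm_of_nonneg (mul_nonneg h0.le (K.w_nonneg x)),
      Real.norm_eq_abs]
    exact mul_le_of_le_one_right (abs_nonneg _) (K.r_mul_w_le_one x)

end Exterior

/-- The cosine as a bounded function. -/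
def cosB : ℝ →ᵇ ℝ := BoundedContinuousFunction.ofNormedAddCommGroup Real.cos Real.continuous_cos 1
  fun x => Real.abs_cos_le_one x

/-- The matrix `(0, I; I, 0)` as an operator in `L²((0, π); ℂ⁴)`. -/
def massOp₁ : AngL2 →L[ℂ] AngL2 := (act (block 0 1 1 0)).compLpL 2 _

/-- The matrix `cos θ (0, iI; -iI, 0)` as an operator in `L²((0, π); ℂ⁴)`. -/
def massOp₂ : AngL2 →L[ℂ] AngL2 :=
  mulOp _ Spinor cosB ∘L (act (block 0 (Complex.I • 1) (-Complex.I • 1) 0)).compLpL 2 _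

theorem inner_massOp₁ (u v : AngL2) : inner ℂ (massOp₁ u) v = inner ℂ u (massOp₁ v) :=
  inner_compLpL (inner_act_block_of_isHermitian (by simp [Matrix.IsHermitian])
    (by simp [Matrix.IsHermitian]) (by simp)) u v

theorem inner_massOp₂ (u v : AngL2) : inner ℂ (massOp₂ u) v = inner ℂ u (massOp₂ v) := by
  rw [massOp₂, ContinuousLinearMap.comp_apply, inner_mulOp, ContinuousLinearMap.comp_apply,
    mulOp_compLpL]
  exact inner_compLpL (inner_act_block_of_isHermitian (by simp [Matrix.IsHermitian])
    (by simp [Matrix.IsHermitian]) (by simp)) u _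

namespace Exterior

variable (K : Exterior)

/-- The bounded part of the operator on the subspace with angular dependence `e^{ikφ}`. -/
def modePerturbation (m e k : ℝ) :
    Lp AngL2 2 (volume : Measure ℝ) →L[ℂ] Lp AngL2 2 (volume : Measure ℝ) :=
  mulOp volume AngL2 (K.potential e k)
    + mulOp volume AngL2 (K.massTerm m) ∘L massOp₁.compLpL 2 volume
    + ((K.a * m : ℝ) : ℂ) • (mulOp volume AngL2 K.wB ∘L massOp₂.compLpL 2 volume)

theorem inner_modePerturbation (m e k : ℝ) (u v : Lp AngL2 2 (volume : Measure ℝ)) :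
    inner ℂ (K.modePerturbation m e k u) v = inner ℂ u (K.modePerturbation m e k v) := by
  simp only [modePerturbation, add_apply, smul_apply, ContinuousLinearMap.comp_apply,
    inner_add_left, inner_add_right, inner_smul_left, inner_smul_right, Complex.conj_ofReal,
    inner_mulOp, inner_compLpL inner_massOp₁, inner_compLpL inner_massOp₂, mulOp_compLpL]

/-- The matrix `diag(σ₃, -σ₃)` as an operator in `L²((0, π); ℂ⁴)`. -/
def _root_.KerrNewman.angσ₃ : AngL2 →L[ℂ] AngL2 := (act (diagBlock σ₃)).compLpL 2 _

theorem _root_.KerrNewman.inner_angσ₃ (u v : AngL2) :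
    inner ℂ (angσ₃ u) v = inner ℂ u (angσ₃ v) :=
  inner_compLpL (inner_act_diagBlock isHermitian_σ₃) u v

theorem _root_.KerrNewman.angσ₃_angσ₃ (v : AngL2) : angσ₃ (angσ₃ v) = v := by
  refine Lp.ext ?_
  filter_upwards [ContinuousLinearMap.coeFn_compLpL (p := 2) (act (diagBlock σ₃)) v,
    ContinuousLinearMap.coeFn_compLpL (p := 2) (act (diagBlock σ₃)) (angσ₃ v)] with x h1 h2
  refine h2.trans ?_
  rw [angσ₃, h1, act_σ₃_act_σ₃]

/-- The value on `χ(x) f(θ)` of the operator for angular dependence `e^{ikφ}`. -/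
def modeHamiltonian (m e k : ℝ) {χ : ℝ → ℝ} (hχ : IsTest univ χ) (f : angTest) :
    Lp AngL2 2 (volume : Measure ℝ) :=
  -Complex.I • tens (angσ₃ (angTest.toL2 f)) (lineTest hχ.deriv)
    - tens (angTest.toL2 (angDiracTest k f)) (mulOp volume ℂ K.wB (lineTest hχ))
    + K.modePerturbation m e k (tens (angTest.toL2 f) (lineTest hχ))

theorem mode_deficiency {m e k : ℝ} (hk : 1 / 2 ≤ |k|) {z : ℂ}
    (hz : z = Complex.I ∨ z = -Complex.I) {u : Lp AngL2 2 (volume : Measure ℝ)}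
    (hu : ∀ (χ : ℝ → ℝ) (hχ : IsTest univ χ) (f : angTest),
      inner ℂ u (K.modeHamiltonian m e k hχ f)
        = z * inner ℂ u (tens (angTest.toL2 f) (lineTest hχ))) : u = 0 := by
  -- A finite exponent is needed for the second countability of the fibre `AngL2`.
  have : Fact ((2 : ENNReal) ≠ ⊤) := ⟨by simp⟩
  obtain ⟨R, hR, hRs, hR0, hRa⟩ := exists_angular_inverse hk
  have h1 : ∀ u, R (angσ₃ u) = -angσ₃ (R u) := hRa
  have h2 := eq_zero_of_modeDirac_add (w := K.wB) (A := angTest.toL2 ∘ₗ angDiracTest k)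
    inner_angσ₃ angσ₃_angσ₃ (inner_angDiracTest k) (denseRange_angDirac hk) hR hRs hR0 h1
    (K.inner_modePerturbation m e k) hz (u := u)
  refine h2 ?_
  intro χ hχ f
  exact hu χ hχ f

end Exterior

end KerrNewman

/-! ### Action of the full operator on the modes, and its deficiency spaces -/

namespace KerrNewman

theorem dx_triFun {g : ℝ → ℂ} {f : ℝ → Spinor} {h : ℝ → ℂ} (hg : Differentiable ℝ g) :
    dx (triFun g f h) = triFun (deriv g) f h :=
  funext fun p => (((hg p.1).hasDerivAt.mul_const (h p.2.2)).smul_const (f p.2.1)).deriv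

theorem dθ_triFun {g : ℝ → ℂ} {f : ℝ → Spinor} {h : ℝ → ℂ} (hf : Differentiable ℝ f) :
    dθ (triFun g f h) = triFun g (deriv f) h :=
  funext fun p => ((hf p.2.1).hasDerivAt.const_smul (g p.1 * h p.2.2)).deriv

theorem dφ_triFun_expMode {g : ℝ → ℂ} {f : ℝ → Spinor} (n : ℤ) (p : ℝ × ℝ × ℝ) :
    dφ (triFun g f (expMode n)) p
      = (Complex.I * (n + 1 / 2 : ℝ)) • triFun g f (expMode n) p := by
  refine ((((hasDerivAt_expMode n p.2.2).const_mul (g p.1)).smul_const (f p.2.1)).deriv).trans ?_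
  rw [triFun, smul_smul]
  congr 1
  ring

theorem toL2_modeTest (n : ℤ) {χ : ℝ → ℝ} (hχ : IsTest univ χ) (f : angTest)
    {J : Lp AngL2 2 (volume : Measure ℝ) →L[ℂ] L2}
    (hJ : ∀ (g : ℝ → ℂ) (f : ℝ → Spinor)
      (hg : MemLp g 2 volume) (hf : MemLp f 2 (volume.restrict (Ioo 0 Real.pi))),
      J (tens (hf.toLp f) (hg.toLp g)) = (memLp_triFun_expMode n hg hf).toLp _) :
    TestFunction.toL2 (modeTest n hχ f) = J (tens (angTest.toL2 f) (lineTest hχ)) :=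
  have hl : MemLp (fun x => (χ x : ℂ)) 2 volume := by
    simpa using (hχ.comp_left Complex.ofRealCLM).memLp (s := univ)
  (hJ _ f.1 hl f.2.memLp).symm

namespace Exterior

variable (K : Exterior)

/-- On a mode `i ∂_φ` is multiplication by `-k`, `k = n + 1/2`: this gives the sign of `k / sin θ`
in `angDirac` and of `a k` in `potential`. -/
theorem h_modeTest (m e : ℝ) (n : ℤ) {χ : ℝ → ℝ} (hχ : IsTest univ χ) (f : angTest)
    (p : ℝ × ℝ × ℝ) : K.h m e (modeTest n hχ f) p
      = -Complex.I • triFun (fun x => ((deriv χ x : ℝ) : ℂ)) (actTest (diagBlock σ₃) f).1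
          (expMode n) p
        - triFun (fun x => (K.wB x : ℂ) • (χ x : ℂ)) (angDirac (n + 1 / 2) f) (expMode n) p
        + (triFun (fun x => (K.potential e (n + 1 / 2) x : ℂ) • (χ x : ℂ)) f.1 (expMode n) p
        + triFun (fun x => (K.massTerm m x : ℂ) • (χ x : ℂ)) (actTest (block 0 1 1 0) f).1
          (expMode n) p
        + ((K.a * m : ℝ) : ℂ) • triFun (fun x => (K.wB x : ℂ) • (χ x : ℂ))
          (fun θ => (cosB θ : ℂ) •
            (actTest (block 0 (Complex.I • 1) (-Complex.I • 1) 0) f).1 θ) (expMode n) p) := by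
  have hd : deriv (fun x => (χ x : ℂ)) = fun x => ((deriv χ x : ℝ) : ℂ) :=
    funext fun x => ((hχ.hasDerivAt x).ofReal_comp).deriv
  have hdiff : Differentiable ℝ fun x => (χ x : ℂ) :=
    fun x => ((hχ.hasDerivAt x).ofReal_comp).differentiableAt
  have e0 : ((modeTest n hχ f : TestFunction) : ℝ × ℝ × ℝ → Spinor)
    = triFun (fun x => (χ x : ℂ)) f.1 (expMode n) := rfl
  rw [e0, h, h₁, h₂, dx_triFun hdiff, hd, dθ_triFun f.2.differentiable, dφ_triFun_expMode]
  have e1 : K.wB p.1 = K.w p.1 := rfl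
  have e2 : K.massTerm m p.1 = -(m * K.r p.1 * K.w p.1) := rfl
  have e3 : cosB p.2.1 = Real.cos p.2.1 := rfl
  have e4 : K.potential e (n + 1 / 2) p.1
    = 1 / (K.r p.1 ^ 2 + K.a ^ 2) * (K.a * (n + 1 / 2) - e * K.Q * K.r p.1) := rfl
  simp only [triFun, actTest, angDirac, e1, e2, e3, e4, map_smul, smul_smul, smul_add, smul_eq_mul,
    diagBlock]
  generalize 1 / (K.r p.1 ^ 2 + K.a ^ 2) = q
  have e5 : ∀ v : Spinor, (-((n + 1 / 2 : ℝ) / Real.sin p.2.1)) • v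
      = ((-((n + 1 / 2 : ℝ) / Real.sin p.2.1) : ℝ) : ℂ) • v := fun v =>
    RCLike.real_smul_eq_coe_smul (K := ℂ) _ _
  rw [e5, smul_smul]
  push_cast
  match_scalars <;> first | ring1 | (ring_nf; simp only [Complex.I_sq]; ring1)

/-- The embedding of a mode intertwines the reduced operator with the full one. Each of the five
terms of the reduced operator is again a product function, for which `J` is known explicitly. -/
theorem hL2_modeTest (m e : ℝ) (n : ℤ) {χ : ℝ → ℝ} (hχ : IsTest univ χ) (f : angTest)
    {J : Lp AngL2 2 (volume : Measure ℝ) →L[ℂ] L2}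
    (hJ : ∀ (g : ℝ → ℂ) (f : ℝ → Spinor)
      (hg : MemLp g 2 volume) (hf : MemLp f 2 (volume.restrict (Ioo 0 Real.pi))),
      J (tens (hf.toLp f) (hg.toLp g)) = (memLp_triFun_expMode n hg hf).toLp _) :
    K.hL2 m e (modeTest n hχ f) = J (K.modeHamiltonian m e (n + 1 / 2) hχ f) := by
  have hl : ∀ {ρ : ℝ → ℝ}, IsTest univ ρ → MemLp (fun x => (ρ x : ℂ)) 2 volume := fun hρ => by
    simpa using (hρ.comp_left Complex.ofRealCLM).memLp (s := univ)
  have hw := memLp_boundedContinuous_smul K.wB (hl hχ)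
  have hp := memLp_boundedContinuous_smul (K.potential e (n + 1 / 2)) (hl hχ)
  have hm := memLp_boundedContinuous_smul (K.massTerm m) (hl hχ)
  have h0 := f.2.memLp (s := Ioo 0 Real.pi)
  have h3 := (actTest (diagBlock σ₃) f).2.memLp (s := Ioo 0 Real.pi)
  have hA := (angDiracTest (n + 1 / 2) f).2.memLp (s := Ioo 0 Real.pi)
  have hM := (actTest (block 0 1 1 0) f).2.memLp (s := Ioo 0 Real.pi)
  have hN := (actTest (block 0 (Complex.I • 1) (-Complex.I • 1) 0) f).2.memLp (s := Ioo 0 Real.pi)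
  have hC := memLp_boundedContinuous_smul cosB hN
  have t1 : J (tens (angσ₃ (angTest.toL2 f)) (lineTest hχ.deriv))
      = (memLp_triFun_expMode n (hl hχ.deriv) h3).toLp _ := by
    rw [angσ₃, ← toL2_actTest]
    exact hJ _ _ (hl hχ.deriv) h3
  have t2 : J (tens (angTest.toL2 (angDiracTest (n + 1 / 2) f))
      (mulOp volume ℂ K.wB (lineTest hχ))) = (memLp_triFun_expMode n hw hA).toLp _ := by
    rw [lineTest, mulOp_toLp K.wB (hl hχ) hw]
    exact hJ _ _ hw hA
  have t3 : J (mulOp volume AngL2 (K.potential e (n + 1 / 2))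
      (tens (angTest.toL2 f) (lineTest hχ))) = (memLp_triFun_expMode n hp h0).toLp _ := by
    rw [mulOp_tens, lineTest, mulOp_toLp _ (hl hχ) hp]
    exact hJ _ _ hp h0
  have t4 : J (mulOp volume AngL2 (K.massTerm m) (massOp₁.compLpL 2 volume
      (tens (angTest.toL2 f) (lineTest hχ)))) = (memLp_triFun_expMode n hm hM).toLp _ := by
    rw [compLpL_tens, mulOp_tens, lineTest, mulOp_toLp _ (hl hχ) hm, massOp₁, ← toL2_actTest]
    exact hJ _ _ hm hM
  have t5 : J (mulOp volume AngL2 K.wB (massOp₂.compLpL 2 volume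
      (tens (angTest.toL2 f) (lineTest hχ)))) = (memLp_triFun_expMode n hw hC).toLp _ := by
    rw [compLpL_tens, mulOp_tens, lineTest, mulOp_toLp _ (hl hχ) hw, massOp₂,
      ContinuousLinearMap.comp_apply, ← toL2_actTest]
    refine Eq.trans ?_ (hJ _ _ hw hC)
    rw [← mulOp_toLp cosB hN hC]
    rfl
  simp only [modeHamiltonian, modePerturbation, add_apply, smul_apply,
    ContinuousLinearMap.comp_apply, map_add, map_sub, map_smul]
  rw [t1, t2, t3, t4, t5, ← MemLp.toLp_const_smul, ← MemLp.toLp_const_smul, ← MemLp.toLp_sub,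
    ← MemLp.toLp_add, ← MemLp.toLp_add, ← MemLp.toLp_add]
  exact MemLp.toLp_congr (K.h_memLp m e (modeTest n hχ f)) _
    (Filter.Eventually.of_forall fun p => K.h_modeTest m e n hχ f p)

/-- The adjoint of the embedding of each mode carries `u` to a deficiency vector of the reduced
operator, which is zero. So `u` is orthogonal to all modes. -/
theorem eq_zero_of_deficiency {m e : ℝ} {z : ℂ} (hz : z = Complex.I ∨ z = -Complex.I) {u : L2}
    (hu : ∀ Ψ : TestFunction, inner ℂ u (K.hL2 m e Ψ) = z * inner ℂ u (TestFunction.toL2 Ψ)) :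
    u = 0 := by
  refine eq_zero_of_inner_modes fun n g f hg hf => ?_
  obtain ⟨J, hJ⟩ := exists_modeMap n
  have hk : 1 / 2 ≤ |((n : ℝ) + 1 / 2)| := by
    rcases le_or_gt 0 n with hn | hn
    · have : (0 : ℝ) ≤ n := by exact_mod_cast hn
      rw [abs_of_nonneg (by linarith)]
      linarith
    · have : (n : ℝ) ≤ -1 := by exact_mod_cast (by omega : n ≤ -1)
      rw [abs_of_neg (by linarith)]
      linarith
  have h0 : ContinuousLinearMap.adjoint J u = 0 := by
    refine K.mode_deficiency (m := m) (e := e) hk hz fun χ hχ f => ?_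
    rw [ContinuousLinearMap.adjoint_inner_left, ContinuousLinearMap.adjoint_inner_left,
      ← K.hL2_modeTest m e n hχ f hJ, hu]
    congr 2
    exact (toL2_modeTest n hχ f hJ)
  rw [← hJ g f hg hf, ← ContinuousLinearMap.adjoint_inner_left, h0, inner_zero_left]

end Exterior

theorem TestFunction.total {u : L2} (hu : ∀ Ψ : TestFunction, inner ℂ u (toL2 Ψ) = 0) : u = 0 := by
  refine eq_zero_of_inner_modes fun n g f hg hf => ?_
  obtain ⟨J, hJ⟩ := exists_modeMap n
  have : Fact ((2 : ENNReal) ≠ ⊤) := ⟨by simp⟩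
  have hd : Dense (LinearMap.range angTest.toL2 : Set AngL2) := by
    rw [Submodule.dense_iff_topologicalClosure_eq_top, Submodule.topologicalClosure_eq_top_iff,
      Submodule.eq_bot_iff]
    exact fun v hv => angTest_total fun f =>
      (Submodule.mem_orthogonal' _ _).1 hv _ (LinearMap.mem_range_self _ f)
  have h0 : ContinuousLinearMap.adjoint J u = 0 := by
    refine eq_zero_of_inner_tens_lineTest hd ?_
    rintro _ ⟨f, rfl⟩ χ hχ
    rw [ContinuousLinearMap.adjoint_inner_left, ← hu (modeTest n hχ f)]
    rw [toL2_modeTest n hχ f hJ]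
  rw [← hJ g f hg hf, ← ContinuousLinearMap.adjoint_inner_left, h0, inner_zero_left]

end KerrNewman

/-! ## Vanishing iterated integrals -/

section Fubini

variable {α β γ : Type*} [MeasurableSpace α] [MeasurableSpace β] [MeasurableSpace γ]
  {μ : Measure α} {ν : Measure β} {ρ : Measure γ} [SFinite μ] [SFinite ν] [SFinite ρ]
  {G : α × β × γ → ℂ}

theorem integral_eq_zero_of_integral_fst (h : ∀ y z, ∫ x, G (x, y, z) ∂μ = 0)
    (hG : Integrable G (μ.prod (ν.prod ρ))) :
    ∫ p, G p ∂μ.prod (ν.prod ρ) = 0 := by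
  rw [integral_prod_symm _ hG]
  exact integral_eq_zero_of_ae (Filter.Eventually.of_forall fun q => h q.1 q.2)

theorem integral_eq_zero_of_integral_mid (h : ∀ x z, ∫ y, G (x, y, z) ∂ν = 0)
    (hG : Integrable G (μ.prod (ν.prod ρ))) :
    ∫ p, G p ∂μ.prod (ν.prod ρ) = 0 := by
  rw [integral_prod _ hG]
  refine integral_eq_zero_of_ae ?_
  filter_upwards [hG.prod_right_ae] with x hx
  rw [integral_prod_symm _ hx]
  exact integral_eq_zero_of_ae (Filter.Eventually.of_forall fun z => h x z)

theorem integral_eq_zero_of_integral_snd (h : ∀ x y, ∫ z, G (x, y, z) ∂ρ = 0)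
    (hG : Integrable G (μ.prod (ν.prod ρ))) :
    ∫ p, G p ∂μ.prod (ν.prod ρ) = 0 := by
  rw [integral_prod _ hG]
  refine integral_eq_zero_of_ae ?_
  filter_upwards [hG.prod_right_ae] with x hx
  rw [integral_prod _ hx]
  exact integral_eq_zero_of_ae (Filter.Eventually.of_forall fun y => h x y)

end Fubini

namespace KerrNewman

/-! ## Symmetry -/

theorem integrable_of_support {G : ℝ × ℝ × ℝ → ℂ}
    (hG : ContinuousOn G (univ ×ˢ Ioo 0 Real.pi ×ˢ univ))
    {C : Set (ℝ × ℝ)} (hC : IsCompact C) (hCs : C ⊆ univ ×ˢ Ioo 0 Real.pi)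
    (h0 : ∀ x θ φ, (x, θ) ∉ C → G (x, θ, φ) = 0) : Integrable G (volume.restrict Ω₃) := by
  let L : Set (ℝ × ℝ × ℝ) :=
    (fun q : (ℝ × ℝ) × ℝ => (q.1.1, q.1.2, q.2)) '' (C ×ˢ Icc 0 (2 * Real.pi))
  have hL : IsCompact L := (hC.prod isCompact_Icc).image (by fun_prop)
  have hLU : L ⊆ univ ×ˢ Ioo 0 Real.pi ×ˢ univ := by
    rintro _ ⟨⟨⟨x, θ⟩, φ⟩, ⟨hq, -⟩, rfl⟩
    exact ⟨trivial, (hCs hq).2, trivial⟩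
  have h1 : IntegrableOn G L := (hG.mono hLU).integrableOn_compact hL
  refine h1.of_forall_sdiff_eq_zero measurableSet_Ω₃ ?_
  rintro ⟨x, θ, φ⟩ ⟨⟨-, -, hφ⟩, hL'⟩
  exact h0 x θ φ fun hx => hL' ⟨((x, θ), φ), ⟨hx, Ico_subset_Icc_self hφ⟩, rfl⟩

/-- Smooth scalar functions, periodic in `φ`, which vanish for `(x, θ)` outside a compact set. -/
structure IsPeriodicTest (F : ℝ × ℝ × ℝ → ℂ) : Prop where
  contDiff : ContDiff ℝ ∞ F
  periodic : ∀ x θ φ, F (x, θ, φ + 2 * Real.pi) = F (x, θ, φ)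
  exists_support : ∃ C : Set (ℝ × ℝ), IsCompact C ∧ C ⊆ univ ×ˢ Ioo 0 Real.pi ∧
    ∀ x θ φ, (x, θ) ∉ C → F (x, θ, φ) = 0

namespace IsPeriodicTest

variable {F : ℝ × ℝ × ℝ → ℂ} (hF : IsPeriodicTest F)

theorem differentiable (hF : IsPeriodicTest F) : Differentiable ℝ F :=
  hF.contDiff.differentiable (by simp)

theorem integrable_mul_fderiv (hF : IsPeriodicTest F) {c : ℝ × ℝ × ℝ → ℂ}
    (hc : ContinuousOn c (univ ×ˢ Ioo 0 Real.pi ×ˢ univ)) (v : ℝ × ℝ × ℝ) :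
    Integrable (fun p => c p * fderiv ℝ F p v) (volume.restrict Ω₃) := by
  obtain ⟨C, hC, hCs, h0⟩ := hF.exists_support
  have h1 : Continuous fun p => fderiv ℝ F p v :=
    (hF.contDiff.continuous_fderiv (by simp)).clm_apply continuous_const
  refine integrable_of_support (hc.mul h1.continuousOn) hC hCs fun x θ φ hx => ?_
  have hev : F =ᶠ[nhds (x, θ, φ)] fun _ => 0 := by
    have hopen : IsOpen ((fun q : ℝ × ℝ × ℝ => (q.1, q.2.1)) ⁻¹' Cᶜ) :=
      hC.isClosed.isOpen_compl.preimage (by fun_prop)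
    filter_upwards [hopen.mem_nhds (show (x, θ, φ) ∈ _ from hx)] with q hq
    exact h0 q.1 q.2.1 q.2.2 hq
  rw [hev.fderiv_eq, fderiv_fun_const]
  simp

theorem isTest_fst (hF : IsPeriodicTest F) (θ φ : ℝ) :
    IsTest univ (fun x => F (x, θ, φ)) := by
  obtain ⟨C, hC, hCs, h0⟩ := hF.exists_support
  refine ⟨hF.contDiff.comp (by fun_prop), ?_, subset_univ _⟩
  refine HasCompactSupport.intro (hC.image continuous_fst) fun x hx => h0 x θ φ fun h => hx ?_
  exact ⟨_, h, rfl⟩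

theorem isTest_snd (hF : IsPeriodicTest F) (x φ : ℝ) :
    IsTest (Ioo 0 Real.pi) (fun θ => F (x, θ, φ)) := by
  obtain ⟨C, hC, hCs, h0⟩ := hF.exists_support
  have hK : IsCompact (Prod.snd '' C) := hC.image continuous_snd
  have h1 : ∀ θ ∉ Prod.snd '' C, F (x, θ, φ) = 0 := fun θ hx => h0 x θ φ fun h => hx ⟨_, h, rfl⟩
  refine ⟨hF.contDiff.comp (by fun_prop), HasCompactSupport.intro hK h1, ?_⟩
  refine (closure_minimal (fun θ hθ => ?_) hK.isClosed).trans ?_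
  · by_contra h
    exact hθ (h1 θ h)
  · rintro _ ⟨q, hq, rfl⟩
    exact (hCs hq).2

theorem integral_fderiv_fst (hF : IsPeriodicTest F) :
    ∫ p in Ω₃, fderiv ℝ F p (1, 0, 0) = 0 := by
  have h1 := hF.integrable_mul_fderiv (c := fun _ => 1) continuousOn_const (1, 0, 0)
  simp only [one_mul] at h1
  rw [restrict_Ω₃] at h1 ⊢
  refine integral_eq_zero_of_integral_fst (fun θ φ => ?_) h1
  rw [← (hF.isTest_fst θ φ).integral_deriv_eq_zero]
  refine integral_congr_ae (Filter.Eventually.of_forall fun x => ?_)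
  exact ((hF.differentiable (x, θ, φ)).hasFDerivAt.comp_hasDerivAt x
    ((hasDerivAt_id x).prodMk ((hasDerivAt_const _ _).prodMk (hasDerivAt_const _ _)))).deriv.symm

/-- The coefficient depends on `x` alone, so it is a constant in the inner integral over `θ`. With
`c = w` this handles the `θ`-derivative in the operator. -/
theorem integral_fderiv_snd (hF : IsPeriodicTest F) {c : ℝ → ℂ} (hc : Continuous c) :
    ∫ p in Ω₃, c p.1 * fderiv ℝ F p (0, 1, 0) = 0 := by
  have h1 := hF.integrable_mul_fderiv (c := fun p => c p.1)
    (hc.comp continuous_fst).continuousOn (0, 1, 0)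
  rw [restrict_Ω₃] at h1 ⊢
  refine integral_eq_zero_of_integral_mid (fun x φ => ?_) h1
  have h2 := (hF.isTest_snd x φ).deriv.setIntegral_eq
    (g := fun θ => c x * deriv (fun θ => F (x, θ, φ)) θ) (by simp +contextual)
  refine Eq.trans ?_ (h2.trans ?_)
  rotate_left
  · rw [integral_const_mul, (hF.isTest_snd x φ).integral_deriv_eq_zero, mul_zero]
  refine integral_congr_ae (Filter.Eventually.of_forall fun θ => congrArg (c x * ·) ?_)
  exact ((hF.differentiable (x, θ, φ)).hasFDerivAt.comp_hasDerivAt θ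
    ((hasDerivAt_const _ _).prodMk ((hasDerivAt_id θ).prodMk (hasDerivAt_const _ _)))).deriv.symm

/-- The coefficient is constant in `φ`, and the boundary values at `0` and `2π` agree by
periodicity. Continuity for `0 < θ < π` suffices, which admits the factor `1 / sin θ`. -/
theorem integral_fderiv_trd (hF : IsPeriodicTest F) {c : ℝ × ℝ → ℂ}
    (hc : ContinuousOn c (univ ×ˢ Ioo 0 Real.pi)) :
    ∫ p in Ω₃, c (p.1, p.2.1) * fderiv ℝ F p (0, 0, 1) = 0 := by
  have h1 := hF.integrable_mul_fderiv (c := fun p => c (p.1, p.2.1))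
    (hc.comp (by fun_prop) fun p hp => ⟨trivial, hp.2.1⟩) (0, 0, 1)
  rw [restrict_Ω₃] at h1 ⊢
  refine integral_eq_zero_of_integral_snd (fun x θ => ?_) h1
  have hd : ∀ φ, HasDerivAt (fun φ => F (x, θ, φ)) (fderiv ℝ F (x, θ, φ) (0, 0, 1)) φ := fun φ =>
    (hF.differentiable (x, θ, φ)).hasFDerivAt.comp_hasDerivAt φ
      ((hasDerivAt_const _ _).prodMk ((hasDerivAt_const _ _).prodMk (hasDerivAt_id φ)))
  have hcont : Continuous fun φ => fderiv ℝ F (x, θ, φ) (0, 0, 1) :=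
    ((hF.contDiff.continuous_fderiv (by simp)).comp (by fun_prop)).clm_apply continuous_const
  change ∫ φ in Ico 0 (2 * Real.pi), c (x, θ) * fderiv ℝ F (x, θ, φ) (0, 0, 1) = 0
  rw [integral_const_mul, integral_Ico_eq_integral_Ioo, ← integral_Ioc_eq_integral_Ioo,
    ← intervalIntegral.integral_of_le Real.two_pi_pos.le,
    intervalIntegral.integral_eq_sub_of_hasDerivAt (fun φ _ => hd φ)
      (hcont.intervalIntegrable _ _)]
  have := hF.periodic x θ 0
  rw [zero_add] at this
  rw [this, sub_self, mul_zero]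

end IsPeriodicTest

theorem integrable_inner_of_memLp {α : Type*} [MeasurableSpace α] {μ : Measure α} {f g : α → Spinor}
    (hf : MemLp f 2 μ) (hg : MemLp g 2 μ) : Integrable (fun x => inner ℂ (f x) (g x)) μ := by
  refine (L2.integrable_inner (𝕜 := ℂ) (hf.toLp f) (hg.toLp g)).congr ?_
  filter_upwards [hf.coeFn_toLp, hg.coeFn_toLp] with x h1 h2
  rw [h1, h2]

theorem isPeriodicTest_inner (Ψ Φ : TestFunction) (A : Spinor →L[ℂ] Spinor) :
    IsPeriodicTest fun p =>
      inner ℂ ((Ψ : ℝ × ℝ × ℝ → Spinor) p) (A ((Φ : ℝ × ℝ × ℝ → Spinor) p)) := by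
  obtain ⟨-, h1, C, hC, hCs, h0⟩ := Ψ.2
  refine ⟨Ψ.contDiff.inner ℂ ((A.restrictScalars ℝ).contDiff.comp Φ.contDiff), fun x θ φ => ?_,
    C, hC, hCs, fun x θ φ hx => ?_⟩
  · rw [h1, Φ.2.2.1, map_neg, inner_neg_neg]
  · rw [h0 x θ φ hx, inner_zero_left]

theorem fderiv_inner_act (Ψ Φ : TestFunction) (A : Spinor →L[ℂ] Spinor) (p v : ℝ × ℝ × ℝ) :
    fderiv ℝ (fun p => inner ℂ ((Ψ : ℝ × ℝ × ℝ → Spinor) p)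
      (A ((Φ : ℝ × ℝ × ℝ → Spinor) p))) p v
      = inner ℂ ((Ψ : ℝ × ℝ × ℝ → Spinor) p) (A (fderiv ℝ (Φ : ℝ × ℝ × ℝ → Spinor) p v))
        + inner ℂ (fderiv ℝ (Ψ : ℝ × ℝ × ℝ → Spinor) p v) (A ((Φ : ℝ × ℝ × ℝ → Spinor) p)) := by
  have h1 := (Ψ.differentiable p).hasFDerivAt.inner ℂ
    ((A.restrictScalars ℝ).hasFDerivAt.comp p (Φ.differentiable p).hasFDerivAt)
  have h2 := congrArg (fun T : (ℝ × ℝ × ℝ) →L[ℝ] ℂ => T v) h1.fderiv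
  exact h2

namespace Exterior

variable (K : Exterior)

/-- All matrices are Hermitian and all coefficients real, so the terms of order zero cancel and the
first-order terms combine by the product rule. -/
theorem inner_h_sub (m e : ℝ) (Ψ Φ : TestFunction) (p : ℝ × ℝ × ℝ) :
    inner ℂ ((Ψ : ℝ × ℝ × ℝ → Spinor) p) (K.h m e Φ p)
      - inner ℂ (K.h m e Ψ p) ((Φ : ℝ × ℝ × ℝ → Spinor) p)
    = -Complex.I * (fderiv ℝ (fun p => inner ℂ ((Ψ : ℝ × ℝ × ℝ → Spinor) p)
        (act (diagBlock σ₃) ((Φ : ℝ × ℝ × ℝ → Spinor) p))) p (1, 0, 0)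
      + (K.w p.1 : ℂ) * fderiv ℝ (fun p => inner ℂ ((Ψ : ℝ × ℝ × ℝ → Spinor) p)
        (act (diagBlock σ₁) ((Φ : ℝ × ℝ × ℝ → Spinor) p))) p (0, 1, 0)
      + (K.w p.1 : ℂ) * ((1 / Real.sin p.2.1 : ℝ) : ℂ) *
        fderiv ℝ (fun p => inner ℂ ((Ψ : ℝ × ℝ × ℝ → Spinor) p)
        (act (diagBlock σ₂) ((Φ : ℝ × ℝ × ℝ → Spinor) p))) p (0, 0, 1)
      + ((1 / (K.r p.1 ^ 2 + K.a ^ 2) : ℝ) : ℂ) * (K.a : ℂ) *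
        fderiv ℝ (fun p => inner ℂ ((Ψ : ℝ × ℝ × ℝ → Spinor) p)
        (ContinuousLinearMap.id ℂ Spinor ((Φ : ℝ × ℝ × ℝ → Spinor) p))) p (0, 0, 1)) := by
  have s1 := inner_act_diagBlock isHermitian_σ₁
  have s2 := inner_act_diagBlock isHermitian_σ₂
  have s3 := inner_act_diagBlock isHermitian_σ₃
  have s4 : ∀ u v, inner ℂ (act (block 0 1 1 0) u) v = inner ℂ u (act (block 0 1 1 0) v) :=
    inner_act_block_of_isHermitian (by simp [Matrix.IsHermitian])
      (by simp [Matrix.IsHermitian]) (by simp)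
  have s5 : ∀ u v, inner ℂ (act (block 0 (Complex.I • 1) (-Complex.I • 1) 0) u) v
      = inner ℂ u (act (block 0 (Complex.I • 1) (-Complex.I • 1) 0) v) :=
    inner_act_block_of_isHermitian (by simp [Matrix.IsHermitian])
      (by simp [Matrix.IsHermitian]) (by simp)
  rw [fderiv_inner_act, fderiv_inner_act, fderiv_inner_act, fderiv_inner_act]
  simp only [diagBlock] at s1 s2 s3 ⊢
  simp only [h, h₁, h₂, Ψ.dx_eq, Ψ.dθ_eq, Ψ.dφ_eq, Φ.dx_eq, Φ.dθ_eq, Φ.dφ_eq,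
    inner_add_left, inner_add_right, inner_sub_left, inner_sub_right, inner_neg_left,
    inner_neg_right, map_smul, inner_smul_left, inner_smul_right, Complex.conj_ofReal,
    Complex.conj_I, s1, s2, s3, s4, s5, ContinuousLinearMap.id_apply]
  ring

theorem inner_toL2_hL2 (m e : ℝ) (Ψ Φ : TestFunction) :
    inner ℂ (TestFunction.toL2 Ψ) (K.hL2 m e Φ) = inner ℂ (K.hL2 m e Ψ) (TestFunction.toL2 Φ) := by
  have cw : Continuous fun x => (K.w x : ℂ) := Complex.continuous_ofReal.comp K.w_continuous
  have cs : ContinuousOn (fun q : ℝ × ℝ => (K.w q.1 : ℂ) * ((1 / Real.sin q.2 : ℝ) : ℂ))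
      (univ ×ˢ Ioo 0 Real.pi) :=
    (cw.comp continuous_fst).continuousOn.mul
      (Complex.continuous_ofReal.comp_continuousOn (continuousOn_const.div (by fun_prop)
        fun q hq => (Real.sin_pos_of_mem_Ioo hq.2).ne'))
  have ca : Continuous (fun q : ℝ × ℝ => ((1 / (K.r q.1 ^ 2 + K.a ^ 2) : ℝ) : ℂ) * (K.a : ℂ)) :=
    (Complex.continuous_ofReal.comp (K.invSq_continuous.comp continuous_fst)).mul continuous_const
  have hm : MapsTo (fun p : ℝ × ℝ × ℝ => (p.1, p.2.1)) (univ ×ˢ Ioo 0 Real.pi ×ˢ univ)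
      (univ ×ˢ Ioo 0 Real.pi) := fun p hp => ⟨trivial, hp.2.1⟩
  have t1 := isPeriodicTest_inner Ψ Φ (act (diagBlock σ₁))
  have t2 := isPeriodicTest_inner Ψ Φ (act (diagBlock σ₂))
  have t3 := isPeriodicTest_inner Ψ Φ (act (diagBlock σ₃))
  have t4 := isPeriodicTest_inner Ψ Φ (ContinuousLinearMap.id ℂ Spinor)
  have i3 := t3.integrable_mul_fderiv (c := fun _ => 1) continuousOn_const (1, 0, 0)
  simp only [one_mul] at i3
  have i1 := t1.integrable_mul_fderiv (c := fun p => (K.w p.1 : ℂ))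
    (cw.comp continuous_fst).continuousOn (0, 1, 0)
  have i2 := t2.integrable_mul_fderiv (cs.comp (by fun_prop) hm) (0, 0, 1)
  have i4 := t4.integrable_mul_fderiv (ca.continuousOn.comp (by fun_prop) hm) (0, 0, 1)
  have e1 : inner ℂ (TestFunction.toL2 Ψ) (K.hL2 m e Φ)
      = ∫ p in Ω₃, inner ℂ ((Ψ : ℝ × ℝ × ℝ → Spinor) p) (K.h m e Φ p) :=
    inner_toLp Ψ.memLp (K.h_memLp m e Φ)
  have e2 : inner ℂ (K.hL2 m e Ψ) (TestFunction.toL2 Φ)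
      = ∫ p in Ω₃, inner ℂ (K.h m e Ψ p) ((Φ : ℝ × ℝ × ℝ → Spinor) p) :=
    inner_toLp (K.h_memLp m e Ψ) Φ.memLp
  rw [e1, e2, ← sub_eq_zero, ← integral_sub (integrable_inner_of_memLp Ψ.memLp (K.h_memLp m e Φ))
    (integrable_inner_of_memLp (K.h_memLp m e Ψ) Φ.memLp)]
  simp only [inner_h_sub]
  have i5 := i3.add i1
  -- The sums of integrable terms are assembled in the order of the pointwise formula, so that the
  -- integral splits into four integrals of derivatives, each of them zero.
  have i6 := i5.add i2
  rw [integral_const_mul]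
  refine mul_eq_zero_of_right _ ?_
  refine (integral_add i6 i4).trans ?_
  refine (congrArg₂ (· + ·) ((integral_add i5 i2).trans
    (congrArg (· + _) (integral_add i3 i1))) rfl).trans ?_
  rw [t3.integral_fderiv_fst, t1.integral_fderiv_snd cw]
  have e3 := t2.integral_fderiv_trd cs
  have e4 := t4.integral_fderiv_trd ca.continuousOn
  simp only [Function.comp_apply, zero_add] at e3 e4 ⊢
  rw [e3, e4, zero_add]

theorem isEssentiallySelfAdjoint_H₀ (m e : ℝ) : IsEssentiallySelfAdjoint (K.H₀ m e) :=
  isEssentiallySelfAdjoint_operatorOnTestFunctions _ _ _ (fun _ hu => TestFunction.total hu)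
    (K.inner_toL2_hL2 m e) fun _ hz _ hu => K.eq_zero_of_deficiency hz hu

end Exterior

end KerrNewman

namespace KerrNewman.Exterior

/-! ## The weighted space -/

variable (K : Exterior)

/-- Multiplication by `S` in `L²(Ω₃)⁴`. -/
def SL2 (f : L2) : L2 := (K.act_S_memLp (Lp.memLp f)).toLp _

theorem inner_toL2S (f g : L2) : inner ℂ (K.toL2S f) (K.toL2S g) = inner ℂ f (K.SL2 g) := by
  rw [inner_L2S, L2.inner_def]
  refine integral_congr_ae ?_
  filter_upwards [MemLp.coeFn_toLp (K.act_S_memLp (Lp.memLp g))] with p hp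
  rw [SL2, hp]

theorem inner_SL2 (f g : L2) : inner ℂ (K.SL2 f) g = inner ℂ f (K.SL2 g) := by
  rw [← inner_toL2S, ← inner_conj_symm, ← inner_toL2S, inner_conj_symm]

theorem S_mul_S_inv (p : ℝ × ℝ × ℝ) : K.S p * (K.S p)⁻¹ = 1 := by
  have h1 := K.abs_coeff_le p
  rw [S_inv, S]
  generalize K.a * K.w p.1 * Real.sin p.2.1 = c at *
  have h2 : (1 - c ^ 2 : ℝ) ≠ 0 := by
    have := abs_le.1 h1
    nlinarith
  have h3 : (1 - (c : ℂ) ^ 2) ≠ 0 := by exact_mod_cast h2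
  rw [mul_smul_comm, mul_sub, mul_one, add_mul, one_mul, smul_mul_assoc, mul_smul_comm,
    block_mul_self]
  push_cast
  match_scalars <;> field_simp
  ring

theorem act_S_act_S_inv (p : ℝ × ℝ × ℝ) (v : Spinor) : act (K.S p) (act (K.S p)⁻¹ v) = v := by
  rw [act_act, S_mul_S_inv, act, map_one]
  rfl

theorem act_S_inv_act_S (p : ℝ × ℝ × ℝ) (v : Spinor) : act (K.S p)⁻¹ (act (K.S p) v) = v := by
  rw [act_act, mul_eq_one_comm.1 (K.S_mul_S_inv p), act, map_one]
  rfl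

theorem SL2_Sinv_h (m e : ℝ) (Ψ : TestFunction) :
    K.SL2 ((K.Sinv_h_memLp m e Ψ).toLp _) = K.hL2 m e Ψ := by
  refine MemLp.toLp_congr _ (K.h_memLp m e Ψ) ?_
  filter_upwards [(K.Sinv_h_memLp m e Ψ).coeFn_toLp] with p hp
  rw [hp, act_S_act_S_inv]

/-- The weight `S` of the scalar product cancels `S⁻¹`. Symmetry and deficiency of `S⁻¹ H₀` in the
weighted space thereby become statements about `H₀` in `L²(Ω₃)⁴`. -/
theorem inner_SinvhL2S (m e : ℝ) (f : L2) (Ψ : TestFunction) :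
    inner ℂ (K.toL2S f) (K.SinvhL2S m e Ψ) = inner ℂ f (K.hL2 m e Ψ) := by
  rw [← SL2_Sinv_h, ← inner_toL2S]
  rfl

theorem isEssentiallySelfAdjoint_SinvH₀ (m e : ℝ) : IsEssentiallySelfAdjoint (K.SinvH₀ m e) := by
  refine isEssentiallySelfAdjoint_operatorOnTestFunctions _ _ _ (fun u hu => ?_) (fun Ψ Φ => ?_)
    fun z hz u hu => ?_
  · obtain ⟨v, rfl⟩ := K.toL2S.surjective u
    have h0 : K.SL2 v = 0 := TestFunction.total fun Ψ => by
      rw [inner_SL2, ← inner_toL2S]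
      exact hu Ψ
    rw [← inner_self_eq_zero (𝕜 := ℂ), inner_toL2S, h0, inner_zero_right]
  · change inner ℂ (K.toL2S (TestFunction.toL2 Ψ)) _ = inner ℂ _ (K.toL2S (TestFunction.toL2 Φ))
    rw [inner_SinvhL2S, inner_toL2_hL2, ← inner_conj_symm, ← inner_SinvhL2S, inner_conj_symm]
  · obtain ⟨v, rfl⟩ := K.toL2S.surjective u
    have hG : HasRealAdjoint (LinearMap.range (TestFunction.toL2.prod (K.hL2 m e))) := by
      refine IsSymmRel.hasRealAdjoint ?_ fun z hz u hu =>
        K.eq_zero_of_deficiency hz fun Ψ => hu _ ⟨Ψ, rfl⟩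
      rintro _ ⟨Ψ, rfl⟩ _ ⟨Φ, rfl⟩
      exact K.inner_toL2_hL2 m e Ψ Φ
    -- In the unweighted space a deficiency vector satisfies `H₀* v = z̄ S v`. Since the form of
    -- `H₀*` is real and `(v, S v)` is the squared weighted norm, that norm vanishes.
    have h1 : IsAdjPair (LinearMap.range (TestFunction.toL2.prod (K.hL2 m e))) v
        ((starRingEnd ℂ) z • K.SL2 v) := by
      rintro _ ⟨Ψ, rfl⟩
      change inner ℂ v (K.hL2 m e Ψ) = inner ℂ _ (TestFunction.toL2 Ψ)
      rw [← inner_SinvhL2S, inner_smul_left, Complex.conj_conj, inner_SL2, ← inner_toL2S]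
      exact hu Ψ
    have h2 := hG _ _ h1
    rw [inner_smul_right, ← inner_toL2S, inner_self_eq_norm_sq_to_K] at h2
    have h4 : ‖K.toL2S v‖ ^ 2 = 0 := by
      rcases hz with rfl | rfl <;> simpa [← Complex.ofReal_pow, Complex.mul_im] using h2
    simpa using h4

end KerrNewman.Exterior

namespace KerrNewman

theorem sqrt_sin_pos {θ : ℝ} (hθ : θ ∈ Ioo 0 Real.pi) : 0 < Real.sqrt (Real.sin θ) :=
  Real.sqrt_pos.2 (Real.sin_pos_of_mem_Ioo hθ)

/-- The logarithmic derivative of `(sin θ)^{1/2}` is the zeroth-order term of the angular operators,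
which is the reason for the rescaling. -/
theorem hasDerivAt_sqrt_sin {θ : ℝ} (hθ : θ ∈ Ioo 0 Real.pi) :
    HasDerivAt (fun θ => Real.sqrt (Real.sin θ))
      (Real.sqrt (Real.sin θ) * (Real.cot θ / 2)) θ := by
  have h0 := Real.sin_pos_of_mem_Ioo hθ
  refine ((Real.hasDerivAt_sin θ).sqrt h0.ne').congr_deriv ?_
  have h1 := Real.sq_sqrt h0.le
  have h2 := (sqrt_sin_pos hθ).ne'
  rw [Real.cot_eq_cos_div_sin]
  field_simp
  rw [h1]

theorem contDiffOn_sqrt_sin : ContDiffOn ℝ ∞ (fun θ => Real.sqrt (Real.sin θ)) (Ioo 0 Real.pi) :=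
  Real.contDiff_sin.contDiffOn.sqrt fun _ hθ => (Real.sin_pos_of_mem_Ioo hθ).ne'

namespace Exterior

variable (K : Exterior)

/-! ## Smoothness of the tortoise coordinate -/

theorem contDiffOn_x : ContDiffOn ℝ ∞ K.x (Ioi K.rPlus) := by
  refine (contDiffOn_infty_iff_deriv_of_isOpen isOpen_Ioi).2 ⟨fun s hs =>
    (K.x_hasDerivAt s hs).differentiableAt.differentiableWithinAt, ?_⟩
  have h1 : ContDiffOn ℝ ∞ (fun s => (s ^ 2 + K.a ^ 2) / K.Δ s) (Ioi K.rPlus) := by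
    refine ContDiffOn.div (by fun_prop) ?_ fun s hs => (K.Δ_pos hs).ne'
    unfold Δ Delta
    fun_prop
  exact h1.congr fun s hs => (K.x_hasDerivAt s hs).deriv

theorem hasDerivAt_r (y : ℝ) : HasDerivAt K.r (K.Δ (K.r y) / (K.r y ^ 2 + K.a ^ 2)) y := by
  have h0 := K.rPlus_lt_r y
  have h1 : HasDerivAt K.x _ (K.r y) := K.x_hasDerivAt _ h0
  have h2 : (K.r y ^ 2 + K.a ^ 2) / Delta K.M K.Q K.a (K.r y) ≠ 0 :=
    (div_pos (K.sq_add_sq_pos h0) (K.Δ_pos h0)).ne'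
  refine (h1.of_local_left_inverse K.r_continuous.continuousAt h2
    (Filter.Eventually.of_forall K.x_r)).congr_deriv ?_
  rw [inv_div]
  rfl

/-- Bootstrapping in the equation `r' = Δ(r) / (r² + a²)`: the right side is as smooth as `r`
itself. -/
theorem contDiff_r : ContDiff ℝ ∞ K.r := by
  refine contDiff_infty.2 fun n => ?_
  induction n with
  | zero => exact contDiff_zero.2 K.r_continuous
  | succ n ih =>
    rw [Nat.cast_succ]
    refine contDiff_succ_iff_deriv.2 ⟨fun y => (K.hasDerivAt_r y).differentiableAt, by simp, ?_⟩
    have h1 : deriv K.r = fun y => K.Δ (K.r y) / (K.r y ^ 2 + K.a ^ 2) :=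
      funext fun y => (K.hasDerivAt_r y).deriv
    rw [h1]
    refine ContDiff.div ?_ (by fun_prop) fun y => (K.sq_add_sq_pos (K.rPlus_lt_r y)).ne'
    unfold Δ Delta
    fun_prop

/-! ## The change of variables -/

theorem isOpen_region : IsOpen K.region := isOpen_Ioi.prod (isOpen_Ioo.prod isOpen_univ)

theorem contDiffOn_rescale {k : ℕ∞} {Ψ : ℝ × ℝ × ℝ × ℝ → Spinor}
    (hΨ : ContDiffOn ℝ k Ψ K.region) : ContDiffOn ℝ k (K.rescale Ψ) tortoiseRegion := by
  have hk : (k : WithTop ℕ∞) ≤ ∞ := by exact_mod_cast le_top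
  have h1 : ContDiffOn ℝ k (fun p : ℝ × ℝ × ℝ × ℝ => (Real.sqrt (Real.sin p.2.1) : ℂ))
      tortoiseRegion :=
    (Complex.ofRealCLM.contDiff.comp_contDiffOn (contDiffOn_sqrt_sin.of_le hk)).comp
      (contDiff_fst.comp contDiff_snd).contDiffOn fun p hp => hp.2.1
  have h2 : ContDiff ℝ k (fun p : ℝ × ℝ × ℝ × ℝ => (K.r p.1, p.2)) :=
    ((K.contDiff_r.of_le hk).comp contDiff_fst).prodMk contDiff_snd
  exact h1.smul (hΨ.comp h2.contDiffOn fun p hp => ⟨K.rPlus_lt_r _, hp.2⟩)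

theorem eq_smul_rescale (Ψ : ℝ × ℝ × ℝ × ℝ → Spinor) {p : ℝ × ℝ × ℝ × ℝ} (hp : p ∈ K.region) :
    Ψ p = ((Real.sqrt (Real.sin p.2.1))⁻¹ : ℂ) • K.rescale Ψ (K.x p.1, p.2) := by
  obtain ⟨s, θ, φ, t⟩ := p
  have h1 : (Real.sqrt (Real.sin θ) : ℂ) ≠ 0 := by exact_mod_cast (sqrt_sin_pos hp.2.1).ne'
  rw [rescale, smul_smul, inv_mul_cancel₀ h1, one_smul, K.r_x hp.1]

theorem contDiffOn_of_rescale {k : ℕ∞} {Ψ : ℝ × ℝ × ℝ × ℝ → Spinor}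
    (hΨ : ContDiffOn ℝ k (K.rescale Ψ) tortoiseRegion) : ContDiffOn ℝ k Ψ K.region := by
  have hk : (k : WithTop ℕ∞) ≤ ∞ := by exact_mod_cast le_top
  have h1 : ContDiffOn ℝ k (fun p : ℝ × ℝ × ℝ × ℝ => ((Real.sqrt (Real.sin p.2.1))⁻¹ : ℂ))
      K.region := by
    refine (ContDiffOn.comp (t := Ioo 0 Real.pi) (g := fun θ => (Real.sqrt (Real.sin θ) : ℂ))
      (Complex.ofRealCLM.contDiff.comp_contDiffOn (contDiffOn_sqrt_sin.of_le hk))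
      (contDiff_fst.comp contDiff_snd).contDiffOn fun p hp => hp.2.1).inv fun p hp => ?_
    exact Complex.ofReal_ne_zero.2 (sqrt_sin_pos hp.2.1).ne'
  have h2 : ContDiffOn ℝ k (fun p : ℝ × ℝ × ℝ × ℝ => (K.x p.1, p.2)) K.region :=
    ((K.contDiffOn_x.of_le hk).comp contDiff_fst.contDiffOn fun p hp => hp.1).prodMk
      contDiff_snd.contDiffOn
  exact (h1.smul (hΨ.comp h2 fun p hp => ⟨trivial, hp.2⟩)).congr fun p hp => K.eq_smul_rescale Ψ hp

theorem isAntiperiodicOn_rescale_iff (Ψ : ℝ × ℝ × ℝ × ℝ → Spinor) :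
    IsAntiperiodicOn Ψ K.region ↔ IsAntiperiodicOn (K.rescale Ψ) tortoiseRegion := by
  constructor
  · intro h y θ φ t hp
    rw [rescale, rescale, ← smul_neg, h (K.r y) θ φ t ⟨K.rPlus_lt_r y, hp.2⟩]
  · intro h s θ φ t hp
    rw [K.eq_smul_rescale Ψ (p := (s, θ, φ + 2 * Real.pi, t)) ⟨hp.1, hp.2.1, trivial⟩,
      K.eq_smul_rescale Ψ hp, ← smul_neg]
    exact congrArg _ (h (K.x s) θ φ t ⟨trivial, hp.2⟩)

end Exterior

end KerrNewman

/-! ### Equivalence of the Dirac equation and the Cauchy problem -/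

namespace KerrNewman

theorem hasDerivAt_apply {f : ℝ → Spinor} {f' : Spinor} {x : ℝ} (hf : HasDerivAt f f' x)
    (i : Fin 4) : deriv (fun y => f y i) x = f' i :=
  (((EuclideanSpace.proj (𝕜 := ℂ) i).restrictScalars ℝ).hasFDerivAt.comp_hasDerivAt x hf).deriv

namespace Exterior

variable (K : Exterior)

theorem w_pos (x : ℝ) : 0 < K.w x :=
  div_pos (Real.sqrt_pos.2 (K.Δ_pos (K.rPlus_lt_r x))) (K.sq_add_sq_pos (K.rPlus_lt_r x))

/-- The equation `i S ∂_t Ψ = h Ψ` is obtained from the Dirac equation by exchanging components and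
multiplying them with nonzero factors. -/
theorem act_S_sub_h_rescale (m e : ℝ) {Ψ : ℝ × ℝ × ℝ × ℝ → Spinor} {x θ φ t : ℝ}
    (hθ : θ ∈ Ioo 0 Real.pi) (hΨ : DifferentiableAt ℝ Ψ (K.r x, θ, φ, t)) :
    act (K.S (x, θ, φ)) (Complex.I • deriv (fun t' => K.rescale Ψ (x, θ, φ, t')) t)
      - K.h m e (fun q => K.rescale Ψ (q.1, q.2.1, q.2.2, t)) (x, θ, φ)
    = ((Real.sqrt (Real.sin θ) * K.w x : ℝ) * Complex.I : ℂ) •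
      (let F := K.radialPart m e Ψ (K.r x, θ, φ, t) + K.angularPart m Ψ (K.r x, θ, φ, t)
      !₂[F 2, -F 3, -F 0, F 1]) := by
  obtain ⟨R, hR⟩ : ∃ R, HasDerivAt (fun s => Ψ (s, θ, φ, t)) R (K.r x) :=
    ⟨_, hΨ.hasFDerivAt.comp_hasDerivAt (K.r x) ((hasDerivAt_id (K.r x)).prodMk
      (hasDerivAt_const _ _))⟩
  obtain ⟨A, hA⟩ : ∃ A, HasDerivAt (fun θ => Ψ (K.r x, θ, φ, t)) A θ :=
    ⟨_, hΨ.hasFDerivAt.comp_hasDerivAt θ ((hasDerivAt_const _ _).prodMk ((hasDerivAt_id θ).prodMk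
      (hasDerivAt_const _ _)))⟩
  obtain ⟨B, hB⟩ : ∃ B, HasDerivAt (fun φ => Ψ (K.r x, θ, φ, t)) B φ :=
    ⟨_, hΨ.hasFDerivAt.comp_hasDerivAt φ ((hasDerivAt_const _ _).prodMk
      ((hasDerivAt_const _ _).prodMk ((hasDerivAt_id φ).prodMk (hasDerivAt_const _ _))))⟩
  obtain ⟨T, hT⟩ : ∃ T, HasDerivAt (fun t => Ψ (K.r x, θ, φ, t)) T t :=
    ⟨_, hΨ.hasFDerivAt.comp_hasDerivAt t ((hasDerivAt_const _ _).prodMk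
      ((hasDerivAt_const _ _).prodMk ((hasDerivAt_const _ _).prodMk (hasDerivAt_id t))))⟩
  have dT : deriv (fun t' => K.rescale Ψ (x, θ, φ, t')) t = (Real.sqrt (Real.sin θ) : ℂ) • T :=
    (hT.const_smul (Real.sqrt (Real.sin θ) : ℂ)).deriv
  have dB : dφ (fun q => K.rescale Ψ (q.1, q.2.1, q.2.2, t)) (x, θ, φ)
      = (Real.sqrt (Real.sin θ) : ℂ) • B := (hB.const_smul (Real.sqrt (Real.sin θ) : ℂ)).deriv
  have dA : dθ (fun q => K.rescale Ψ (q.1, q.2.1, q.2.2, t)) (x, θ, φ)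
      = (Real.sqrt (Real.sin θ) : ℂ) • A
        + ((Real.sqrt (Real.sin θ) * (Real.cot θ / 2) : ℝ) : ℂ) • Ψ (K.r x, θ, φ, t) :=
    ((hasDerivAt_sqrt_sin hθ).ofReal_comp.smul hA).deriv
  have dR : dx (fun q => K.rescale Ψ (q.1, q.2.1, q.2.2, t)) (x, θ, φ)
      = (Real.sqrt (Real.sin θ) : ℂ) •
        (((K.Δ (K.r x) / (K.r x ^ 2 + K.a ^ 2) : ℝ) : ℂ) • R) := by
    rw [Complex.coe_smul (K.Δ (K.r x) / (K.r x ^ 2 + K.a ^ 2))]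
    exact ((hR.scomp x (K.hasDerivAt_r x)).const_smul (Real.sqrt (Real.sin θ) : ℂ)).deriv
  have e0 : K.rescale Ψ (x, θ, φ, t) = (Real.sqrt (Real.sin θ) : ℂ) • Ψ (K.r x, θ, φ, t) := rfl
  have hδ : (Real.sqrt (K.Δ (K.r x)) : ℂ) ≠ 0 := by
    exact_mod_cast (Real.sqrt_pos.2 (K.Δ_pos (K.rPlus_lt_r x))).ne'
  -- Writing `Δ` as a square makes `√Δ` the only radical in the radial coefficients, so that
  -- clearing denominators leaves a polynomial identity modulo `i² = -1`.
  have hδ2 : (K.Δ (K.r x) : ℂ) = (Real.sqrt (K.Δ (K.r x)) : ℂ) ^ 2 := by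
    exact_mod_cast (Real.sq_sqrt (K.Δ_pos (K.rPlus_lt_r x)).le).symm
  have hρ : ((K.r x : ℂ) ^ 2 + (K.a : ℂ) ^ 2) ≠ 0 := by
    exact_mod_cast (K.sq_add_sq_pos (K.rPlus_lt_r x)).ne'
  have hs : Complex.sin θ ≠ 0 := by
    exact_mod_cast (Real.sin_pos_of_mem_Ioo hθ).ne'
  have hw : (K.w x : ℂ) = Real.sqrt (K.Δ (K.r x)) / ((K.r x : ℂ) ^ 2 + (K.a : ℂ) ^ 2) := by
    rw [w]; push_cast; rfl
  rw [h, h₁, h₂, dR, dA, dB, dT, e0, act_S]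
  simp only [act_block_apply, radialPart, angularPart, radialD, angularL, hasDerivAt_apply hR,
    hasDerivAt_apply hA, hasDerivAt_apply hB, hasDerivAt_apply hT, hδ2]
  generalize Ψ (K.r x, θ, φ, t) = P
  ext i
  fin_cases i <;>
  · simp [σ₁, σ₂, σ₃, hw, hδ2]
    field_simp
    ring_nf
    simp only [Complex.I_sq, Complex.I_pow_three]
    ring

/-- Applying the invertible matrix `S` removes `S⁻¹`; what remains differs from the Dirac expression
by the nonzero factor `i (sin θ)^{1/2} w` and a signed permutation of the components. -/
theorem dirac_iff_cauchy (m e : ℝ) {Ψ : ℝ × ℝ × ℝ × ℝ → Spinor} {x θ φ t : ℝ}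
    (hθ : θ ∈ Ioo 0 Real.pi) (hΨ : DifferentiableAt ℝ Ψ (K.r x, θ, φ, t)) :
    K.radialPart m e Ψ (K.r x, θ, φ, t) + K.angularPart m Ψ (K.r x, θ, φ, t) = 0
      ↔ Complex.I • deriv (fun t' => K.rescale Ψ (x, θ, φ, t')) t
        = act (K.S (x, θ, φ))⁻¹
          (K.h m e (fun q => K.rescale Ψ (q.1, q.2.1, q.2.2, t)) (x, θ, φ)) := by
  have h1 := K.act_S_sub_h_rescale m e hθ hΨ
  have hc : ((Real.sqrt (Real.sin θ) * K.w x : ℝ) * Complex.I : ℂ) ≠ 0 :=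
    mul_ne_zero (Complex.ofReal_ne_zero.2 (mul_pos (sqrt_sin_pos hθ) (K.w_pos x)).ne')
      Complex.I_ne_zero
  have h2 : ∀ v u : Spinor, v = act (K.S (x, θ, φ))⁻¹ u ↔ act (K.S (x, θ, φ)) v - u = 0 := by
    intro v u
    rw [sub_eq_zero]
    constructor
    · rintro rfl
      exact K.act_S_act_S_inv _ u
    · rintro rfl
      exact (K.act_S_inv_act_S _ v).symm
  rw [h2, h1, smul_eq_zero_iff_right hc]
  generalize K.radialPart m e Ψ (K.r x, θ, φ, t) + K.angularPart m Ψ (K.r x, θ, φ, t) = F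
  constructor
  · rintro rfl
    ext i
    fin_cases i <;> simp
  · intro h
    have h0 := congrArg (fun v : Spinor => v 0) h
    have h1 := congrArg (fun v : Spinor => v 1) h
    have h2 := congrArg (fun v : Spinor => v 2) h
    have h3 := congrArg (fun v : Spinor => v 3) h
    simp at h0 h1 h2 h3
    ext i
    fin_cases i <;> assumption

theorem isDiracSolution_iff (m e : ℝ) {k : ℕ∞} (hk : 1 ≤ k) (Ψ : ℝ × ℝ × ℝ × ℝ → Spinor) :
    K.IsDiracSolution m e k Ψ ↔ K.IsCauchySolution m e k (K.rescale Ψ) := by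
  have hk' : (k : WithTop ℕ∞) ≠ 0 := by
    rintro h
    have : k = 0 := by exact_mod_cast h
    simp [this] at hk
  -- The pointwise equivalence needs differentiability in all four variables; this is where `k ≥ 1`
  -- enters.
  have hd : ContDiffOn ℝ k Ψ K.region → ∀ p ∈ K.region, DifferentiableAt ℝ Ψ p := fun h p hp =>
    (h.differentiableOn hk').differentiableAt (K.isOpen_region.mem_nhds hp)
  constructor
  · rintro ⟨h1, h2⟩
    refine ⟨K.contDiffOn_rescale h1, fun x θ φ t hθ => ?_⟩
    have hp : (K.r x, θ, φ, t) ∈ K.region := ⟨K.rPlus_lt_r x, hθ, trivial⟩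
    exact (K.dirac_iff_cauchy m e hθ (hd h1 _ hp)).1 (h2 _ hp)
  · rintro ⟨h1, h2⟩
    have h3 := K.contDiffOn_of_rescale h1
    refine ⟨h3, fun ⟨s, θ, φ, t⟩ hp => ?_⟩
    obtain ⟨x, rfl⟩ : ∃ x, K.r x = s := ⟨K.x s, K.r_x hp.1⟩
    exact (K.dirac_iff_cauchy m e hp.2.1 (hd h3 _ hp)).2 (h2 x θ φ t hp.2.1)

end Exterior

end KerrNewman

end

theorem mainTheorem3 (K : KerrNewman.Exterior) (m e : ℝ) :
    Set.BijOn K.x (Set.Ioi K.rPlus) Set.univ ∧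
    (∀ Ψ : ℝ × ℝ × ℝ × ℝ → KerrNewman.Spinor,
      (∀ k : ℕ∞, 1 ≤ k →
        (K.IsDiracSolution m e k Ψ ↔ K.IsCauchySolution m e k (K.rescale Ψ))) ∧
      (KerrNewman.IsAntiperiodicOn Ψ K.region ↔
        KerrNewman.IsAntiperiodicOn (K.rescale Ψ) KerrNewman.tortoiseRegion)) ∧
    IsEssentiallySelfAdjoint (K.H₀ m e) ∧
    IsEssentiallySelfAdjoint (K.SinvH₀ m e) :=
  ⟨K.x_bijOn, fun Ψ => ⟨fun _ hk => K.isDiracSolution_iff m e hk Ψ,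
    K.isAntiperiodicOn_rescale_iff Ψ⟩, K.isEssentiallySelfAdjoint_H₀ m e,
    K.isEssentiallySelfAdjoint_SinvH₀ m e⟩
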